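/- **Theorem (incremental maintenance of $\mathrm{NRC}^+$ is in $\mathrm{NC}_0$).** *Setting.* $\mathrm{NRC}^+$ is the positive nested relational calculus on bags. Its types are $1$, $Base$, $A\times B$, $\mathrm{Bag}(C)$. Its expressions, all of bag type, are built from database relations, variables, $\mathsf{let}$, predicates on tuples of primitive values, $\mathsf{sng}(x)$, $\mathsf{sng}(\pi_i x)$, $\mathsf{sng}(\langle\rangle)$, $\mathsf{sng}(e)$, $\emptyset$, $\mathsf{for}\ldots\mathsf{union}$, $\times$, $\mathsf{flatten}$, $\uplus$ and $\ominus$. In *shredded form* a bag of type $\mathrm{Bag}(A)$ is a flat bag, in which every inner bag is replaced by a label, together with one dictionary (with a support set of labels) for each inner bag type of $A$, mapping labels to flat bags. The shredding transformation turns a query $h:\mathrm{Bag}(B)$ into a flat query $h^F$ and a tuple $h^\Gamma$ of dictionaries over the shredded database; each occurrence $\mathsf{sng}_\iota(e)$ creates labels $\langle\iota,\varepsilon\rangle$, $\varepsilon$ being the assignment to the $\mathsf{for}$-variables in scope, with dictionary $\langle\iota,\varepsilon\rangle\mapsto e^F(\varepsilon)$. Multiplicities are taken modulo $2^k$, $k\ge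 1$. For an active domain of $n$ primitive values and $m$ database labels, the *natural bit sequence representation* has, in a canonical order, $k$ bits for each tuple constructible from the active domain and the label set according to the schema (for a dictionary: for each pair of a label and a possible element) and one bit per label for each support set. These groups of bits are called cells. *Maintenance.* For all schemas, queries $h$ of $\mathrm{NRC}^+$ and $k\ge1$, there are finitely many auxiliary materialized views (flat bags of fixed schemas, determined by the active domain and the current shredded database, and stored in the same representation) such that for every constant $c$ there are a constant $d$, a polynomial size bound, and a LOGSPACE machine with the following property. For all $n,m$ and all choices $p$ of $c$ cells of the database, the machine prints, on input $n,m$ (in unary) and $p$, a Boolean circuit of fan-in at most $2$, depth at most $d$, and size polynomial in its number of inputs. For every active domain of $n$ primitive values, every shredded database $D$ and every shredded update $\Delta D$ over it that vanishes outside the cells $p$, this circuit maps the bits of the views $(h^F,h^\Gamma)(D)$ and of the auxiliary views at $D$, together with the bits of the $c$ cells $p$ of $\Delta D$, to the bits of all these views at $D\uplus\Delta D$. *Contrast.* If $Base$ is infinite, re-evaluation is not in $\mathrm{NC}_0$, even over flat inputs: there are a flat schema and a query such that, for every $k\ge1$, no family of bounded-fan-in circuits of constant depth (uniform or not) computes the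 bits of the view of the query from the bits of the database. -/

import Mathlib

namespace NRC

/-! ### Types and terms of the positive nested relational calculus on bags -/

/-- Types `1 | Base | A × B | Bag(C)`. -/
inductive Ty : Type
  | unit : Ty
  | base : Ty
  | prod : Ty → Ty → Ty
  | bag : Ty → Ty

/-- Nested tuple types all of whose components are `Base` (the argument types of predicates, and
the row types of flat relations). -/
def Ty.IsTBase : Ty → Prop
  | .unit => True
  | .base => True
  | .prod A B => A.IsTBase ∧ B.IsTBase
  | .bag _ => False

/-- Typed variables (de Bruijn). -/
inductive Var : List Ty → Ty → Type
  | zero {Γ : List Ty} {A : Ty} : Var (A :: Γ) A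
  | succ {Γ : List Ty} {A B : Ty} : Var Γ A → Var (B :: Γ) A

def Var.idx : {Γ : List Ty} → {A : Ty} → Var Γ A → ℕ
  | _, _, .zero => 0
  | _, _, .succ x => x.idx + 1

/-- Flat values: tuples of primitive values and labels.  A label is either `inp j`, a label of an
inner bag of the database, or `lab ι ε`, the label `⟨ι, ε⟩` that the `ι`-th singleton construct of
a query creates under the assignment `ε` of the `for`-bound variables in scope. -/
inductive FVal (Base : Type) : Type
  | unit : FVal Base
  | base : Base → FVal Base
  | pair : FVal Base → FVal Base → FVal Base
  | inp : ℕ → FVal Base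
  | lab : ℕ → List (FVal Base) → FVal Base

def FVal.fst {Base : Type} : FVal Base → FVal Base
  | .pair a _ => a
  | _ => .unit

def FVal.snd {Base : Type} : FVal Base → FVal Base
  | .pair _ b => b
  | _ => .unit

/-- `Term Base S Γ Θ B` is the set of well-typed expressions `Γ; Θ ⊢ e : Bag(B)` over a database
with relations `R i : Bag(S i)`.  `Γ` types the `let`-bound variables (an entry `C` stands for
`X : Bag(C)`), `Θ` types the `for`-bound variables. Predicates are arbitrary predicates on tuples
of primitive values. -/
inductive Term (Base : Type) {r : ℕ} (S : Fin r → Ty) : List Ty → List Ty → Ty → Type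
  | rel {Γ Θ : List Ty} (i : Fin r) : Term Base S Γ Θ (S i)
  | letIn {Γ Θ : List Ty} {C B : Ty} :
      Term Base S Γ Θ C → Term Base S (C :: Γ) Θ B → Term Base S Γ Θ B
  | var {Γ Θ : List Ty} {C : Ty} : Var Γ C → Term Base S Γ Θ C
  | pred {Γ Θ : List Ty} {A : Ty} (x : Var Θ A) (hA : A.IsTBase) (P : FVal Base → Bool) :
      Term Base S Γ Θ .unit
  | sngVar {Γ Θ : List Ty} {A : Ty} : Var Θ A → Term Base S Γ Θ A
  | sngFst {Γ Θ : List Ty} {A₁ A₂ : Ty} : Var Θ (.prod A₁ A₂) → Term Base S Γ Θ A₁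
  | sngSnd {Γ Θ : List Ty} {A₁ A₂ : Ty} : Var Θ (.prod A₁ A₂) → Term Base S Γ Θ A₂
  | sngUnit {Γ Θ : List Ty} : Term Base S Γ Θ .unit
  | empty {Γ Θ : List Ty} {B : Ty} : Term Base S Γ Θ B
  | sng {Γ Θ : List Ty} {B : Ty} : Term Base S Γ Θ B → Term Base S Γ Θ (.bag B)
  | forIn {Γ Θ : List Ty} {A B : Ty} :
      Term Base S Γ Θ A → Term Base S Γ (A :: Θ) B → Term Base S Γ Θ B
  | plus {Γ Θ : List Ty} {B : Ty} :
      Term Base S Γ Θ B → Term Base S Γ Θ B → Term Base S Γ Θ B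
  | times {Γ Θ : List Ty} {B₁ B₂ : Ty} :
      Term Base S Γ Θ B₁ → Term Base S Γ Θ B₂ → Term Base S Γ Θ (.prod B₁ B₂)
  | flatten {Γ Θ : List Ty} {B : Ty} : Term Base S Γ Θ (.bag B) → Term Base S Γ Θ B
  | minus {Γ Θ : List Ty} {B : Ty} : Term Base S Γ Θ B → Term Base S Γ Θ B

/-- Closed expressions: queries `h : Bag(B)`. -/
abbrev Query (Base : Type) {r : ℕ} (S : Fin r → Ty) (B : Ty) : Type := Term Base S [] [] B

/-- For each occurrence of `sng(e)`, in order of its static index (pre-order), the types of the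
`for`-bound variables in scope. -/
def Term.sigs {Base : Type} {r : ℕ} {S : Fin r → Ty} :
    {Γ Θ : List Ty} → {B : Ty} → Term Base S Γ Θ B → List (List Ty)
  | _, _, _, .rel _ => []
  | _, _, _, .letIn e₁ e₂ => e₁.sigs ++ e₂.sigs
  | _, _, _, .var _ => []
  | _, _, _, .pred _ _ _ => []
  | _, _, _, .sngVar _ => []
  | _, _, _, .sngFst _ => []
  | _, _, _, .sngSnd _ => []
  | _, _, _, .sngUnit => []
  | _, _, _, .empty => []
  | _, Θ, _, .sng e => Θ :: e.sigs
  | _, _, _, .forIn e₁ e₂ => e₁.sigs ++ e₂.sigs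
  | _, _, _, .plus e₁ e₂ => e₁.sigs ++ e₂.sigs
  | _, _, _, .times e₁ e₂ => e₁.sigs ++ e₂.sigs
  | _, _, _, .flatten e => e.sigs
  | _, _, _, .minus e => e.sigs

/-! ### Shredded values, with multiplicities modulo `2 ^ k` -/

/-- Flat bags with multiplicities modulo `2 ^ k`. -/
abbrev Bag (Base : Type) (k : ℕ) : Type := FVal Base →₀ ZMod (2 ^ k)

/-- Label dictionaries `L ↦ Bag(·)` with their support sets. -/
structure Dict (Base : Type) (k : ℕ) : Type where
  supp : FVal Base → Bool
  defn : FVal Base → Bag Base k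

/-- The context component `A^Γ` of a type `A`. -/
def Ty.Ctx (Base : Type) (k : ℕ) : Ty → Type
  | .unit => Unit
  | .base => Unit
  | .prod A B => A.Ctx Base k × B.Ctx Base k
  | .bag C => Dict Base k × C.Ctx Base k

/-- Contexts for a list of variables. -/
def CtxEnv (Base : Type) (k : ℕ) : List Ty → Type
  | [] => Unit
  | A :: Γ => A.Ctx Base k × CtxEnv Base k Γ

def Var.get {Base : Type} {k : ℕ} :
    {Γ : List Ty} → {A : Ty} → Var Γ A → CtxEnv Base k Γ → A.Ctx Base k
  | _, _, .zero, ρ => ρ.1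
  | _, _, .succ x, ρ => x.get ρ.2

noncomputable section

/-- The empty context. -/
def Ctx.empty {Base : Type} {k : ℕ} : (A : Ty) → A.Ctx Base k
  | .unit => ()
  | .base => ()
  | .prod A B => (Ctx.empty A, Ctx.empty B)
  | .bag C => (⟨fun _ => false, fun _ => 0⟩, Ctx.empty C)

/-- Label union of contexts. Where both dictionaries define a label, their definitions agree for
consistent values, and the first one is taken. -/
def Ctx.lunion {Base : Type} {k : ℕ} : (A : Ty) → A.Ctx Base k → A.Ctx Base k → A.Ctx Base k
  | .unit, _, _ => ()
  | .base, _, _ => ()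
  | .prod A B, x, y => (Ctx.lunion A x.1 y.1, Ctx.lunion B x.2 y.2)
  | .bag C, x, y =>
      (⟨fun l => x.1.supp l || y.1.supp l,
        fun l => if x.1.supp l = true then x.1.defn l else y.1.defn l⟩,
       Ctx.lunion C x.2 y.2)

/-- Addition of contexts: definitions are added label by label. -/
def Ctx.add {Base : Type} {k : ℕ} : (A : Ty) → A.Ctx Base k → A.Ctx Base k → A.Ctx Base k
  | .unit, _, _ => ()
  | .base, _, _ => ()
  | .prod A B, x, y => (Ctx.add A x.1 y.1, Ctx.add B x.2 y.2)
  | .bag C, x, y =>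
      (⟨fun l => x.1.supp l || y.1.supp l, fun l => x.1.defn l + y.1.defn l⟩,
       Ctx.add C x.2 y.2)

/-- Shredded bags of type `Bag(A)`: a flat bag of type `Bag(A^F)` and a context of type `A^Γ`. -/
structure ShBag (Base : Type) (k : ℕ) (A : Ty) : Type where
  flat : Bag Base k
  ctx : A.Ctx Base k

def ShBag.add {Base : Type} {k : ℕ} {A : Ty} (x y : ShBag Base k A) : ShBag Base k A :=
  ⟨x.flat + y.flat, Ctx.add A x.ctx y.ctx⟩

/-- Shredded databases (also used for shredded updates). -/
abbrev DB (Base : Type) (k : ℕ) {r : ℕ} (S : Fin r → Ty) : Type := ∀ i, ShBag Base k (S i)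

/-- The updated database `D ⊎ Δ`. -/
def DB.add {Base : Type} {k r : ℕ} {S : Fin r → Ty} (D Δ : DB Base k S) : DB Base k S :=
  fun i => (D i).add (Δ i)

/-! ### The shredding of a query -/

/-- The values of the two components `sh^F(e)` and `sh^Γ(e)` of the shredding of `e` over a
shredded database `D`.

The flat component is a function of the assignment `ε` of flat values to the `for`-bound
variables. `γF ε` lists the flat components of the `let`-bound variables, `γΓ` and `δΓ` the
contexts of the `let`-bound and of the `for`-bound variables. The singleton constructs of `e` carry
the static indices `i, i + 1, …` in pre-order. -/
def Term.shred {Base : Type} {k r : ℕ} {S : Fin r → Ty} (D : DB Base k S) :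
    {Γ Θ : List Ty} → {B : Ty} → Term Base S Γ Θ B → (i : ℕ) →
      (γF : List (FVal Base) → List (Bag Base k)) →
      (γΓ : CtxEnv Base k Γ) → (δΓ : CtxEnv Base k Θ) →
      (List (FVal Base) → Bag Base k) × B.Ctx Base k
  | _, _, _, .rel j, _, _, _, _ => (fun _ => (D j).flat, (D j).ctx)
  | _, _, _, .letIn e₁ e₂, i, γF, γΓ, δΓ =>
      let s₁ := e₁.shred D i γF γΓ δΓ
      e₂.shred D (i + e₁.sigs.length) (fun ε => s₁.1 ε :: γF ε) (s₁.2, γΓ) δΓ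
  | _, _, _, .var X, _, γF, γΓ, _ => (fun ε => (γF ε).getD X.idx 0, X.get γΓ)
  | _, _, _, .pred x _ P, _, _, _, _ =>
      (fun ε => if P (ε.getD x.idx .unit) = true then Finsupp.single .unit 1 else 0, ())
  | _, _, _, .sngVar x, _, _, _, δΓ =>
      (fun ε => Finsupp.single (ε.getD x.idx .unit) 1, x.get δΓ)
  | _, _, _, .sngFst x, _, _, _, δΓ =>
      (fun ε => Finsupp.single (ε.getD x.idx .unit).fst 1, (x.get δΓ).1)
  | _, _, _, .sngSnd x, _, _, _, δΓ =>
      (fun ε => Finsupp.single (ε.getD x.idx .unit).snd 1, (x.get δΓ).2)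
  | _, _, _, .sngUnit, _, _, _, _ => (fun _ => Finsupp.single .unit 1, ())
  | _, _, B, .empty, _, _, _, _ => (fun _ => 0, Ctx.empty B)
  | _, _, _, .sng e, i, γF, γΓ, δΓ =>
      let s := e.shred D (i + 1) γF γΓ δΓ
      (fun ε => Finsupp.single (.lab i ε) 1,
       (⟨fun l => match l with
          | .lab j _ => decide (j = i)
          | _ => false,
         fun l => match l with
          | .lab j ε => if j = i then s.1 ε else 0
          | _ => 0⟩,
        s.2))
  | _, _, _, .forIn e₁ e₂, i, γF, γΓ, δΓ =>
      let s₁ := e₁.shred D i γF γΓ δΓ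
      let s₂ := e₂.shred D (i + e₁.sigs.length) (fun ε => γF ε.tail) γΓ (s₁.2, δΓ)
      (fun ε => (s₁.1 ε).sum fun v μ => μ • s₂.1 (v :: ε), s₂.2)
  | _, _, B, .plus e₁ e₂, i, γF, γΓ, δΓ =>
      let s₁ := e₁.shred D i γF γΓ δΓ
      let s₂ := e₂.shred D (i + e₁.sigs.length) γF γΓ δΓ
      (fun ε => s₁.1 ε + s₂.1 ε, Ctx.lunion B s₁.2 s₂.2)
  | _, _, _, .times e₁ e₂, i, γF, γΓ, δΓ =>
      let s₁ := e₁.shred D i γF γΓ δΓ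
      let s₂ := e₂.shred D (i + e₁.sigs.length) γF γΓ δΓ
      (fun ε => (s₁.1 ε).sum fun v μ => (s₂.1 ε).sum fun w ν =>
          Finsupp.single (.pair v w) (μ * ν),
       (s₁.2, s₂.2))
  | _, _, _, .flatten e, i, γF, γΓ, δΓ =>
      let s := e.shred D i γF γΓ δΓ
      (fun ε => (s.1 ε).sum fun l μ => μ • s.2.1.defn l, s.2.2)
  | _, _, _, .minus e, i, γF, γΓ, δΓ =>
      let s := e.shred D i γF γΓ δΓ
      (fun ε => - s.1 ε, s.2)

/-- The view of a query in shredded form. -/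
def Query.view {Base : Type} {k r : ℕ} {S : Fin r → Ty} {B : Ty}
    (h : Query Base S B) (D : DB Base k S) : ShBag Base k B :=
  let s := Term.shred D h 0 (fun _ => []) () ()
  ⟨s.1 [], s.2⟩

/-! ### Tuples constructible from the active domain, and the natural bit representation -/

/-- The values of type `A^F` over the primitive values `a` and the labels in `L`, in lexicographic
order. -/
def tuples {Base : Type} {n : ℕ} (a : Fin n ↪ Base) (L : List (FVal Base)) :
    Ty → List (FVal Base)
  | .unit => [.unit]
  | .base => (List.finRange n).map fun j => .base (a j)
  | .prod A B => (tuples a L A).flatMap fun v => (tuples a L B).map fun w => .pair v w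
  | .bag _ => L

/-- The assignments of flat values to variables of the given types. -/
def assigns {Base : Type} {n : ℕ} (a : Fin n ↪ Base) (L : List (FVal Base)) :
    List Ty → List (List (FVal Base))
  | [] => [[]]
  | A :: Θ => (tuples a L A).flatMap fun v => (assigns a L Θ).map fun ε => v :: ε

/-- The `m` labels available to the database. -/
def inpLabels (Base : Type) (m : ℕ) : List (FVal Base) := (List.range m).map FVal.inp

/-- Adds to the labels `L` the labels of the singleton constructs with static indices
`i, i + 1, …`, whose `for`-bound variables are typed by the given lists; the assignment in
a label involves only labels listed before. -/
def labelsFrom {Base : Type} {n : ℕ} (a : Fin n ↪ Base) :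
    ℕ → List (FVal Base) → List (List Ty) → List (FVal Base)
  | _, L, [] => L
  | i, L, Θ :: rest => labelsFrom a (i + 1) (L ++ (assigns a L Θ).map (FVal.lab i)) rest

/-- The label set of the views of `h`. -/
def Query.labels {Base : Type} {r : ℕ} {S : Fin r → Ty} {B : Ty} (h : Query Base S B)
    {n : ℕ} (m : ℕ) (a : Fin n ↪ Base) : List (FVal Base) :=
  labelsFrom a 0 (inpLabels Base m) (Term.sigs h)

/-- The `k` bits of a multiplicity modulo `2 ^ k`, least significant bit first. -/
def bits {k : ℕ} (x : ZMod (2 ^ k)) : List Bool :=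
  (List.range k).map fun j => x.val.testBit j

/-- The cells of a context: for each dictionary, one bit per label (is it in the support?) and
then `k` bits per label and possible element of its definition. -/
def Ctx.blocks {Base : Type} {k n : ℕ} (a : Fin n ↪ Base) (L : List (FVal Base)) :
    (A : Ty) → A.Ctx Base k → List (List Bool)
  | .unit, _ => []
  | .base, _ => []
  | .prod A B, x => Ctx.blocks a L A x.1 ++ Ctx.blocks a L B x.2
  | .bag C, x =>
      (L.map fun l => [x.1.supp l]) ++
      (L.flatMap fun l => (tuples a L C).map fun t => bits (x.1.defn l t)) ++
      Ctx.blocks a L C x.2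

/-- The cells of the natural bit representation of a shredded bag: `k` bits per possible tuple of
its flat component, followed by the cells of its context. -/
def ShBag.blocks {Base : Type} {k n : ℕ} {A : Ty} (a : Fin n ↪ Base) (L : List (FVal Base))
    (x : ShBag Base k A) : List (List Bool) :=
  ((tuples a L A).map fun t => bits (x.flat t)) ++ Ctx.blocks a L A x.ctx

/-- The cells of the natural bit representation of a shredded database with `m` labels. -/
def DB.blocks {Base : Type} {k r : ℕ} {S : Fin r → Ty} {n : ℕ} (a : Fin n ↪ Base) (m : ℕ)
    (D : DB Base k S) : List (List Bool) :=
  (List.finRange r).flatMap fun i => (D i).blocks a (inpLabels Base m)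

/-- Number of tuples of type `A^F` over `n` primitive values and `m` labels. -/
def Ty.numTuples (n m : ℕ) : Ty → ℕ
  | .unit => 1
  | .base => n
  | .prod A B => A.numTuples n m * B.numTuples n m
  | .bag _ => m

def Ty.numCtxCells (n m : ℕ) : Ty → ℕ
  | .unit => 0
  | .base => 0
  | .prod A B => A.numCtxCells n m + B.numCtxCells n m
  | .bag C => m + m * C.numTuples n m + C.numCtxCells n m

/-- Number of cells of a shredded database over `n` primitive values and `m` labels, that is, the
length of `DB.blocks`. -/
def numCells {r : ℕ} (S : Fin r → Ty) (n m : ℕ) : ℕ :=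
  ∑ i, ((S i).numTuples n m + (S i).numCtxCells n m)

/-- All values of a context are built from the primitive values `a` and the labels in `L`, and
labels outside the support of a dictionary have no definition. -/
def Ctx.Over {Base : Type} {k n : ℕ} (a : Fin n ↪ Base) (L : List (FVal Base)) :
    (A : Ty) → A.Ctx Base k → Prop
  | .unit, _ => True
  | .base, _ => True
  | .prod A B, x => Ctx.Over a L A x.1 ∧ Ctx.Over a L B x.2
  | .bag C, x =>
      (∀ l, x.1.supp l = true → l ∈ L) ∧
      (∀ l t, x.1.defn l t ≠ 0 → x.1.supp l = true ∧ t ∈ tuples a L C) ∧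
      Ctx.Over a L C x.2

/-- The database (or update) `D` has its primitive values among the `n` values `a` and its labels
among the `m` labels available. -/
def DB.Over {Base : Type} {k r : ℕ} {S : Fin r → Ty} {n : ℕ} (a : Fin n ↪ Base) (m : ℕ)
    (D : DB Base k S) : Prop :=
  ∀ i, (∀ t, (D i).flat t ≠ 0 → t ∈ tuples a (inpLabels Base m) (S i)) ∧
    Ctx.Over a (inpLabels Base m) (S i) (D i).ctx

/-- An auxiliary materialized view: a flat bag of a fixed schema, determined by the active domain
and the current shredded database. -/
structure AuxView (Base : Type) (k : ℕ) {r : ℕ} (S : Fin r → Ty) : Type where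
  schema : Ty
  mult : {n : ℕ} → (m : ℕ) → (Fin n ↪ Base) → DB Base k S → FVal Base → ZMod (2 ^ k)

/-- The natural bit representation of the view of `h`. -/
def viewBits {Base : Type} {k r : ℕ} {S : Fin r → Ty} {B : Ty} (h : Query Base S B)
    {n : ℕ} (m : ℕ) (a : Fin n ↪ Base) (D : DB Base k S) : List Bool :=
  ((Query.view h D).blocks a (Query.labels h m a)).flatten

/-- The natural bit representation of the view of `h` followed by that of auxiliary views. -/
def stateBits {Base : Type} {k r : ℕ} {S : Fin r → Ty} {B : Ty} (h : Query Base S B)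
    (aux : List (AuxView Base k S)) {n : ℕ} (m : ℕ) (a : Fin n ↪ Base) (D : DB Base k S) :
    List Bool :=
  viewBits h m a D ++
    aux.flatMap fun V =>
      (tuples a (Query.labels h m a) V.schema).flatMap fun t => bits (V.mult m a D t)

/-- The update `Δ` vanishes outside the cells with numbers `p 0, …, p (c - 1)`. -/
def SupportedAt {Base : Type} {k r : ℕ} {S : Fin r → Ty} {n : ℕ} (a : Fin n ↪ Base) (m : ℕ)
    (Δ : DB Base k S) {c : ℕ} (p : Fin c → ℕ) : Prop :=
  ∀ q, (∀ j, p j ≠ q) → ∀ b ∈ (Δ.blocks a m).getD q [], b = false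

/-- The contents of the cells of the update `Δ` with numbers `p 0, …, p (c - 1)`. -/
def updateBits {Base : Type} {k r : ℕ} {S : Fin r → Ty} {n : ℕ} (a : Fin n ↪ Base) (m : ℕ)
    (Δ : DB Base k S) {c : ℕ} (p : Fin c → ℕ) : List Bool :=
  (List.finRange c).flatMap fun j => (Δ.blocks a m).getD (p j) []

end

/-! ### Boolean circuits of fan-in at most two -/

/-- Gates; the arguments of a logical gate are numbers of earlier gates. -/
inductive Gate : Type
  | input : ℕ → Gate
  | const : Bool → Gate
  | not : ℕ → Gate
  | and : ℕ → ℕ → Gate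
  | or : ℕ → ℕ → Gate

/-- A circuit: its number of inputs, its gates in topological order, and the numbers of its output
gates. (A reference to a gate that does not come earlier reads the constant false.) -/
structure Circuit : Type where
  inputs : ℕ
  gates : List Gate
  outputs : List ℕ

def Gate.eval (x : List Bool) (vals : List Bool) : Gate → Bool
  | .input i => x.getD i false
  | .const b => b
  | .not i => !(vals.getD i false)
  | .and i j => vals.getD i false && vals.getD j false
  | .or i j => vals.getD i false || vals.getD j false

def Circuit.eval (C : Circuit) (x : List Bool) : List Bool :=
  let vals := C.gates.foldl (fun vals g => vals ++ [g.eval x vals]) []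
  C.outputs.map fun i => vals.getD i false

def Gate.depth (ds : List ℕ) : Gate → ℕ
  | .input _ => 0
  | .const _ => 0
  | .not i => ds.getD i 0 + 1
  | .and i j => max (ds.getD i 0) (ds.getD j 0) + 1
  | .or i j => max (ds.getD i 0) (ds.getD j 0) + 1

/-- The largest depth of a gate. -/
def Circuit.depth (C : Circuit) : ℕ :=
  (C.gates.foldl (fun ds g => ds ++ [g.depth ds]) []).foldr max 0

def Circuit.size (C : Circuit) : ℕ := C.gates.length

/-- Description of a gate as a sequence of numbers. -/
def Gate.encode : Gate → List ℕ
  | .input i => [0, i, 0]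
  | .const b => [1, if b then 1 else 0, 0]
  | .not i => [2, i, 0]
  | .and i j => [3, i, j]
  | .or i j => [4, i, j]

/-- Description of a circuit as a sequence of numbers. -/
def Circuit.encode (C : Circuit) : List ℕ :=
  C.inputs :: (C.gates.flatMap Gate.encode ++ C.outputs.flatMap fun i => [5, i, 0])

/-- The circuit computes the output `y` on the input `x`. -/
def Circuit.Maps (C : Circuit) (x y : List Bool) : Prop :=
  x.length = C.inputs ∧ C.eval x = y

/-! ### Logarithmic space -/

/-- Arithmetic operations of the machine model, each computable in space linear in the number of
bits of its arguments (`sub` truncates at `0`; division by `0` gives `0`). -/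
inductive Op : Type
  | add | sub | mul | div | mod

def Op.eval : Op → ℕ → ℕ → ℕ
  | .add, a, b => a + b
  | .sub, a, b => a - b
  | .mul, a, b => a * b
  | .div, a, b => a / b
  | .mod, a, b => a % b

/-- Programs of a register machine with a write-only output. A program mentions only finitely many
registers, so a run in which no register exceeds `N ^ e` uses `O(log N)` bits of storage; runs of
this kind are exactly the logarithmic-space computations. -/
inductive Prog : Type
  | skip : Prog
  | set (dst value : ℕ) : Prog
  | op (o : Op) (dst src₁ src₂ : ℕ) : Prog
  | emit (src : ℕ) : Prog
  | seq : Prog → Prog → Prog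
  | ifNonzero (src : ℕ) (p q : Prog) : Prog
  | whileNonzero (src : ℕ) (p : Prog) : Prog

/-- `Runs M P σ out σ'`: started with register contents `σ`, the program `P` halts with register
contents `σ'` after writing `out`, and never stores a number larger than `M` in a register. -/
inductive Prog.Runs (M : ℕ) : Prog → (ℕ → ℕ) → List ℕ → (ℕ → ℕ) → Prop
  | skip (σ : ℕ → ℕ) : Runs M .skip σ [] σ
  | set (σ : ℕ → ℕ) (d v : ℕ) (hv : v ≤ M) : Runs M (.set d v) σ [] (Function.update σ d v)
  | op (σ : ℕ → ℕ) (o : Op) (d s₁ s₂ : ℕ) (hv : o.eval (σ s₁) (σ s₂) ≤ M) :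
      Runs M (.op o d s₁ s₂) σ [] (Function.update σ d (o.eval (σ s₁) (σ s₂)))
  | emit (σ : ℕ → ℕ) (s : ℕ) : Runs M (.emit s) σ [σ s] σ
  | seq {P Q : Prog} {σ σ' σ'' : ℕ → ℕ} {u v : List ℕ} :
      Runs M P σ u σ' → Runs M Q σ' v σ'' → Runs M (.seq P Q) σ (u ++ v) σ''
  | ifTrue {P Q : Prog} {σ σ' : ℕ → ℕ} {u : List ℕ} {s : ℕ} :
      σ s ≠ 0 → Runs M P σ u σ' → Runs M (.ifNonzero s P Q) σ u σ'
  | ifFalse {P Q : Prog} {σ σ' : ℕ → ℕ} {u : List ℕ} {s : ℕ} :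
      σ s = 0 → Runs M Q σ u σ' → Runs M (.ifNonzero s P Q) σ u σ'
  | whileDone {P : Prog} {σ : ℕ → ℕ} {s : ℕ} : σ s = 0 → Runs M (.whileNonzero s P) σ [] σ
  | whileStep {P : Prog} {σ σ' σ'' : ℕ → ℕ} {u v : List ℕ} {s : ℕ} :
      σ s ≠ 0 → Runs M P σ u σ' → Runs M (.whileNonzero s P) σ' v σ'' →
      Runs M (.whileNonzero s P) σ (u ++ v) σ''

/-- Started with the numbers `args` in its first registers and `0` elsewhere, the program `P`
writes `out`, keeping all register contents at most `M`. -/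
def Prog.Prints (P : Prog) (M : ℕ) (args out : List ℕ) : Prop :=
  (∀ x ∈ args, x ≤ M) ∧ ∃ σ', Prog.Runs M P (fun i => args.getD i 0) out σ'

end NRC

/-!
Why incremental maintenance is in `NC₀`. Let `R` be the ring of integers modulo `2 ^ k`, and read a
shredded database over a fixed active domain as a vector `x : ℕ → R` of cell contents. Every entry
of the view of a query is a function of `x` of *bounded degree*: its iterated forward differences of
order above some `N` vanish, where `N` depends on the query and on `k` only (`polyBag_shred`). For
multiplicities this holds since all constructs of the calculus are polynomial. A support bit is the
parity of its cell; differences of the parity function pick up factors `2`, and `2 ^ k = 0`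
(`degLE_parity`), so the label union, which branches on supports, is harmless as well. Multiplying
an entry by a power of two moves any of its bits to the top position, so each bit of the view is the
highest bit of a function of bounded degree (`exists_polyBits_view`).

The auxiliary views hold all iterated differences of order at most `N` of these functions and of
the cells themselves. They form an array of polynomial size whose index consists of a function `t`
and of a number `Q` whose digits in a large base `Z` are the directions of the differences
(`deriv`). Since schemas with `(n + L + 2) ^ K` tuples exist (`powSchemas`), the array can be stored
as flat bags (`exists_auxViews`). By the definition of the difference operator, a step of cell `q`
by `b ∈ {0, 1}` changes the entry `(t, Q)` to the sum of the entry `(t, Q)` and of `b` times the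
entry `(t, Q Z + q + 1)` (`deriv_step`), and entries with too many digits are zero
(`deriv_eq_zero`). An update of `c` cells is a sequence of at most `c (2 ^ k - 1)` such conditional
steps: bit `i` of the increment of a cell controls `2 ^ i` of them (`increment_stepsE`). Unrolling
the steps gives for each output bit one fixed Boolean formula whose inputs have addresses given by
arithmetic expressions in `n`, `m`, the cell numbers and the number of the output bit
(`eval_stateBitE`). Circuits consisting of copies of one such formula have constant depth and are
printed by a loop that evaluates arithmetic expressions, all of polynomially bounded value
(`exists_prints_familyCircuit`).

For the contrast, the query `for x in R union sng(⟨⟩)` counts the elements of a unary relation. The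
lowest bit of the count depends on the multiplicity of each of the `n` primitive values, but a
circuit of depth `d` and fan-in two reads at most `2 ^ d` inputs (`Circuit.exists_support`).
-/

namespace NRC

/-! ### Functions of bounded degree and their derivatives -/

section Degree

variable {R : Type} [CommRing R]

/-- The forward difference of `f` in the direction of the coordinate `q`. -/
def fdiff (q : ℕ) (f : (ℕ → R) → R) : (ℕ → R) → R := fun x => f (x + Pi.single q 1) - f x

/-- `f` has degree at most `N`: all its iterated forward differences of order `N + 1` vanish. -/
def DegLE : ℕ → ((ℕ → R) → R) → Prop
  | 0, f => ∀ q, fdiff q f = 0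
  | N + 1, f => ∀ q, DegLE N (fdiff q f)

theorem fdiff_zero (q : ℕ) : fdiff q (0 : (ℕ → R) → R) = 0 := by
  funext x; simp [fdiff]

theorem fdiff_add (q : ℕ) (f g : (ℕ → R) → R) : fdiff q (f + g) = fdiff q f + fdiff q g := by
  funext x; simp only [fdiff, Pi.add_apply]; ring

theorem fdiff_mul (q : ℕ) (f g : (ℕ → R) → R) :
    fdiff q (f * g) = fdiff q f * g + f * fdiff q g + fdiff q f * fdiff q g := by
  funext x; simp only [fdiff, Pi.add_apply, Pi.mul_apply]; ring

theorem DegLE.zero (N : ℕ) : DegLE N (0 : (ℕ → R) → R) := by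
  induction N with
  | zero => exact fun q => fdiff_zero q
  | succ N ih => intro q; rw [fdiff_zero]; exact ih

theorem DegLE.const (N : ℕ) (r : R) : DegLE N (fun _ => r) := by
  have h : ∀ q, fdiff q (fun _ : ℕ → R => r) = 0 := fun q => by funext x; simp [fdiff]
  cases N with
  | zero => exact h
  | succ N => intro q; rw [h]; exact DegLE.zero N

theorem DegLE.succ {N : ℕ} {f : (ℕ → R) → R} (h : DegLE N f) : DegLE (N + 1) f := by
  induction N generalizing f with
  | zero => intro q; rw [h q]; exact DegLE.zero 0
  | succ N ih => exact fun q => ih (h q)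

theorem DegLE.mono {M N : ℕ} {f : (ℕ → R) → R} (h : DegLE M f) (hMN : M ≤ N) : DegLE N f := by
  induction hMN with
  | refl => exact h
  | step _ ih => exact ih.succ

theorem DegLE.add {N : ℕ} {f g : (ℕ → R) → R} (hf : DegLE N f) (hg : DegLE N g) :
    DegLE N (f + g) := by
  induction N generalizing f g with
  | zero => intro q; rw [fdiff_add, hf q, hg q, add_zero]
  | succ N ih => intro q; rw [fdiff_add]; exact ih (hf q) (hg q)

theorem DegLE.mul {M N : ℕ} {f g : (ℕ → R) → R} (hf : DegLE M f) (hg : DegLE N g) :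
    DegLE (M + N) (f * g) := by
  obtain ⟨s, hs⟩ : ∃ s, s = M + N := ⟨_, rfl⟩
  induction s generalizing M N f g with
  | zero =>
    obtain ⟨rfl, rfl⟩ : M = 0 ∧ N = 0 := by omega
    intro q
    rw [fdiff_mul, hf q, hg q]; simp
  | succ s ih =>
    rw [← hs]
    intro q
    rw [fdiff_mul]
    have h1 : DegLE s (fdiff q f * g) := by
      cases M with
      | zero => rw [hf q, zero_mul]; exact DegLE.zero s
      | succ M =>
        have e : s = M + N := by omega
        rw [e]; exact ih (hf q) hg e
    have h2 : DegLE s (f * fdiff q g) := by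
      cases N with
      | zero => rw [hg q, mul_zero]; exact DegLE.zero s
      | succ N =>
        have e : s = M + N := by omega
        rw [e]; exact ih hf (hg q) e
    have h3 : DegLE s (fdiff q f * fdiff q g) := by
      cases M with
      | zero => rw [hf q, zero_mul]; exact DegLE.zero s
      | succ M =>
        cases N with
        | zero => rw [hg q, mul_zero]; exact DegLE.zero s
        | succ N =>
          obtain ⟨s, rfl⟩ : ∃ s', s = s' + 1 := ⟨s - 1, by omega⟩
          exact (show DegLE (M + 1 + N) _ from ih (M := M + 1) (N := N) (f := fdiff q f)
            (hf q).succ (hg q) (by omega)).mono (by omega)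
    exact (h1.add h2).add h3

theorem DegLE.const_mul {N : ℕ} {f : (ℕ → R) → R} (r : R) (hf : DegLE N f) :
    DegLE N (fun x => r * f x) := by
  have := (DegLE.const 0 r).mul hf
  rwa [Nat.zero_add] at this

theorem DegLE.neg {N : ℕ} {f : (ℕ → R) → R} (hf : DegLE N f) : DegLE N (fun x => - f x) := by
  simpa using hf.const_mul (-1)

theorem DegLE.coord (N q : ℕ) : DegLE (N + 1) (fun x : ℕ → R => x q) := by
  intro q'
  have : fdiff q' (fun x : ℕ → R => x q) = fun _ => (Pi.single q' 1 : ℕ → R) q := by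
    funext x; simp [fdiff]
  rw [this]
  exact DegLE.const N _

/-- Iterated forward differences; the directions are the digits of `Q` in base `Z`, where the
digit `q + 1` stands for the coordinate `q`. A number with a digit `0` encodes no sequence of
directions. -/
def deriv (Z Q : ℕ) (f : (ℕ → R) → R) : (ℕ → R) → R :=
  (Z.digits Q).foldr (fun d g => if d = 0 then 0 else fdiff (d - 1) g) f

@[simp] theorem deriv_zero (Z : ℕ) (f : (ℕ → R) → R) : deriv Z 0 f = f := by
  simp [deriv]

theorem deriv_append {Z q : ℕ} (hq : q + 1 < Z) (Q : ℕ) (f : (ℕ → R) → R) :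
    deriv Z (Q * Z + (q + 1)) f = fdiff q (deriv Z Q f) := by
  have h : Z.digits (Q * Z + (q + 1)) = (q + 1) :: Z.digits Q := by
    rw [show Q * Z + (q + 1) = (q + 1) + Z * Q by ring]
    exact Nat.digits_add Z (by omega) (q + 1) Q hq (Or.inl (by omega))
  simp [deriv, h]

/-- A conditional unit step in the direction `q`. -/
theorem deriv_step {Z q : ℕ} (hq : q + 1 < Z) (Q : ℕ) (f : (ℕ → R) → R) (x : ℕ → R) (b : Bool) :
    deriv Z Q f (x + if b then Pi.single q 1 else 0) =
      deriv Z Q f x + if b then deriv Z (Q * Z + (q + 1)) f x else 0 := by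
  cases b
  · simp
  · simp [deriv_append hq, fdiff]

/-- The innermost difference, which is the last of the list, lowers the degree. -/
theorem foldr_fdiff_eq_zero {N : ℕ} {f : (ℕ → R) → R} (hf : DegLE N f) (l : List ℕ)
    (hl : N < l.length) :
    l.foldr (fun d g => if d = 0 then 0 else fdiff (d - 1) g) f = 0 := by
  have hz : ∀ l : List ℕ,
      l.foldr (fun d g => if d = 0 then 0 else fdiff (d - 1) g) (0 : (ℕ → R) → R) = 0 := by
    intro l
    induction l with
    | nil => rfl
    | cons d l ih => rw [List.foldr_cons, ih, fdiff_zero, ite_self]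
  induction l using List.reverseRecOn generalizing N f with
  | nil => simp at hl
  | append_singleton l d ih =>
    rw [List.foldr_append]
    simp only [List.foldr_cons, List.foldr_nil]
    rw [List.length_append, List.length_singleton] at hl
    split_ifs
    · exact hz l
    · cases N with
      | zero => rw [hf]; exact hz l
      | succ N => exact ih (hf _) (by omega)

/-- Numbers with more than `N` digits encode differences of order above `N`, so a function of degree
at most `N` has nonzero derivatives at numbers below `Z ^ N` only. -/
theorem deriv_eq_zero {N Z Q : ℕ} (hZ : 1 < Z) {f : (ℕ → R) → R} (hf : DegLE N f)
    (hQ : Z ^ N ≤ Q) : deriv Z Q f = 0 :=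
  foldr_fdiff_eq_zero hf _ ((Nat.lt_digits_length_iff hZ Q).2 hQ)

end Degree

/-! ### Shredded queries have bounded degree -/

section Shred

variable {Base : Type} {k : ℕ}

/-- The bag `b x` varies with `x` inside a fixed finite set, with multiplicities of degree at
most `N`. -/
def PolyBag (N : ℕ) (b : (ℕ → ZMod (2 ^ k)) → Bag Base k) : Prop :=
  (∃ F : Finset (FVal Base), ∀ x, (b x).support ⊆ F) ∧ ∀ t, DegLE N fun x => b x t

/-- All multiplicities and all supports of the context `c x` have degree at most `N` in `x`. -/
def PolyCtx (N : ℕ) : (A : Ty) → ((ℕ → ZMod (2 ^ k)) → A.Ctx Base k) → Prop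
  | .unit, _ => True
  | .base, _ => True
  | .prod A B, c => PolyCtx N A (fun x => (c x).1) ∧ PolyCtx N B (fun x => (c x).2)
  | .bag C, c => (∀ l, DegLE N fun x => if (c x).1.supp l = true then 1 else 0) ∧
      (∀ l, PolyBag N fun x => (c x).1.defn l) ∧ PolyCtx N C (fun x => (c x).2)

/-- `PolyCtx` for all contexts of an environment. -/
def PolyEnv (N : ℕ) : (Γ : List Ty) → ((ℕ → ZMod (2 ^ k)) → CtxEnv Base k Γ) → Prop
  | [], _ => True
  | A :: Γ, ρ => PolyCtx N A (fun x => (ρ x).1) ∧ PolyEnv N Γ (fun x => (ρ x).2)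

variable {M N : ℕ} {a b : (ℕ → ZMod (2 ^ k)) → Bag Base k}

theorem PolyBag.mono (h : PolyBag M b) (hMN : M ≤ N) : PolyBag N b :=
  ⟨h.1, fun t => (h.2 t).mono hMN⟩

theorem PolyCtx.mono (hMN : M ≤ N) : {A : Ty} → {c : (ℕ → ZMod (2 ^ k)) → A.Ctx Base k} →
    PolyCtx M A c → PolyCtx N A c
  | .unit, _, _ => trivial
  | .base, _, _ => trivial
  | .prod _ _, _, h => ⟨PolyCtx.mono hMN h.1, PolyCtx.mono hMN h.2⟩
  | .bag _, _, h => ⟨fun l => (h.1 l).mono hMN, fun l => (h.2.1 l).mono hMN,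
      PolyCtx.mono hMN h.2.2⟩

theorem PolyEnv.mono (hMN : M ≤ N) : {Γ : List Ty} → {ρ : (ℕ → ZMod (2 ^ k)) → CtxEnv Base k Γ} →
    PolyEnv M Γ ρ → PolyEnv N Γ ρ
  | [], _, _ => trivial
  | _ :: _, _, h => ⟨PolyCtx.mono hMN h.1, PolyEnv.mono hMN h.2⟩

theorem PolyEnv.get : {Γ : List Ty} → {A : Ty} → (X : Var Γ A) →
    {ρ : (ℕ → ZMod (2 ^ k)) → CtxEnv Base k Γ} → PolyEnv N Γ ρ →
    PolyCtx N A (fun x => X.get (ρ x))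
  | _, _, .zero, _, h => h.1
  | _, _, .succ X, _, h => PolyEnv.get X h.2

theorem PolyBag.const (N : ℕ) (v : Bag Base k) : PolyBag N fun _ => v :=
  ⟨⟨v.support, fun _ => subset_rfl⟩, fun _ => DegLE.const N _⟩

theorem PolyBag.add (ha : PolyBag N a) (hb : PolyBag N b) : PolyBag N fun x => a x + b x := by
  classical
  obtain ⟨⟨F, hF⟩, ha⟩ := ha
  obtain ⟨⟨G, hG⟩, hb⟩ := hb
  exact ⟨⟨F ∪ G, fun x => Finsupp.support_add.trans (Finset.union_subset_union (hF x) (hG x))⟩,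
    fun t => (ha t).add (hb t)⟩

theorem PolyBag.neg (ha : PolyBag N a) : PolyBag N fun x => - a x := by
  obtain ⟨⟨F, hF⟩, ha⟩ := ha
  exact ⟨⟨F, fun x => (Finsupp.support_neg (a x)).trans_subset (hF x)⟩, fun t => (ha t).neg⟩

theorem PolyBag.finset_sum {ι : Type} (s : Finset ι) {f : ι → (ℕ → ZMod (2 ^ k)) → Bag Base k}
    (h : ∀ i ∈ s, PolyBag N (f i)) : PolyBag N fun x => ∑ i ∈ s, f i x := by
  classical
  induction s using Finset.induction_on with
  | empty => simpa using PolyBag.const N 0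
  | insert i s hi ih =>
    simp only [Finset.sum_insert hi]
    exact (h i (Finset.mem_insert_self i s)).add
      (ih fun j hj => h j (Finset.mem_insert_of_mem hj))

theorem PolyBag.smul {f : (ℕ → ZMod (2 ^ k)) → ZMod (2 ^ k)} (hf : DegLE M f)
    (hb : PolyBag N b) : PolyBag (M + N) fun x => f x • b x := by
  obtain ⟨⟨F, hF⟩, hb⟩ := hb
  exact ⟨⟨F, fun x => Finsupp.support_smul.trans (hF x)⟩, fun t => hf.mul (hb t)⟩

/-- The common finite set `F` turns the union over the elements of `a x` into a sum with a fixed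
index set. -/
theorem PolyBag.sum (ha : PolyBag M a) {g : (ℕ → ZMod (2 ^ k)) → FVal Base → Bag Base k}
    (hg : ∀ v, PolyBag N fun x => g x v) :
    PolyBag (M + N) fun x => (a x).sum fun v μ => μ • g x v := by
  obtain ⟨⟨F, hF⟩, ha⟩ := ha
  have h : (fun x => (a x).sum fun v μ => μ • g x v) = fun x => ∑ v ∈ F, a x v • g x v := by
    funext x
    exact Finsupp.sum_of_support_subset _ (hF x) _ (fun v _ => zero_smul _ _)
  rw [h]
  exact PolyBag.finset_sum F fun v _ => PolyBag.smul (ha v) (hg v)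

/-- A product of bags is an iterated union of scaled singletons. -/
theorem PolyBag.times (ha : PolyBag M a) (hb : PolyBag N b) :
    PolyBag (M + N) fun x => (a x).sum fun v μ => (b x).sum fun w ν =>
      Finsupp.single (FVal.pair v w) (μ * ν) := by
  have h : (fun x => (a x).sum fun v μ => (b x).sum fun w ν =>
      Finsupp.single (FVal.pair v w) (μ * ν)) = fun x => (a x).sum fun v μ =>
        μ • (b x).sum fun w ν => ν • Finsupp.single (FVal.pair v w) (1 : ZMod (2 ^ k)) := by
    funext x
    refine Finsupp.sum_congr fun v _ => ?_
    rw [Finsupp.smul_sum]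
    refine Finsupp.sum_congr fun w _ => ?_
    rw [smul_smul, Finsupp.smul_single, smul_eq_mul, mul_one]
  rw [h]
  exact PolyBag.sum ha fun v => PolyBag.sum (N := 0) hb fun w => PolyBag.const 0 _

theorem PolyCtx.empty (N : ℕ) :
    (A : Ty) → PolyCtx N A (fun _ : ℕ → ZMod (2 ^ k) => (Ctx.empty A : A.Ctx Base k))
  | .unit => trivial
  | .base => trivial
  | .prod A B => ⟨PolyCtx.empty N A, PolyCtx.empty N B⟩
  | .bag C => ⟨fun _ => by simpa [Ctx.empty] using DegLE.const N 0, fun _ => PolyBag.const N 0,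
      PolyCtx.empty N C⟩

/-- On indicators `s`, `t`, the Boolean operations of the label union are polynomials, for
example `s ∨ t` is `s + t - s t`. -/
theorem PolyCtx.lunion : {A : Ty} → {c d : (ℕ → ZMod (2 ^ k)) → A.Ctx Base k} →
    PolyCtx N A c → PolyCtx N A d → PolyCtx (N + N) A (fun x => Ctx.lunion A (c x) (d x))
  | .unit, _, _, _, _ => trivial
  | .base, _, _, _, _ => trivial
  | .prod _ _, _, _, hc, hd => ⟨PolyCtx.lunion hc.1 hd.1, PolyCtx.lunion hc.2 hd.2⟩
  | .bag C, c, d, hc, hd => by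
    refine ⟨fun l => ?_, fun l => ?_, PolyCtx.lunion hc.2.2 hd.2.2⟩
    · have h := (((hc.1 l).mono (Nat.le_add_right N N)).add
        ((hd.1 l).mono (Nat.le_add_right N N))).add ((hc.1 l).mul (hd.1 l)).neg
      convert h using 1
      funext x
      have hor : ∀ s t : Bool, (if (s || t) = true then 1 else 0 : ZMod (2 ^ k)) =
          (if s = true then 1 else 0) + (if t = true then 1 else 0) +
            -((if s = true then 1 else 0) * (if t = true then 1 else 0)) := by
        intro s t
        cases s <;> cases t <;> simp
      exact hor _ _
    · have h := (PolyBag.smul (hc.1 l) (hc.2.1 l)).add (PolyBag.smul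
        ((DegLE.const N (1 : ZMod (2 ^ k))).add (hc.1 l).neg) (hd.2.1 l))
      convert h using 1
      funext x
      simp only [Ctx.lunion, Pi.add_apply]
      cases (c x).1.supp l <;> simp

/-- The entries of a shredded query have bounded degree in a database of bounded degree; the bound
depends on the query only. -/
theorem polyBag_shred {r : ℕ} {S : Fin r → Ty} : {Γ Θ : List Ty} → {B : Ty} →
    (e : Term Base S Γ Θ B) → ∀ N, ∃ N', ∀ (D : (ℕ → ZMod (2 ^ k)) → DB Base k S) (i : ℕ)
      (γF : (ℕ → ZMod (2 ^ k)) → List (FVal Base) → List (Bag Base k))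
      (γΓ : (ℕ → ZMod (2 ^ k)) → CtxEnv Base k Γ) (δΓ : (ℕ → ZMod (2 ^ k)) → CtxEnv Base k Θ),
      (∀ j, PolyBag N (fun x => (D x j).flat) ∧ PolyCtx N (S j) (fun x => (D x j).ctx)) →
      (∀ ε j, PolyBag N fun x => (γF x ε).getD j 0) → PolyEnv N Γ γΓ → PolyEnv N Θ δΓ →
      (∀ ε, PolyBag N' fun x => (e.shred (D x) i (γF x) (γΓ x) (δΓ x)).1 ε) ∧
        PolyCtx N' B (fun x => (e.shred (D x) i (γF x) (γΓ x) (δΓ x)).2) := by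
  intro Γ Θ B e
  induction e with
  | rel j => exact fun N => ⟨N, fun D i γF γΓ δΓ hD _ _ _ => ⟨fun _ => (hD j).1, (hD j).2⟩⟩
  | letIn e₁ e₂ ih₁ ih₂ =>
    intro N
    obtain ⟨N₁, h₁⟩ := ih₁ N
    obtain ⟨N₂, h₂⟩ := ih₂ (max N N₁)
    refine ⟨N₂, fun D i γF γΓ δΓ hD hγ hγΓ hδΓ => ?_⟩
    have s₁ := h₁ D i γF γΓ δΓ hD hγ hγΓ hδΓ
    have l : N ≤ max N N₁ := le_max_left _ _
    have r : N₁ ≤ max N N₁ := le_max_right _ _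
    refine h₂ D (i + e₁.sigs.length)
      (fun x ε => (e₁.shred (D x) i (γF x) (γΓ x) (δΓ x)).1 ε :: γF x ε)
      (fun x => ((e₁.shred (D x) i (γF x) (γΓ x) (δΓ x)).2, γΓ x)) δΓ
      (fun j => ⟨(hD j).1.mono l, (hD j).2.mono l⟩) ?_ ⟨s₁.2.mono r, hγΓ.mono l⟩ (hδΓ.mono l)
    intro ε j
    cases j with
    | zero => simpa using (s₁.1 ε).mono r
    | succ j => simpa using (hγ ε j).mono l
  | var X =>
    exact fun N => ⟨N, fun D i γF γΓ δΓ _ hγ hγΓ _ => ⟨fun ε => hγ ε _, hγΓ.get X⟩⟩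
  | pred x hA P =>
    exact fun N => ⟨0, fun D i γF γΓ δΓ _ _ _ _ => ⟨fun ε => PolyBag.const 0 _, trivial⟩⟩
  | sngVar x =>
    exact fun N => ⟨N, fun D i γF γΓ δΓ _ _ _ hδ => ⟨fun ε => PolyBag.const N _, hδ.get x⟩⟩
  | sngFst x =>
    exact fun N => ⟨N, fun D i γF γΓ δΓ _ _ _ hδ => ⟨fun ε => PolyBag.const N _, (hδ.get x).1⟩⟩
  | sngSnd x =>
    exact fun N => ⟨N, fun D i γF γΓ δΓ _ _ _ hδ => ⟨fun ε => PolyBag.const N _, (hδ.get x).2⟩⟩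
  | sngUnit =>
    exact fun N => ⟨0, fun D i γF γΓ δΓ _ _ _ _ => ⟨fun ε => PolyBag.const 0 _, trivial⟩⟩
  | empty =>
    exact fun N => ⟨0, fun D i γF γΓ δΓ _ _ _ _ => ⟨fun ε => PolyBag.const 0 _, PolyCtx.empty 0 _⟩⟩
  | sng e ih =>
    intro N
    obtain ⟨N', h⟩ := ih N
    refine ⟨N', fun D i γF γΓ δΓ hD hγ hγΓ hδΓ => ?_⟩
    have s := h D (i + 1) γF γΓ δΓ hD hγ hγΓ hδΓ
    refine ⟨fun ε => PolyBag.const N' _, fun l => ?_, fun l => ?_, s.2⟩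
    · cases l with
      | lab j ε => exact DegLE.const N' (if decide (j = i) = true then 1 else 0 : ZMod (2 ^ k))
      | _ => exact DegLE.const N' (0 : ZMod (2 ^ k))
    cases l with
    | lab j ε =>
      by_cases hj : j = i
      · simpa [Term.shred, hj] using s.1 ε
      · simpa [Term.shred, hj] using PolyBag.const N' 0
    | _ => exact PolyBag.const N' 0
  | forIn e₁ e₂ ih₁ ih₂ =>
    intro N
    obtain ⟨N₁, h₁⟩ := ih₁ N
    obtain ⟨N₂, h₂⟩ := ih₂ (max N N₁)
    refine ⟨N₁ + N₂, fun D i γF γΓ δΓ hD hγ hγΓ hδΓ => ?_⟩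
    have s₁ := h₁ D i γF γΓ δΓ hD hγ hγΓ hδΓ
    have l : N ≤ max N N₁ := le_max_left _ _
    have r : N₁ ≤ max N N₁ := le_max_right _ _
    have s₂ := h₂ D (i + e₁.sigs.length) (fun x ε => γF x ε.tail) γΓ
      (fun x => ((e₁.shred (D x) i (γF x) (γΓ x) (δΓ x)).2, δΓ x))
      (fun j => ⟨(hD j).1.mono l, (hD j).2.mono l⟩) (fun ε j => (hγ ε.tail j).mono l)
      (hγΓ.mono l) ⟨s₁.2.mono r, hδΓ.mono l⟩
    exact ⟨fun ε => PolyBag.sum (s₁.1 ε) fun v => s₂.1 (v :: ε), s₂.2.mono (Nat.le_add_left _ _)⟩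
  | plus e₁ e₂ ih₁ ih₂ =>
    intro N
    obtain ⟨N₁, h₁⟩ := ih₁ N
    obtain ⟨N₂, h₂⟩ := ih₂ N
    refine ⟨max N₁ N₂ + max N₁ N₂, fun D i γF γΓ δΓ hD hγ hγΓ hδΓ => ?_⟩
    have s₁ := h₁ D i γF γΓ δΓ hD hγ hγΓ hδΓ
    have s₂ := h₂ D (i + e₁.sigs.length) γF γΓ δΓ hD hγ hγΓ hδΓ
    have l : N₁ ≤ max N₁ N₂ := le_max_left _ _
    have r : N₂ ≤ max N₁ N₂ := le_max_right _ _
    exact ⟨fun ε => (((s₁.1 ε).mono l).add ((s₂.1 ε).mono r)).mono (Nat.le_add_left _ _),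
      (s₁.2.mono l).lunion (s₂.2.mono r)⟩
  | times e₁ e₂ ih₁ ih₂ =>
    intro N
    obtain ⟨N₁, h₁⟩ := ih₁ N
    obtain ⟨N₂, h₂⟩ := ih₂ N
    refine ⟨N₁ + N₂, fun D i γF γΓ δΓ hD hγ hγΓ hδΓ => ?_⟩
    have s₁ := h₁ D i γF γΓ δΓ hD hγ hγΓ hδΓ
    have s₂ := h₂ D (i + e₁.sigs.length) γF γΓ δΓ hD hγ hγΓ hδΓ
    exact ⟨fun ε => PolyBag.times (s₁.1 ε) (s₂.1 ε),
      s₁.2.mono (Nat.le_add_right _ _), s₂.2.mono (Nat.le_add_left _ _)⟩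
  | flatten e ih =>
    intro N
    obtain ⟨N', h⟩ := ih N
    refine ⟨N' + N', fun D i γF γΓ δΓ hD hγ hγΓ hδΓ => ?_⟩
    have s := h D i γF γΓ δΓ hD hγ hγΓ hδΓ
    exact ⟨fun ε => PolyBag.sum (s.1 ε) fun l => s.2.2.1 l, s.2.2.2.mono (Nat.le_add_left _ _)⟩
  | minus e ih =>
    intro N
    obtain ⟨N', h⟩ := ih N
    refine ⟨N', fun D i γF γΓ δΓ hD hγ hγΓ hδΓ => ?_⟩
    have s := h D i γF γΓ δΓ hD hγ hγΓ hδΓ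
    exact ⟨fun ε => (s.1 ε).neg, s.2⟩

end Shred

/-! ### Bits of a multiplicity -/

section Bits

variable {k : ℕ}

theorem testBit_zero_one (hk : 1 ≤ k) : (1 : ZMod (2 ^ k)).val.testBit 0 = true := by
  have : Fact (1 < 2 ^ k) := ⟨Nat.one_lt_two_pow (by omega)⟩
  rw [ZMod.val_one]; rfl

theorem length_bits (v : ZMod (2 ^ k)) : (bits v).length = k := by simp [bits]

theorem getD_bits (v : ZMod (2 ^ k)) {i : ℕ} (hi : i < k) :
    (bits v).getD i false = v.val.testBit i := by
  simp [bits, List.getD_eq_getElem?_getD, hi]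

/-- The number modulo `2 ^ k` with the given bits. -/
def ofBits (k : ℕ) (l : List Bool) : ZMod (2 ^ k) :=
  ∑ i ∈ Finset.range k, if l.getD i false then 2 ^ i else 0

theorem sum_testBit (v : ZMod (2 ^ k)) :
    (∑ i ∈ Finset.range k, if v.val.testBit i then 2 ^ i else 0 : ZMod (2 ^ k)) = v := by
  have h : ∀ (n j : ℕ), ∑ i ∈ Finset.range j, (if n.testBit i then 2 ^ i else 0) = n % 2 ^ j := by
    intro n j
    induction j with
    | zero => simp [Nat.mod_one]
    | succ j ih =>
      rw [Finset.sum_range_succ, ih, Nat.mod_pow_succ, Nat.testBit_eq_decide_div_mod_eq]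
      rcases Nat.mod_two_eq_zero_or_one (n / 2 ^ j) with h | h <;> simp [h]
  have h2 := congrArg (Nat.cast : ℕ → ZMod (2 ^ k)) (h v.val k)
  rw [Nat.mod_eq_of_lt (ZMod.val_lt v), ZMod.natCast_zmod_val] at h2
  simpa using h2

theorem ofBits_bits (v : ZMod (2 ^ k)) : ofBits k (bits v) = v := by
  conv_rhs => rw [← sum_testBit v]
  exact Finset.sum_congr rfl fun i hi => by rw [getD_bits v (Finset.mem_range.1 hi)]

/-- Multiplication by a power of two moves any bit to the top position. -/
theorem testBit_top (v : ZMod (2 ^ k)) {j : ℕ} (hj : j < k) :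
    (2 ^ (k - 1 - j) * v).val.testBit (k - 1) = v.val.testBit j := by
  have h : (2 ^ (k - 1 - j) * v) = ((2 ^ (k - 1 - j) * v.val : ℕ) : ZMod (2 ^ k)) := by
    push_cast
    rw [ZMod.natCast_zmod_val]
  rw [h, ZMod.val_natCast, Nat.testBit_mod_two_pow, Nat.testBit_two_pow_mul]
  have h1 : k - 1 < k := by omega
  have h2 : k - 1 - j ≤ k - 1 := by omega
  have h3 : k - 1 - (k - 1 - j) = j := by omega
  simp [h1, h3]

/-- The parity of a multiplicity, as a number. -/
def parity (v : ZMod (2 ^ k)) : ZMod (2 ^ k) := if v.val.testBit 0 then 1 else 0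

theorem parity_add_one (hk : 1 ≤ k) (v : ZMod (2 ^ k)) : parity (v + 1) = 1 - parity v := by
  have h : (v + 1).val % 2 = (v.val + 1) % 2 := by
    have : Fact (1 < 2 ^ k) := ⟨Nat.one_lt_two_pow (by omega)⟩
    rw [ZMod.val_add, ZMod.val_one, Nat.mod_mod_of_dvd _ (dvd_pow_self 2 (by omega))]
  simp only [parity, Nat.testBit_zero, decide_eq_true_eq]
  rcases Nat.mod_two_eq_zero_or_one v.val with h0 | h0
  · have : (v + 1).val % 2 = 1 := by omega
    simp [h0, this]
  · have : (v + 1).val % 2 = 0 := by omega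
    simp [h0, this]

/-- Differences of `1 - 2 * parity` pick up factors `-2`, and `2 ^ k = 0`. -/
theorem degLE_mul_parity (hk : 1 ≤ k) (q j : ℕ) (r : ZMod (2 ^ k)) (hr : r * 2 ^ (j + 1) = 0) :
    DegLE j fun x : ℕ → ZMod (2 ^ k) => r * (1 - 2 * parity (x q)) := by
  have h : ∀ (r : ZMod (2 ^ k)) q',
      fdiff q' (fun x : ℕ → ZMod (2 ^ k) => r * (1 - 2 * parity (x q))) =
        if q' = q then (fun x : ℕ → ZMod (2 ^ k) => -(r * 2) * (1 - 2 * parity (x q)))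
        else (0 : (ℕ → ZMod (2 ^ k)) → ZMod (2 ^ k)) := by
    intro r q'
    funext x
    split_ifs with hq
    · subst hq
      simp only [fdiff, Pi.add_apply, Pi.single_eq_same, parity_add_one hk]
      ring
    · simp [fdiff, Pi.single_eq_of_ne (Ne.symm hq)]
  induction j generalizing r with
  | zero =>
    intro q'
    rw [h]
    rw [zero_add, pow_one] at hr
    split_ifs
    · funext x; rw [hr]; simp
    · rfl
  | succ j ih =>
    intro q'
    rw [h]
    split_ifs
    · exact ih _ (by rw [neg_mul, mul_assoc, ← pow_succ', hr, neg_zero])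
    · exact DegLE.zero j

theorem degLE_parity (hk : 1 ≤ k) (q : ℕ) :
    DegLE (k + 1) fun x : ℕ → ZMod (2 ^ k) => parity (x q) := by
  intro q'
  have h : fdiff q' (fun x : ℕ → ZMod (2 ^ k) => parity (x q)) =
      if q' = q then (fun x : ℕ → ZMod (2 ^ k) => 1 * (1 - 2 * parity (x q)))
      else (0 : (ℕ → ZMod (2 ^ k)) → ZMod (2 ^ k)) := by
    funext x
    split_ifs with hq
    · subst hq
      simp only [fdiff, Pi.add_apply, Pi.single_eq_same, parity_add_one hk]
      ring
    · simp [fdiff, Pi.single_eq_of_ne (Ne.symm hq)]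
  rw [h]
  split_ifs
  · refine degLE_mul_parity hk q k 1 ?_
    have h0 : ((2 ^ k : ℕ) : ZMod (2 ^ k)) = 0 := ZMod.natCast_self _
    push_cast at h0
    rw [pow_succ, h0]; simp
  · exact DegLE.zero k

end Bits

/-! ### Cells of a shredded database -/

theorem getD_flatMap_of_length {α β : Type} (l : List α) (g : α → List β) (s : ℕ) (d : β)
    (hs : ∀ x ∈ l, (g x).length = s) (i j : ℕ) (hi : i < l.length) (hj : j < s) :
    (l.flatMap g).getD (i * s + j) d = (g l[i]).getD j d := by
  induction l generalizing i with
  | nil => simp at hi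
  | cons x l ih =>
    have hx : (g x).length = s := hs x (by simp)
    rw [List.flatMap_cons]
    cases i with
    | zero =>
      rw [List.getD_append _ _ _ _ (by rw [hx]; omega)]
      simp
    | succ i =>
      have e : (i + 1) * s + j = s + (i * s + j) := by ring
      rw [List.getD_append_right _ _ _ _ (by rw [hx, e]; omega), hx, e, Nat.add_sub_cancel_left]
      exact ih (fun y hy => hs y (by simp [hy])) i (by simpa using hi)

theorem length_flatMap_of_length {α β : Type} (l : List α) (g : α → List β) (s : ℕ)
    (hs : ∀ x ∈ l, (g x).length = s) : (l.flatMap g).length = l.length * s := by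
  rw [List.length_flatMap, List.map_congr_left hs, List.map_const', List.sum_replicate, smul_eq_mul]

theorem getD_flatMap_finRange {r : ℕ} {β : Type} (g : Fin r → List β) (d : β) (i : Fin r) (q : ℕ)
    (hq : q < (g i).length) :
    ((List.finRange r).flatMap g).getD
      ((((List.finRange r).take i).map fun j => (g j).length).sum + q) d = (g i).getD q d := by
  have hi : (i : ℕ) < (List.finRange r).length := by simp
  have h : List.finRange r =
      (List.finRange r).take i ++ (List.finRange r)[(i : ℕ)] :: (List.finRange r).drop (i + 1) := by
    rw [List.getElem_cons_drop, List.take_append_drop]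
  conv_lhs => rw [h, List.flatMap_append, List.flatMap_cons]
  rw [List.getD_append_right _ _ _ _ (by rw [← h, List.length_flatMap]; omega), ← h,
    List.length_flatMap, Nat.add_sub_cancel_left, List.getElem_finRange]
  exact List.getD_append _ _ _ _ hq

theorem zipWith_flatMap {α β : Type} (f : β → β → β) (l : List α) (g h : α → List β)
    (hl : ∀ x ∈ l, (g x).length = (h x).length) :
    List.zipWith f (l.flatMap g) (l.flatMap h) = l.flatMap fun x => List.zipWith f (g x) (h x) := by
  induction l with
  | nil => rfl
  | cons x l ih =>
    rw [List.flatMap_cons, List.flatMap_cons, List.flatMap_cons,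
      List.zipWith_append (hl x (by simp)), ih fun y hy => hl y (by simp [hy])]

section Cells

variable {Base : Type} {k n : ℕ}

/-- The bits of a cell; a cell is given by the flag that marks supports and by its content, which
for supports is `0` or `1`. -/
def cellBits (c : Bool × ZMod (2 ^ k)) : List Bool :=
  if c.1 then [c.2.val.testBit 0] else bits c.2

/-- The effect of an update on a cell: multiplicities are added, supports are joined. -/
def addCell (c d : Bool × ZMod (2 ^ k)) : Bool × ZMod (2 ^ k) :=
  (c.1, c.2 + if c.1 then (if d.2.val.testBit 0 && !c.2.val.testBit 0 then 1 else 0) else d.2)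

/-- The cells of a context, in the order of the natural representation. -/
def Ctx.cells (a : Fin n ↪ Base) (L : List (FVal Base)) :
    (A : Ty) → A.Ctx Base k → List (Bool × ZMod (2 ^ k))
  | .unit, _ => []
  | .base, _ => []
  | .prod A B, x => Ctx.cells a L A x.1 ++ Ctx.cells a L B x.2
  | .bag C, x =>
      (L.map fun l => (true, if x.1.supp l then 1 else 0)) ++
      ((L.flatMap fun l => (tuples a L C).map fun t => (false, x.1.defn l t)) ++
      Ctx.cells a L C x.2)

/-- The cells of a shredded bag, in the order of the natural representation. -/
def ShBag.cells {A : Ty} (a : Fin n ↪ Base) (L : List (FVal Base)) (x : ShBag Base k A) :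
    List (Bool × ZMod (2 ^ k)) :=
  ((tuples a L A).map fun t => (false, x.flat t)) ++ Ctx.cells a L A x.ctx

/-- The cells of a shredded database, in the order of the natural representation. -/
def DB.cells {r : ℕ} {S : Fin r → Ty} (a : Fin n ↪ Base) (m : ℕ) (D : DB Base k S) :
    List (Bool × ZMod (2 ^ k)) :=
  (List.finRange r).flatMap fun i => (D i).cells a (inpLabels Base m)

theorem Ctx.map_cellBits_cells (hk : 1 ≤ k) (a : Fin n ↪ Base) (L : List (FVal Base)) :
    (A : Ty) → (x : A.Ctx Base k) → (Ctx.cells a L A x).map cellBits = Ctx.blocks a L A x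
  | .unit, _ => rfl
  | .base, _ => rfl
  | .prod A B, x => by
    simp [Ctx.cells, Ctx.blocks, Ctx.map_cellBits_cells hk a L A, Ctx.map_cellBits_cells hk a L B]
  | .bag C, x => by
    have hs : ∀ s : Bool, cellBits (true, if s = true then 1 else (0 : ZMod (2 ^ k))) = [s] := by
      intro s
      cases s <;> simp [cellBits, -Nat.testBit_zero, testBit_zero_one hk]
    have hb : ∀ v : ZMod (2 ^ k), cellBits (false, v) = bits v := fun v => by simp [cellBits]
    simp only [Ctx.cells, Ctx.blocks, Ctx.map_cellBits_cells hk a L C, List.map_append,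
      List.map_map, List.map_flatMap, List.append_assoc, Function.comp_def, hs, hb]

theorem ShBag.map_cellBits_cells (hk : 1 ≤ k) {A : Ty} (a : Fin n ↪ Base) (L : List (FVal Base))
    (x : ShBag Base k A) : (x.cells a L).map cellBits = x.blocks a L := by
  have hb : ∀ v : ZMod (2 ^ k), cellBits (false, v) = bits v := fun v => by simp [cellBits]
  simp [ShBag.cells, ShBag.blocks, Ctx.map_cellBits_cells hk, Function.comp_def, hb]

theorem DB.map_cellBits_cells (hk : 1 ≤ k) {r : ℕ} {S : Fin r → Ty} (a : Fin n ↪ Base) (m : ℕ)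
    (D : DB Base k S) : (D.cells a m).map cellBits = D.blocks a m := by
  simp [DB.cells, DB.blocks, List.map_flatMap, ShBag.map_cellBits_cells hk]

/-- The layout of the cells of a context of type `A` over `n` primitive values and `m` labels: runs
of cells of equal kind, `true` marking supports. -/
def Ty.ctxRuns (n m : ℕ) : Ty → List (Bool × ℕ)
  | .unit => []
  | .base => []
  | .prod A B => A.ctxRuns n m ++ B.ctxRuns n m
  | .bag C => (true, m) :: (false, m * C.numTuples n m) :: C.ctxRuns n m

/-- The layout of the cells of a shredded bag. -/
def Ty.runs (n m : ℕ) (A : Ty) : List (Bool × ℕ) := (false, A.numTuples n m) :: A.ctxRuns n m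

/-- The kinds of the single cells of a layout. -/
def expandRuns (l : List (Bool × ℕ)) : List Bool := l.flatMap fun s => List.replicate s.2 s.1

theorem length_tuples (a : Fin n ↪ Base) (L : List (FVal Base)) :
    (A : Ty) → (tuples a L A).length = A.numTuples n L.length
  | .unit => rfl
  | .base => by simp [tuples, Ty.numTuples]
  | .prod A B => by
    rw [tuples, length_flatMap_of_length _ _ (B.numTuples n L.length)
      (fun v _ => by rw [List.length_map, length_tuples a L B]), length_tuples a L A]
    rfl
  | .bag _ => rfl

theorem Ctx.map_fst_cells (a : Fin n ↪ Base) (L : List (FVal Base)) :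
    (A : Ty) → (x : A.Ctx Base k) →
      (Ctx.cells a L A x).map Prod.fst = expandRuns (A.ctxRuns n L.length)
  | .unit, _ => rfl
  | .base, _ => rfl
  | .prod A B, x => by
    simp only [Ctx.cells, List.map_append, Ctx.map_fst_cells a L A, Ctx.map_fst_cells a L B,
      Ty.ctxRuns, expandRuns, List.flatMap_append]
  | .bag C, x => by
    have h : ((L.flatMap fun l => (tuples a L C).map fun t => (false, x.1.defn l t)).map
        Prod.fst : List Bool) = List.replicate (L.length * C.numTuples n L.length) false := by
      rw [List.eq_replicate_iff]
      constructor
      · rw [List.length_map, length_flatMap_of_length _ _ (C.numTuples n L.length)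
          (fun v _ => by rw [List.length_map, length_tuples])]
      · intro b hb
        simp only [List.mem_map, List.mem_flatMap] at hb
        obtain ⟨_, ⟨_, _, _, _, rfl⟩, rfl⟩ := hb
        rfl
    simp only [Ctx.cells, List.map_append, h, Ctx.map_fst_cells a L C, Ty.ctxRuns, expandRuns,
      List.flatMap_cons, List.map_map, Function.comp_def, List.map_const']

theorem ShBag.map_fst_cells {A : Ty} (a : Fin n ↪ Base) (L : List (FVal Base))
    (x : ShBag Base k A) : (x.cells a L).map Prod.fst = expandRuns (A.runs n L.length) := by
  simp [ShBag.cells, Ctx.map_fst_cells, Ty.runs, expandRuns, Function.comp_def, List.map_const',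
    length_tuples]

theorem length_inpLabels (m : ℕ) : (inpLabels Base m).length = m := by simp [inpLabels]

theorem DB.map_fst_cells {r : ℕ} {S : Fin r → Ty} (a : Fin n ↪ Base) (m : ℕ)
    (D : DB Base k S) : (D.cells a m).map Prod.fst =
      expandRuns ((List.finRange r).flatMap fun i => (S i).runs n m) := by
  simp [DB.cells, List.map_flatMap, ShBag.map_fst_cells, length_inpLabels, expandRuns,
    List.flatMap_assoc]

theorem length_expandRuns (l : List (Bool × ℕ)) :
    (expandRuns l).length = (l.map Prod.snd).sum := by
  simp [expandRuns, List.length_flatMap]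

theorem sum_ctxRuns (n m : ℕ) :
    (A : Ty) → ((A.ctxRuns n m).map Prod.snd).sum = A.numCtxCells n m
  | .unit => rfl
  | .base => rfl
  | .prod A B => by simp [Ty.ctxRuns, Ty.numCtxCells, sum_ctxRuns n m A, sum_ctxRuns n m B]
  | .bag C => by simp [Ty.ctxRuns, Ty.numCtxCells, sum_ctxRuns n m C, add_assoc]

theorem Ctx.length_cells (a : Fin n ↪ Base) (L : List (FVal Base)) (A : Ty) (x : A.Ctx Base k) :
    (Ctx.cells a L A x).length = A.numCtxCells n L.length := by
  rw [← List.length_map (f := Prod.fst), Ctx.map_fst_cells, length_expandRuns, sum_ctxRuns]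

theorem ShBag.length_cells {A : Ty} (a : Fin n ↪ Base) (L : List (FVal Base))
    (x : ShBag Base k A) :
    (x.cells a L).length = A.numTuples n L.length + A.numCtxCells n L.length := by
  rw [ShBag.cells, List.length_append, List.length_map, length_tuples, Ctx.length_cells]

theorem DB.length_cells {r : ℕ} {S : Fin r → Ty} (a : Fin n ↪ Base) (m : ℕ) (D : DB Base k S) :
    (D.cells a m).length = numCells S n m := by
  rw [DB.cells, List.length_flatMap, numCells, ← List.ofFn_eq_map, List.sum_ofFn]
  simp [ShBag.length_cells, length_inpLabels]

theorem Ctx.cells_add (hk : 1 ≤ k) (a : Fin n ↪ Base) (L : List (FVal Base)) :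
    (A : Ty) → (x y : A.Ctx Base k) → Ctx.cells a L A (Ctx.add A x y) =
      List.zipWith addCell (Ctx.cells a L A x) (Ctx.cells a L A y)
  | .unit, _, _ => rfl
  | .base, _, _ => rfl
  | .prod A B, x, y => by
    simp only [Ctx.cells, Ctx.add, Ctx.cells_add hk a L A, Ctx.cells_add hk a L B]
    rw [List.zipWith_append (by rw [Ctx.length_cells, Ctx.length_cells])]
  | .bag C, x, y => by
    have hs : ∀ s t : Bool, ((true, if (s || t) = true then 1 else 0) : Bool × ZMod (2 ^ k)) =
        addCell (true, if s = true then 1 else 0) (true, if t = true then 1 else 0) := by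
      intro s t
      cases s <;> cases t <;> simp [addCell, -Nat.testBit_zero, testBit_zero_one hk]
    have hm : ∀ u v : ZMod (2 ^ k), (false, u + v) = addCell (false, u) (false, v) := by
      intro u v
      simp [addCell]
    simp only [Ctx.cells, Ctx.add, Ctx.cells_add hk a L C]
    rw [List.zipWith_append (by simp), List.zipWith_append (by simp [List.length_flatMap]),
      zipWith_flatMap _ _ _ _ (by simp)]
    simp only [List.zipWith_map, List.zipWith_self, Finsupp.add_apply, hm]
    congr 1
    exact List.map_congr_left fun l _ => hs _ _

theorem ShBag.cells_add (hk : 1 ≤ k) {A : Ty} (a : Fin n ↪ Base) (L : List (FVal Base))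
    (x y : ShBag Base k A) :
    (x.add y).cells a L = List.zipWith addCell (x.cells a L) (y.cells a L) := by
  have hm : ∀ u v : ZMod (2 ^ k), (false, u + v) = addCell (false, u) (false, v) := by
    intro u v
    simp [addCell]
  simp only [ShBag.cells, ShBag.add, Ctx.cells_add hk]
  rw [List.zipWith_append (by simp)]
  simp only [List.zipWith_map, List.zipWith_self, Finsupp.add_apply, hm]

theorem DB.cells_add (hk : 1 ≤ k) {r : ℕ} {S : Fin r → Ty} (a : Fin n ↪ Base) (m : ℕ)
    (D Δ : DB Base k S) :
    (D.add Δ).cells a m = List.zipWith addCell (D.cells a m) (Δ.cells a m) := by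
  simp only [DB.cells, DB.add, ShBag.cells_add hk]
  rw [zipWith_flatMap _ _ _ _ (by simp [ShBag.length_cells])]

/-! ### Decoding a database from its cells -/

/-- The content of the cell with number `q`. -/
def DB.enc {r : ℕ} {S : Fin r → Ty} (a : Fin n ↪ Base) (m : ℕ) (D : DB Base k S) (q : ℕ) :
    ZMod (2 ^ k) := ((D.cells a m).getD q (false, 0)).2

open Classical in
/-- The flat bag whose possible elements `ts` have the multiplicities `y 0, y 1, …`. -/
noncomputable def decFlat (ts : List (FVal Base)) (y : ℕ → ZMod (2 ^ k)) : Bag Base k :=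
  Finsupp.onFinset ts.toFinset (fun t => if t ∈ ts then y (ts.idxOf t) else 0) fun t ht => by
    by_contra h
    exact ht (if_neg fun h' => h (List.mem_toFinset.2 h'))

open Classical in
/-- The context whose cells are `y 0, y 1, …`. A support cell is read modulo `2`, which makes the
decoding total and keeps the support a function of bounded degree of its cell. -/
noncomputable def Ctx.dec (a : Fin n ↪ Base) (L : List (FVal Base)) :
    (A : Ty) → (ℕ → ZMod (2 ^ k)) → A.Ctx Base k
  | .unit, _ => ()
  | .base, _ => ()
  | .prod A B, y =>
      (Ctx.dec a L A y, Ctx.dec a L B fun q => y (A.numCtxCells n L.length + q))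
  | .bag C, y =>
      (⟨fun l => decide (l ∈ L) && (y (L.idxOf l)).val.testBit 0,
        fun l => if l ∈ L then decFlat (tuples a L C) fun q =>
            y (L.length + (L.idxOf l * C.numTuples n L.length + q))
          else 0⟩,
       Ctx.dec a L C fun q => y (L.length + (L.length * C.numTuples n L.length + q)))

/-- The database whose cells are `y 0, y 1, …`. -/
noncomputable def DB.dec {r : ℕ} (S : Fin r → Ty) (a : Fin n ↪ Base) (m : ℕ)
    (y : ℕ → ZMod (2 ^ k)) : DB Base k S := fun i =>
  let off := (((List.finRange r).take i).map fun j =>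
    (S j).numTuples n m + (S j).numCtxCells n m).sum
  ⟨decFlat (tuples a (inpLabels Base m) (S i)) fun q => y (off + q),
   Ctx.dec a (inpLabels Base m) (S i) fun q => y (off + ((S i).numTuples n m + q))⟩

/-- The sequence `y` starts with the contents of the cells `l`. -/
def Reads (y : ℕ → ZMod (2 ^ k)) (l : List (Bool × ZMod (2 ^ k))) : Prop :=
  ∀ q, q < l.length → y q = (l.getD q (false, 0)).2

theorem Reads.left {y : ℕ → ZMod (2 ^ k)} {l₁ l₂ : List (Bool × ZMod (2 ^ k))}
    (h : Reads y (l₁ ++ l₂)) : Reads y l₁ := by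
  intro q hq
  rw [h q (by rw [List.length_append]; omega), List.getD_append _ _ _ _ hq]

theorem Reads.right {y : ℕ → ZMod (2 ^ k)} {l₁ l₂ : List (Bool × ZMod (2 ^ k))}
    (h : Reads y (l₁ ++ l₂)) : Reads (fun q => y (l₁.length + q)) l₂ := by
  intro q hq
  show y _ = _
  rw [h _ (by rw [List.length_append]; omega),
    List.getD_append_right _ _ _ _ (Nat.le_add_right _ _), Nat.add_sub_cancel_left]

theorem decFlat_eq {ts : List (FVal Base)} {y : ℕ → ZMod (2 ^ k)} {b : Bag Base k}
    (hb : ∀ t, b t ≠ 0 → t ∈ ts) (h : Reads y (ts.map fun t => (false, b t))) :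
    decFlat ts y = b := by
  classical
  ext t
  simp only [decFlat, Finsupp.onFinset_apply]
  split_ifs with ht
  · have hi : List.idxOf t ts < ts.length := List.idxOf_lt_length_iff.2 ht
    have := h (List.idxOf t ts) (by simpa using hi)
    convert this using 2
    rw [List.getD_eq_getElem _ _ (by simpa using hi)]
    simp
  · by_contra hne
    exact ht (hb t (Ne.symm hne))

theorem Ctx.dec_eq (hk : 1 ≤ k) (a : Fin n ↪ Base) (L : List (FVal Base)) :
    (A : Ty) → (x : A.Ctx Base k) → Ctx.Over a L A x → (y : ℕ → ZMod (2 ^ k)) →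
      Reads y (Ctx.cells a L A x) → Ctx.dec a L A y = x
  | .unit, _, _, _, _ => rfl
  | .base, _, _, _, _ => rfl
  | .prod A B, x, hx, y, hy => by
    refine Prod.ext (Ctx.dec_eq hk a L A _ hx.1 _ hy.left) ?_
    have := hy.right
    rw [Ctx.length_cells] at this
    exact Ctx.dec_eq hk a L B _ hx.2 _ this
  | .bag C, x, hx, y, hy => by
    classical
    have h1 := hy.left
    have h2 := hy.right.left
    have h3 := hy.right.right
    have hlen : ∀ l ∈ L, ((tuples a L C).map fun t =>
        ((false, x.1.defn l t) : Bool × ZMod (2 ^ k))).length = C.numTuples n L.length :=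
      fun l _ => by rw [List.length_map, length_tuples]
    rw [List.length_map] at h2 h3
    rw [length_flatMap_of_length _ _ _ hlen] at h3
    refine Prod.ext ?_ (Ctx.dec_eq hk a L C _ hx.2.2 _ h3)
    have hs : (fun l => decide (l ∈ L) && (y (L.idxOf l)).val.testBit 0) = x.1.supp := by
      funext l
      by_cases hl : l ∈ L
      · have hi : L.idxOf l < L.length := List.idxOf_lt_length_iff.2 hl
        have e := h1 (L.idxOf l) (by simpa using hi)
        rw [List.getD_eq_getElem _ _ (by simpa using hi), List.getElem_map,
          List.getElem_idxOf] at e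
        rw [e]
        cases x.1.supp l <;> simp [hl, -Nat.testBit_zero, testBit_zero_one hk]
      · have : x.1.supp l = false := by
          by_contra h
          exact hl (hx.1 l (by simpa using h))
        simp [hl, this]
    have hd : (fun l => if l ∈ L then decFlat (tuples a L C) fun q =>
        y (L.length + (L.idxOf l * C.numTuples n L.length + q)) else 0) = x.1.defn := by
      funext l
      by_cases hl : l ∈ L
      · rw [if_pos hl]
        have hi : L.idxOf l < L.length := List.idxOf_lt_length_iff.2 hl
        refine decFlat_eq (fun t ht => (hx.2.1 l t ht).2) ?_
        intro q hq
        rw [List.length_map, length_tuples] at hq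
        have hq2 : L.idxOf l * C.numTuples n L.length + q <
            (L.flatMap fun l => (tuples a L C).map fun t =>
              ((false, x.1.defn l t) : Bool × ZMod (2 ^ k))).length := by
          rw [length_flatMap_of_length _ _ _ hlen]
          calc _ < (L.idxOf l + 1) * C.numTuples n L.length := by rw [add_mul, one_mul]; omega
            _ ≤ _ := Nat.mul_le_mul_right _ hi
        have e := h2 _ hq2
        rw [getD_flatMap_of_length _ _ _ _ hlen _ _ hi hq, List.getElem_idxOf] at e
        exact e
      · rw [if_neg hl]
        ext t
        by_contra h
        exact hl (hx.1 l (hx.2.1 l t (Ne.symm h)).1)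
    show (⟨fun l => decide (l ∈ L) && (y (L.idxOf l)).val.testBit 0,
        fun l => if l ∈ L then decFlat (tuples a L C) fun q =>
          y (L.length + (L.idxOf l * C.numTuples n L.length + q)) else 0⟩ : Dict Base k) = x.1
    rw [hs, hd]

/-- Databases over the active domain are determined by their cells. -/
theorem DB.dec_enc (hk : 1 ≤ k) {r : ℕ} {S : Fin r → Ty} (a : Fin n ↪ Base) (m : ℕ)
    (D : DB Base k S) (hD : D.Over a m) : DB.dec S a m (D.enc a m) = D := by
  funext i
  have h : Reads (fun q => D.enc a m ((((List.finRange r).take i).map fun j =>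
      (S j).numTuples n m + (S j).numCtxCells n m).sum + q))
      ((D i).cells a (inpLabels Base m)) := by
    intro q hq
    have e := getD_flatMap_finRange (fun i => (D i).cells a (inpLabels Base m)) (false, 0) i q hq
    simp only [ShBag.length_cells, length_inpLabels] at e
    show ((DB.cells a m D).getD _ _).2 = _
    rw [← e]
    rfl
  have h2 := h.right
  rw [List.length_map, length_tuples, length_inpLabels] at h2
  show ShBag.mk _ _ = D i
  have e1 := decFlat_eq (hD i).1 h.left
  have e2 := Ctx.dec_eq hk a (inpLabels Base m) (S i) (D i).ctx (hD i).2 _ h2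
  rw [e1, e2]

theorem Ctx.Over.add {a : Fin n ↪ Base} {L : List (FVal Base)} :
    {A : Ty} → {x y : A.Ctx Base k} → Ctx.Over a L A x → Ctx.Over a L A y →
      Ctx.Over a L A (Ctx.add A x y)
  | .unit, _, _, _, _ => trivial
  | .base, _, _, _, _ => trivial
  | .prod _ _, _, _, hx, hy => ⟨Ctx.Over.add hx.1 hy.1, Ctx.Over.add hx.2 hy.2⟩
  | .bag C, x, y, hx, hy => by
    refine ⟨fun l hl => ?_, fun l t hlt => ?_, Ctx.Over.add hx.2.2 hy.2.2⟩
    · have hl' : (x.1.supp l || y.1.supp l) = true := hl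
      rcases Bool.or_eq_true_iff.1 hl' with h | h
      · exact hx.1 l h
      · exact hy.1 l h
    · have hlt' : x.1.defn l t + y.1.defn l t ≠ 0 := hlt
      show (x.1.supp l || y.1.supp l) = true ∧ _
      by_cases h : x.1.defn l t = 0
      · have h' : y.1.defn l t ≠ 0 := fun h' => hlt' (by rw [h, h', add_zero])
        exact ⟨by simp [(hy.2.1 l t h').1], (hy.2.1 l t h').2⟩
      · exact ⟨by simp [(hx.2.1 l t h).1], (hx.2.1 l t h).2⟩

theorem DB.Over.add {r : ℕ} {S : Fin r → Ty} {a : Fin n ↪ Base} {m : ℕ} {D Δ : DB Base k S}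
    (hD : D.Over a m) (hΔ : Δ.Over a m) : (D.add Δ).Over a m := by
  refine fun i => ⟨fun t ht => ?_, Ctx.Over.add (hD i).2 (hΔ i).2⟩
  have ht' : (D i).flat t + (Δ i).flat t ≠ 0 := ht
  by_cases h : (D i).flat t = 0
  · exact (hΔ i).1 t fun h' => ht' (by rw [h, h', add_zero])
  · exact (hD i).1 t h

/-- Is the cell with number `q` a support? -/
def isSupp {r : ℕ} (S : Fin r → Ty) (n m q : ℕ) : Bool :=
  (expandRuns ((List.finRange r).flatMap fun i => (S i).runs n m)).getD q false

theorem DB.fst_getD_cells {r : ℕ} {S : Fin r → Ty} (a : Fin n ↪ Base) (m : ℕ)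
    (D : DB Base k S) (q : ℕ) : ((D.cells a m).getD q (false, 0)).1 = isSupp S n m q := by
  rw [isSupp, ← DB.map_fst_cells a m D]
  exact (List.getD_map _ ((false, 0) : Bool × ZMod (2 ^ k)) Prod.fst).symm

/-- The `i`-th bit of the increment of the cell with number `q` under the update `Δ`. A support that
is already set gets no increment. -/
def stepBit {r : ℕ} {S : Fin r → Ty} (a : Fin n ↪ Base) (m : ℕ) (D Δ : DB Base k S)
    (q i : ℕ) : Bool :=
  if isSupp S n m q then
    decide (i = 0) && (((Δ.blocks a m).getD q []).getD 0 false && !(D.enc a m q).val.testBit 0)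
  else ((Δ.blocks a m).getD q []).getD i false

theorem DB.getD_blocks (hk : 1 ≤ k) {r : ℕ} {S : Fin r → Ty} (a : Fin n ↪ Base) (m : ℕ)
    (D : DB Base k S) (q : ℕ) (hq : q < numCells S n m) :
    (D.blocks a m).getD q [] =
      if isSupp S n m q then [(D.enc a m q).val.testBit 0] else bits (D.enc a m q) := by
  rw [← DB.map_cellBits_cells hk, List.getD_eq_getElem _ _ (by simpa [DB.length_cells] using hq),
    List.getElem_map, ← DB.fst_getD_cells a m D, DB.enc,
    List.getD_eq_getElem _ _ (by simpa [DB.length_cells] using hq)]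
  rfl

theorem DB.enc_eq_zero {r : ℕ} {S : Fin r → Ty} (a : Fin n ↪ Base) (m : ℕ)
    (D : DB Base k S) (q : ℕ) (hq : numCells S n m ≤ q) : D.enc a m q = 0 := by
  rw [DB.enc, List.getD_eq_default _ _ (by rw [DB.length_cells]; exact hq)]

/-- Every update, also one of a support, acts on the contents of the cells by addition. -/
theorem DB.enc_add (hk : 1 ≤ k) {r : ℕ} {S : Fin r → Ty} (a : Fin n ↪ Base) (m : ℕ)
    (D Δ : DB Base k S) (q : ℕ) : (D.add Δ).enc a m q =
      D.enc a m q + ∑ i ∈ Finset.range k, if stepBit a m D Δ q i then 2 ^ i else 0 := by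
  rcases lt_or_ge q (numCells S n m) with hq | hq
  · have e : (D.add Δ).enc a m q = (addCell ((D.cells a m).getD q (false, 0))
        ((Δ.cells a m).getD q (false, 0))).2 := by
      rw [DB.enc, DB.cells_add hk, List.getD_eq_getElem _ _ (by simpa [DB.length_cells] using hq),
        List.getElem_zipWith, List.getD_eq_getElem _ _ (by simpa [DB.length_cells] using hq),
        List.getD_eq_getElem _ _ (by simpa [DB.length_cells] using hq)]
    rw [e, addCell, DB.fst_getD_cells]
    show D.enc a m q + (if isSupp S n m q = true then
      (if ((Δ.enc a m q).val.testBit 0 && !(D.enc a m q).val.testBit 0) = true then 1 else 0)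
      else Δ.enc a m q) = _
    congr 1
    simp only [stepBit, DB.getD_blocks hk a m Δ q hq]
    cases isSupp S n m q
    · simp only [Bool.false_eq_true, if_false]
      exact (ofBits_bits (Δ.enc a m q)).symm
    · simp only [if_true]
      rw [Finset.sum_eq_single 0]
      · simp
      · intro i _ hi
        simp [hi]
      · intro h
        exact absurd (Finset.mem_range.2 (show 0 < k by omega)) h
  · rw [DB.enc_eq_zero a m _ q hq, DB.enc_eq_zero a m _ q hq, zero_add, eq_comm]
    refine Finset.sum_eq_zero fun i _ => ?_
    have hl : (Δ.blocks a m).length = numCells S n m := by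
      rw [← DB.map_cellBits_cells hk, List.length_map, DB.length_cells]
    simp [stepBit, List.getElem?_eq_none (hl.trans_le hq)]

theorem stepBit_eq_false {r : ℕ} {S : Fin r → Ty} {a : Fin n ↪ Base} {m : ℕ} {D Δ : DB Base k S}
    {c : ℕ} {p : Fin c → ℕ} (h : SupportedAt a m Δ p) {q : ℕ} (hq : ∀ j, p j ≠ q) (i : ℕ) :
    stepBit a m D Δ q i = false := by
  have hb : ∀ i, ((Δ.blocks a m).getD q []).getD i false = false := by
    intro i
    rcases lt_or_ge i ((Δ.blocks a m).getD q []).length with hi | hi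
    · rw [List.getD_eq_getElem _ _ hi]
      exact h q hq _ (List.getElem_mem hi)
    · exact List.getD_eq_default _ _ hi
  simp only [stepBit, hb]
  simp

end Cells

/-! ### Bits of the view as functions of the cells of the database -/

section View

variable {Base : Type} {k n : ℕ}

theorem polyBag_decFlat (ts : List (FVal Base)) (σ : ℕ → ℕ) :
    PolyBag (k + 1) fun x : ℕ → ZMod (2 ^ k) => decFlat ts fun q => x (σ q) := by
  classical
  refine ⟨⟨ts.toFinset, fun x => Finsupp.support_onFinset_subset⟩, fun t => ?_⟩
  by_cases ht : t ∈ ts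
  · simpa [decFlat, ht] using DegLE.coord k (σ (ts.idxOf t))
  · simpa [decFlat, ht] using DegLE.const (k + 1) (0 : ZMod (2 ^ k))

theorem polyCtx_dec (hk : 1 ≤ k) (a : Fin n ↪ Base) (L : List (FVal Base)) :
    (A : Ty) → (σ : ℕ → ℕ) →
      PolyCtx (k + 1) A fun x : ℕ → ZMod (2 ^ k) => Ctx.dec a L A fun q => x (σ q)
  | .unit, _ => trivial
  | .base, _ => trivial
  | .prod A B, σ => ⟨polyCtx_dec hk a L A σ, polyCtx_dec hk a L B fun q => σ (_ + q)⟩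
  | .bag C, σ => by
    classical
    refine ⟨fun l => ?_, fun l => ?_, polyCtx_dec hk a L C fun q => σ (L.length + (_ + q))⟩
    · by_cases hl : l ∈ L
      · have := degLE_parity hk (σ (L.idxOf l))
        simpa [Ctx.dec, hl, parity] using this
      · simpa [Ctx.dec, hl] using DegLE.const (k + 1) (0 : ZMod (2 ^ k))
    · by_cases hl : l ∈ L
      · have := polyBag_decFlat (k := k) (tuples a L C)
          fun q => σ (L.length + (L.idxOf l * C.numTuples n L.length + q))
        simpa [Ctx.dec, hl] using this
      · simpa [Ctx.dec, hl] using PolyBag.const (k + 1) (0 : Bag Base k)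

/-- The highest bit of a multiplicity. -/
def topBit (v : ZMod (2 ^ k)) : Bool := v.val.testBit (k - 1)

/-- All bits of the string `s x` are highest bits of functions of degree at most `N`. -/
def PolyBits (N : ℕ) (s : (ℕ → ZMod (2 ^ k)) → List Bool) : Prop :=
  ∃ gs : List ((ℕ → ZMod (2 ^ k)) → ZMod (2 ^ k)),
    (∀ g ∈ gs, DegLE N g) ∧ ∀ x, s x = gs.map fun g => topBit (g x)

theorem PolyBits.nil (N : ℕ) : PolyBits N fun _ : ℕ → ZMod (2 ^ k) => [] :=
  ⟨[], by simp, by simp⟩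

theorem PolyBits.append {N : ℕ} {s t : (ℕ → ZMod (2 ^ k)) → List Bool} (hs : PolyBits N s)
    (ht : PolyBits N t) : PolyBits N fun x => s x ++ t x := by
  obtain ⟨gs, h1, h2⟩ := hs
  obtain ⟨gs', h1', h2'⟩ := ht
  refine ⟨gs ++ gs', fun g hg => ?_, fun x => by
    show s x ++ t x = _
    rw [h2, h2', List.map_append]⟩
  rcases List.mem_append.1 hg with h | h
  · exact h1 g h
  · exact h1' g h

theorem PolyBits.flatMap {N : ℕ} {α : Type} (l : List α)
    {s : (ℕ → ZMod (2 ^ k)) → α → List Bool} (hs : ∀ i, PolyBits N fun x => s x i) :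
    PolyBits N fun x => l.flatMap (s x) := by
  induction l with
  | nil => exact PolyBits.nil N
  | cons i l ih => simpa only [List.flatMap_cons] using (hs i).append ih

theorem PolyBits.bits {N : ℕ} {f : (ℕ → ZMod (2 ^ k)) → ZMod (2 ^ k)} (hf : DegLE N f) :
    PolyBits N fun x => bits (f x) := by
  refine ⟨(List.range k).map fun j x => 2 ^ (k - 1 - j) * f x, fun g hg => ?_, fun x => ?_⟩
  · obtain ⟨j, _, rfl⟩ := List.mem_map.1 hg
    exact hf.const_mul _
  · rw [List.map_map]
    refine List.map_congr_left fun j hj => ?_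
    exact (testBit_top _ (List.mem_range.1 hj)).symm

theorem PolyBits.indicator (hk : 1 ≤ k) {N : ℕ} {s : (ℕ → ZMod (2 ^ k)) → Bool}
    (hs : DegLE N fun x => if s x = true then 1 else 0) : PolyBits N fun x => [s x] := by
  refine ⟨[fun x => 2 ^ (k - 1 - 0) * (if s x = true then 1 else 0)], ?_, fun x => ?_⟩
  · simpa using hs.const_mul (2 ^ (k - 1 - 0))
  · rw [List.map_singleton, topBit, testBit_top _ (by omega)]
    cases hs : s x <;> simp [hs, -Nat.testBit_zero, testBit_zero_one hk]

theorem polyBits_ctx (hk : 1 ≤ k) {N : ℕ} (a : Fin n ↪ Base) (L : List (FVal Base)) :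
    (A : Ty) → (c : (ℕ → ZMod (2 ^ k)) → A.Ctx Base k) → PolyCtx N A c →
      PolyBits N fun x => (Ctx.blocks a L A (c x)).flatten
  | .unit, _, _ => PolyBits.nil N
  | .base, _, _ => PolyBits.nil N
  | .prod A B, c, hc => by
    simpa only [Ctx.blocks, List.flatten_append] using
      (polyBits_ctx hk a L A _ hc.1).append (polyBits_ctx hk a L B _ hc.2)
  | .bag C, c, hc => by
    have h1 : PolyBits N fun x => L.flatMap fun l => [(c x).1.supp l] :=
      PolyBits.flatMap L fun l => PolyBits.indicator hk (hc.1 l)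
    have h2 : PolyBits N fun x => L.flatMap fun l => (tuples a L C).flatMap fun t =>
        bits ((c x).1.defn l t) :=
      PolyBits.flatMap L fun l => PolyBits.flatMap _ fun t => PolyBits.bits ((hc.2.1 l).2 t)
    have hf : ∀ g : FVal Base → List (List Bool),
        (L.flatMap g).flatten = L.flatMap fun l => (g l).flatten := by
      intro g
      simp only [← List.flatMap_id, List.flatMap_assoc]
    simpa only [Ctx.blocks, List.flatten_append, ← List.flatMap_def, hf] using
      (h1.append h2).append (polyBits_ctx hk a L C _ hc.2.2)

/-- The bits of the view of a query are the highest bits of functions of bounded degree of the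
cells of the database. -/
theorem exists_polyBits_view (hk : 1 ≤ k) {r : ℕ} {S : Fin r → Ty} {B : Ty} (h : Query Base S B) :
    ∃ N, ∀ (n m : ℕ) (a : Fin n ↪ Base),
      PolyBits N fun x : ℕ → ZMod (2 ^ k) => viewBits h m a (DB.dec S a m x) := by
  obtain ⟨N, hN⟩ := polyBag_shred (k := k) h (k + 1)
  refine ⟨N, fun n m a => ?_⟩
  have hp := hN (fun x => DB.dec S a m x) 0 (fun _ _ => []) (fun _ => ()) (fun _ => ())
    (fun j => ⟨polyBag_decFlat _ fun q => _ + q, polyCtx_dec hk a _ _ fun q => _ + (_ + q)⟩)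
    (fun ε j => by simpa using PolyBag.const (k + 1) (0 : Bag Base k)) trivial trivial
  have h1 : PolyBits N fun x : ℕ → ZMod (2 ^ k) => (tuples a (h.labels m a) B).flatMap fun t =>
      bits ((h.view (DB.dec S a m x)).flat t) :=
    PolyBits.flatMap _ fun t => PolyBits.bits ((hp.1 []).2 t)
  have h2 := polyBits_ctx hk a (h.labels m a) B (fun x => (h.view (DB.dec S a m x)).ctx) hp.2
  simpa only [viewBits, ShBag.blocks, List.flatten_append, ← List.flatMap_def] using h1.append h2

theorem length_viewBits (hk : 1 ≤ k) {r : ℕ} {S : Fin r → Ty} {B : Ty} (h : Query Base S B)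
    (m : ℕ) (a : Fin n ↪ Base) (D : DB Base k S) : (viewBits h m a D).length =
      ((B.runs n (h.labels m a).length).map fun s => (if s.1 then 1 else k) * s.2).sum := by
  have h1 : ∀ l : List (Bool × ZMod (2 ^ k)), (l.map cellBits).flatten.length =
      ((l.map Prod.fst).map fun b => if b = true then 1 else k).sum := by
    intro l
    rw [List.length_flatten, List.map_map, List.map_map]
    congr 1
    refine List.map_congr_left fun c _ => ?_
    cases hc : c.1 <;> simp [cellBits, hc, length_bits]
  have h2 : ∀ l : List (Bool × ℕ), ((expandRuns l).map fun b => if b = true then 1 else k).sum =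
      (l.map fun s => (if s.1 then 1 else k) * s.2).sum := by
    intro l
    induction l with
    | nil => rfl
    | cons s l ih =>
      rw [expandRuns, List.flatMap_cons, List.map_append, List.sum_append, List.map_cons,
        List.sum_cons, ← ih, List.map_replicate, List.sum_replicate, smul_eq_mul, mul_comm]
      rfl
  rw [viewBits, ← ShBag.map_cellBits_cells hk, h1, ShBag.map_fst_cells, h2]

theorem length_getD_blocks (hk : 1 ≤ k) {r : ℕ} {S : Fin r → Ty} (a : Fin n ↪ Base) (m : ℕ)
    (D : DB Base k S) (q : ℕ) (hq : q < numCells S n m) :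
    ((D.blocks a m).getD q []).length = if isSupp S n m q then 1 else k := by
  rw [DB.getD_blocks hk a m D q hq]
  split_ifs
  · rfl
  · exact length_bits _

end View

/-! ### Labels -/

section Labels

variable {Base : Type} {n : ℕ}

/-- The number of assignments to variables of types `Θ` over `n` primitive values and `L` labels. -/
def numAssigns (n L : ℕ) (Θ : List Ty) : ℕ := (Θ.map (Ty.numTuples n L)).prod

/-- The number of labels produced by `labelsFrom` from `L` labels over `n` primitive values. -/
def numLabels (n : ℕ) : ℕ → List (List Ty) → ℕ
  | L, [] => L
  | L, Θ :: rest => numLabels n (L + numAssigns n L Θ) rest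

theorem length_assigns (a : Fin n ↪ Base) (L : List (FVal Base)) (Θ : List Ty) :
    (assigns a L Θ).length = numAssigns n L.length Θ := by
  induction Θ with
  | nil => rfl
  | cons A Θ ih =>
    rw [assigns, length_flatMap_of_length _ _ (numAssigns n L.length Θ)
      (fun v _ => by rw [List.length_map, ih]), length_tuples]
    simp [numAssigns]

theorem length_labelsFrom (a : Fin n ↪ Base) (i : ℕ) (L : List (FVal Base))
    (l : List (List Ty)) : (labelsFrom a i L l).length = numLabels n L.length l := by
  induction l generalizing i L with
  | nil => rfl
  | cons Θ l ih => rw [labelsFrom, ih, numLabels, List.length_append, List.length_map,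
      length_assigns]

theorem le_numLabels (n L : ℕ) (l : List (List Ty)) : L ≤ numLabels n L l := by
  induction l generalizing L with
  | nil => exact le_rfl
  | cons Θ l ih => exact (Nat.le_add_right _ _).trans (ih _)

theorem nodup_flatMap_map {α β γ : Type} {f : α → β → γ}
    (hf : ∀ v w v' w', f v w = f v' w' → v = v' ∧ w = w') {l : List α} {l' : List β}
    (hl : l.Nodup) (hl' : l'.Nodup) : (l.flatMap fun v => l'.map fun w => f v w).Nodup := by
  have h : (l.flatMap fun v => l'.map fun w => f v w) =
      (l.product l').map fun p => f p.1 p.2 := by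
    simp [List.product, List.map_flatMap, Function.comp_def]
  rw [h]
  refine (hl.product hl').map fun p p' hp => ?_
  have := hf _ _ _ _ hp
  exact Prod.ext this.1 this.2

theorem nodup_tuples (a : Fin n ↪ Base) {L : List (FVal Base)} (hL : L.Nodup) :
    (A : Ty) → (tuples a L A).Nodup
  | .unit => List.nodup_singleton _
  | .base => (List.nodup_finRange n).map fun _ _ h => a.injective (FVal.base.inj h)
  | .prod A B => nodup_flatMap_map (fun _ _ _ _ h => FVal.pair.inj h)
      (nodup_tuples a hL A) (nodup_tuples a hL B)
  | .bag _ => hL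

theorem nodup_assigns (a : Fin n ↪ Base) {L : List (FVal Base)} (hL : L.Nodup) :
    (Θ : List Ty) → (assigns a L Θ).Nodup
  | [] => List.nodup_singleton _
  | A :: Θ => nodup_flatMap_map (fun _ _ _ _ h => List.cons.inj h)
      (nodup_tuples a hL A) (nodup_assigns a hL Θ)

theorem nodup_labelsFrom (a : Fin n ↪ Base) (i : ℕ) (L : List (FVal Base)) (l : List (List Ty))
    (hL : L.Nodup) (hi : ∀ j ε, FVal.lab j ε ∈ L → j < i) : (labelsFrom a i L l).Nodup := by
  induction l generalizing i L with
  | nil => exact hL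
  | cons Θ l ih =>
    refine ih _ _ (List.Nodup.append hL
      ((nodup_assigns a hL Θ).map fun ε ε' h => (FVal.lab.inj h).2) ?_) fun j ε h => ?_
    · intro v hv hv'
      obtain ⟨ε, _, rfl⟩ := List.mem_map.1 hv'
      exact lt_irrefl i (hi i ε hv)
    · rcases List.mem_append.1 h with h | h
      · exact (hi j ε h).trans (Nat.lt_succ_self i)
      · obtain ⟨ε', _, h⟩ := List.mem_map.1 h
        rw [(FVal.lab.inj h).1]
        exact Nat.lt_succ_self j

theorem Query.nodup_labels {r : ℕ} {S : Fin r → Ty} {B : Ty} (h : Query Base S B) (m : ℕ)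
    (a : Fin n ↪ Base) : (h.labels m a).Nodup := by
  refine nodup_labelsFrom a 0 _ _ (List.nodup_range.map fun _ _ h => FVal.inp.inj h) ?_
  intro j ε hj
  simp [inpLabels] at hj

end Labels

/-! ### Arrays as auxiliary views -/

section Arrays

variable {Base : Type} {k r : ℕ} {S : Fin r → Ty} {B : Ty}

/-- Flat bags of the given schemas hold an arbitrary array: the tuple with number `i` in the
canonical order has the `i`-th entry of the array as its multiplicity. -/
theorem exists_auxViews (h : Query Base S B) (As : List Ty)
    (g : {n : ℕ} → ℕ → (Fin n ↪ Base) → DB Base k S → ℕ → ZMod (2 ^ k)) :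
    ∃ aux : List (AuxView Base k S), ∀ (n m : ℕ) (a : Fin n ↪ Base) (D : DB Base k S),
      (aux.flatMap fun V =>
        (tuples a (h.labels m a) V.schema).flatMap fun t => bits (V.mult m a D t)) =
      (List.range (As.map (Ty.numTuples n (h.labels m a).length)).sum).flatMap
        fun i => bits (g m a D i) := by
  classical
  induction As generalizing g with
  | nil => exact ⟨[], fun _ _ _ _ => rfl⟩
  | cons A As ih =>
    obtain ⟨aux, haux⟩ := ih fun {n} m a D i => g m a D (A.numTuples n (h.labels m a).length + i)
    refine ⟨⟨A, fun m a D t => g m a D ((tuples a (h.labels m a) A).idxOf t)⟩ :: aux,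
      fun n m a D => ?_⟩
    rw [List.flatMap_cons, haux, List.map_cons, List.sum_cons, List.range_add, List.flatMap_append]
    congr 1
    · rw [← length_tuples a]
      have hn := nodup_tuples a (h.nodup_labels m a) A
      have e : List.range (tuples a (h.labels m a) A).length =
          (tuples a (h.labels m a) A).map fun t => (tuples a (h.labels m a) A).idxOf t := by
        refine List.ext_getElem (by simp) fun i h1 h2 => ?_
        rw [List.getElem_range, List.getElem_map, hn.idxOf_getElem]
      rw [e, List.flatMap_map]
    · rw [List.flatMap_map]

/-- Schemas with `(n + L + 2) ^ K` tuples in total over `n` primitive values and `L` labels: the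
`K`-fold products of the factors `1`, `1`, `Base` and a label. -/
def powSchemas : ℕ → List Ty
  | 0 => [.unit]
  | K + 1 => (powSchemas K).flatMap fun A =>
      [.prod .unit A, .prod .unit A, .prod .base A, .prod (.bag .unit) A]

theorem sum_numTuples_powSchemas (n L K : ℕ) :
    ((powSchemas K).map (Ty.numTuples n L)).sum = (n + L + 2) ^ K := by
  induction K with
  | zero => rfl
  | succ K ih =>
    rw [pow_succ, ← ih, powSchemas]
    induction powSchemas K with
    | nil => simp
    | cons A As ih' =>
      rw [List.flatMap_cons, List.map_append, List.sum_append, ih', List.map_cons (l := As),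
        List.sum_cons, add_mul]
      congr 1
      simp [Ty.numTuples]
      ring

end Arrays

/-! ### Arithmetic expressions and their evaluation in logarithmic space -/

/-- Arithmetic expressions in the registers `0, …, v - 1`. -/
inductive NExp (v : ℕ) : Type
  | var (i : Fin v) : NExp v
  | const (c : ℕ) : NExp v
  | op (o : Op) (e₁ e₂ : NExp v) : NExp v

namespace NExp

variable {v : ℕ}

/-- The value of an expression when the registers have the contents `ρ`. -/
def eval (ρ : ℕ → ℕ) : NExp v → ℕ
  | .var i => ρ i
  | .const c => c
  | .op o e₁ e₂ => o.eval (e₁.eval ρ) (e₂.eval ρ)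

instance : Add (NExp v) := ⟨.op .add⟩
instance : Sub (NExp v) := ⟨.op .sub⟩
instance : Mul (NExp v) := ⟨.op .mul⟩
instance : Div (NExp v) := ⟨.op .div⟩
instance : Mod (NExp v) := ⟨.op .mod⟩

variable (ρ : ℕ → ℕ) (e e₁ e₂ : NExp v)

@[simp] theorem eval_var (i : Fin v) : (var i).eval ρ = ρ i := rfl
@[simp] theorem eval_const (c : ℕ) : (const c : NExp v).eval ρ = c := rfl
@[simp] theorem eval_add : (e₁ + e₂).eval ρ = e₁.eval ρ + e₂.eval ρ := rfl
@[simp] theorem eval_sub : (e₁ - e₂).eval ρ = e₁.eval ρ - e₂.eval ρ := rfl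
@[simp] theorem eval_mul : (e₁ * e₂).eval ρ = e₁.eval ρ * e₂.eval ρ := rfl
@[simp] theorem eval_div : (e₁ / e₂).eval ρ = e₁.eval ρ / e₂.eval ρ := rfl
@[simp] theorem eval_mod : (e₁ % e₂).eval ρ = e₁.eval ρ % e₂.eval ρ := rfl

/-- The number `1` if `e₁ < e₂`, and `0` otherwise: truncated subtraction gives `0 / 0 = 0` in the
second case. -/
def lt (e₁ e₂ : NExp v) : NExp v := (e₂ - e₁) / (e₂ - e₁)

@[simp] theorem eval_lt : (lt e₁ e₂).eval ρ = if e₁.eval ρ < e₂.eval ρ then 1 else 0 := by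
  show (e₂.eval ρ - e₁.eval ρ) / (e₂.eval ρ - e₁.eval ρ) = _
  split_ifs with h
  · exact Nat.div_self (by omega)
  · rw [Nat.sub_eq_zero_of_le (by omega)]

/-- The value of `e₁` where `b` has the value `1`, and that of `e₂` where it has the value `0`. -/
def cond (b e₁ e₂ : NExp v) : NExp v := b * e₁ + (const 1 - b) * e₂

theorem eval_cond {b : NExp v} {p : Prop} [Decidable p] (hb : b.eval ρ = if p then 1 else 0) :
    (cond b e₁ e₂).eval ρ = if p then e₁.eval ρ else e₂.eval ρ := by
  show b.eval ρ * e₁.eval ρ + (1 - b.eval ρ) * e₂.eval ρ = _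
  rw [hb]
  split_ifs <;> simp

/-- The power of an expression with a fixed exponent. -/
def pow (e : NExp v) : ℕ → NExp v
  | 0 => const 1
  | K + 1 => pow e K * e

@[simp] theorem eval_pow (K : ℕ) : (pow e K).eval ρ = e.eval ρ ^ K := by
  induction K with
  | zero => rfl
  | succ K ih => rw [pow, eval_mul, ih, pow_succ]

/-- The sum of a fixed list of expressions. -/
def sum (l : List (NExp v)) : NExp v := l.foldr (· + ·) (const 0)

@[simp] theorem eval_sum (l : List (NExp v)) :
    (sum l).eval ρ = (l.map (eval ρ)).sum := by
  induction l with
  | nil => rfl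
  | cons e l ih =>
    show e.eval ρ + (sum l).eval ρ = _
    rw [ih, List.map_cons, List.sum_cons]

theorem eval_congr {ρ ρ' : ℕ → ℕ} (h : ∀ i < v, ρ i = ρ' i) (e : NExp v) :
    e.eval ρ = e.eval ρ' := by
  induction e with
  | var i => exact h i i.2
  | const c => rfl
  | op o e₁ e₂ ih₁ ih₂ => rw [eval, ih₁, ih₂]; rfl

/-- The degree of a polynomial bound for an expression. -/
def weight : NExp v → ℕ
  | .var _ => 1
  | .const c => c + 1
  | .op _ e₁ e₂ => e₁.weight + e₂.weight

theorem weight_pos (e : NExp v) : 1 ≤ e.weight := by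
  induction e with
  | var i => exact le_rfl
  | const c => exact Nat.le_add_left 1 c
  | op o e₁ e₂ ih₁ ih₂ => exact ih₁.trans (Nat.le_add_right _ _)

theorem eval_le {ρ : ℕ → ℕ} {M : ℕ} (hM : 2 ≤ M) (hρ : ∀ i < v, ρ i ≤ M) (e : NExp v) :
    e.eval ρ ≤ M ^ e.weight := by
  induction e with
  | var i => simpa [eval, weight] using hρ i i.2
  | const c =>
    calc c ≤ 2 ^ (c + 1) := (Nat.lt_two_pow_self.trans (Nat.pow_lt_pow_succ one_lt_two)).le
      _ ≤ M ^ (c + 1) := Nat.pow_le_pow_left hM _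
  | op o e₁ e₂ ih₁ ih₂ =>
    have l : ∀ e : NExp v, 2 ≤ M ^ e.weight := fun e =>
      hM.trans (Nat.le_self_pow (by have := e.weight_pos; omega) M)
    have hl : M ^ e₁.weight ≤ M ^ e₁.weight * M ^ e₂.weight :=
      Nat.le_mul_of_pos_right _ (by have := l e₂; omega)
    rw [weight, pow_add]
    cases o with
    | add =>
      exact (Nat.add_le_add ih₁ ih₂).trans (Nat.add_le_mul (l e₁) (l e₂))
    | sub => exact (Nat.sub_le _ _).trans (ih₁.trans hl)
    | mul => exact Nat.mul_le_mul ih₁ ih₂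
    | div => exact (Nat.div_le_self _ _).trans (ih₁.trans hl)
    | mod => exact (Nat.mod_le _ _).trans (ih₁.trans hl)

/-- The program that stores the value of an expression in register `d` and uses registers from `d`
on only. -/
def code : NExp v → ℕ → Prog
  | .var i, d => .seq (.set d 0) (.op .add d i d)
  | .const c, d => .set d c
  | .op o e₁ e₂, d => .seq (e₁.code d) (.seq (e₂.code (d + 1)) (.op o d d (d + 1)))

theorem runs_code {M N : ℕ} (hM : 2 ≤ M) (e : NExp v) (hN : M ^ e.weight ≤ N) (d : ℕ)
    (hd : v ≤ d) (σ : ℕ → ℕ) (hσ : ∀ i < v, σ i ≤ M) :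
    ∃ σ', Prog.Runs N (e.code d) σ [] σ' ∧ σ' d = e.eval σ ∧ ∀ i < d, σ' i = σ i := by
  induction e generalizing d σ with
  | var i =>
    have hi : (i : ℕ) ≠ d := by omega
    refine ⟨_, .seq (.set σ d 0 (Nat.zero_le N)) (.op _ .add d i d ?_), ?_, fun j hj => ?_⟩
    · simpa [Op.eval, Function.update_of_ne hi, weight] using
        (hσ i i.2).trans (by simpa [weight] using hN)
    · simp [Op.eval, Function.update_of_ne hi]
    · simp [Function.update_of_ne hj.ne]
  | const c =>
    refine ⟨_, .set σ d c ((eval_le hM hσ (const c)).trans hN), by simp, fun j hj => ?_⟩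
    simp [Function.update_of_ne hj.ne]
  | op o e₁ e₂ ih₁ ih₂ =>
    have hpos : 0 < M := by omega
    obtain ⟨σ₁, r₁, h₁, k₁⟩ := ih₁
      ((Nat.pow_le_pow_right hpos (Nat.le_add_right _ _)).trans hN) d hd σ hσ
    obtain ⟨σ₂, r₂, h₂, k₂⟩ := ih₂
      ((Nat.pow_le_pow_right hpos (Nat.le_add_left _ _)).trans hN) (d + 1) (by omega) σ₁
      fun i hi => by rw [k₁ i (by omega)]; exact hσ i hi
    have a₁ : σ₂ d = e₁.eval σ := by rw [k₂ d (Nat.lt_succ_self d), h₁]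
    have a₂ : σ₂ (d + 1) = e₂.eval σ := by
      rw [h₂]; exact eval_congr (fun i hi => k₁ i (by omega)) e₂
    have r := Prog.Runs.seq r₁ (.seq r₂ (.op σ₂ o d d (d + 1) (by
      rw [a₁, a₂]; exact (eval_le hM hσ (op o e₁ e₂)).trans hN)))
    refine ⟨_, r, ?_, fun i hi => ?_⟩
    · rw [Function.update_self, a₁, a₂]; rfl
    · rw [Function.update_of_ne hi.ne, k₂ i (by omega), k₁ i hi]

/-- The program that prints the values of some expressions, with working registers from `d` on. -/
def print (l : List (NExp v)) (d : ℕ) : Prog :=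
  l.foldr (fun e P => .seq (.seq (e.code d) (.emit d)) P) .skip

theorem runs_print {M N : ℕ} (hM : 2 ≤ M) (l : List (NExp v))
    (hN : ∀ e ∈ l, M ^ e.weight ≤ N) (d : ℕ) (hd : v ≤ d) (σ : ℕ → ℕ) (hσ : ∀ i < v, σ i ≤ M) :
    ∃ σ', Prog.Runs N (print l d) σ (l.map (eval σ)) σ' ∧ ∀ i < d, σ' i = σ i := by
  induction l generalizing σ with
  | nil => exact ⟨σ, .skip σ, fun _ _ => rfl⟩
  | cons e l ih =>
    obtain ⟨σ₁, r₁, h₁, k₁⟩ := runs_code hM e (hN e (by simp)) d hd σ hσ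
    obtain ⟨σ₂, r₂, k₂⟩ := ih (fun e he => hN e (by simp [he])) σ₁
      fun i hi => by rw [k₁ i (by omega)]; exact hσ i hi
    have e₁ : l.map (eval σ) = l.map (eval σ₁) :=
      List.map_congr_left fun e _ => eval_congr (fun i hi => (k₁ i (by omega)).symm) e
    refine ⟨σ₂, ?_, fun i hi => by rw [k₂ i hi, k₁ i hi]⟩
    have r := Prog.Runs.seq (Prog.Runs.seq r₁ (.emit σ₁ d)) r₂
    rw [h₁] at r
    rw [List.map_cons, e₁]
    exact r

/-- The program that prints the values of the expressions `l` for `o = 0, 1, …`, below the value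
of `e`. The loop variable `o` is register `w`; register `w + 1` counts the remaining rounds, and
register `w + 2` holds the constant `1`. -/
def loop {w : ℕ} (e : NExp w) (l : List (NExp (w + 1))) : Prog :=
  .seq (.set w 0) (.seq (e.code (w + 1)) (.seq (.set (w + 2) 1) (.whileNonzero (w + 1)
    (.seq (print l (w + 3)) (.seq (.op .add w w (w + 2)) (.op .sub (w + 1) (w + 1) (w + 2)))))))

/-- The rounds of `loop` that remain when `j` values of the loop variable are left. -/
theorem runs_while {w M N : ℕ} (hM : 2 ≤ M) (hMN : M ≤ N) (l : List (NExp (w + 1)))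
    (hN : ∀ e ∈ l, M ^ e.weight ≤ N) (ρ : ℕ → ℕ) (hρ : ∀ i < w, ρ i ≤ M) (j : ℕ) (σ : ℕ → ℕ)
    (hσ : ∀ i < w, σ i = ρ i) (h1 : σ (w + 1) = j) (h2 : σ (w + 2) = 1) (h3 : σ w + j ≤ M) :
    ∃ σ', Prog.Runs N (.whileNonzero (w + 1)
        (.seq (print l (w + 3)) (.seq (.op .add w w (w + 2)) (.op .sub (w + 1) (w + 1) (w + 2)))))
      σ ((List.range j).flatMap fun i => l.map (eval (Function.update ρ w (σ w + i)))) σ' ∧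
      ∀ i < w, σ' i = ρ i := by
  induction j generalizing σ with
  | zero => exact ⟨σ, .whileDone h1, hσ⟩
  | succ j ih =>
    have hle : ∀ i < w + 1, σ i ≤ M := by
      intro i hi
      rcases Nat.lt_succ_iff_lt_or_eq.1 hi with h | rfl
      · rw [hσ i h]; exact hρ i h
      · omega
    obtain ⟨σ₁, r₁, k₁⟩ := runs_print hM l hN (w + 3) (by omega) σ hle
    have e0 := k₁ w (by omega)
    have e1 := k₁ (w + 1) (by omega)
    have e2 := k₁ (w + 2) (by omega)
    rw [h1] at e1
    rw [h2] at e2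
    have r₂ := Prog.Runs.op (M := N) σ₁ .add w w (w + 2) (by
      show σ₁ w + σ₁ (w + 2) ≤ N
      omega)
    set σ₂ := Function.update σ₁ w (Op.add.eval (σ₁ w) (σ₁ (w + 2))) with hσ₂
    have f0 : σ₂ w = σ w + 1 := by rw [hσ₂, Function.update_self, e0, e2]; rfl
    have f1 : σ₂ (w + 1) = j + 1 := by rw [hσ₂, Function.update_of_ne (by omega), e1]
    have f2 : σ₂ (w + 2) = 1 := by rw [hσ₂, Function.update_of_ne (by omega), e2]
    have r₃ := Prog.Runs.op (M := N) σ₂ .sub (w + 1) (w + 1) (w + 2) (by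
      show σ₂ (w + 1) - σ₂ (w + 2) ≤ N
      omega)
    set σ₃ := Function.update σ₂ (w + 1) (Op.sub.eval (σ₂ (w + 1)) (σ₂ (w + 2))) with hσ₃
    have g0 : σ₃ w = σ w + 1 := by rw [hσ₃, Function.update_of_ne (by omega), f0]
    have g1 : σ₃ (w + 1) = j := by rw [hσ₃, Function.update_self, f1, f2]; rfl
    have g2 : σ₃ (w + 2) = 1 := by rw [hσ₃, Function.update_of_ne (by omega), f2]
    obtain ⟨σ₄, r₄, k₄⟩ := ih σ₃ (fun i hi => by
      rw [hσ₃, Function.update_of_ne (by omega), hσ₂, Function.update_of_ne (by omega),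
        k₁ i (by omega), hσ i hi]) g1 g2 (by omega)
    refine ⟨σ₄, ?_, k₄⟩
    have r := Prog.Runs.whileStep (s := w + 1) (by omega) (.seq r₁ (.seq r₂ r₃)) r₄
    convert r using 1
    rw [List.range_succ_eq_map, List.flatMap_cons, List.flatMap_map]
    simp only [List.append_nil]
    congr 1
    · refine List.map_congr_left fun e _ => eval_congr (fun i hi => ?_) e
      rcases Nat.lt_succ_iff_lt_or_eq.1 hi with h | rfl
      · rw [Function.update_of_ne h.ne, hσ i h]
      · simp
    · rw [g0]
      simp only [Nat.succ_eq_add_one, Nat.add_right_comm, Nat.add_assoc]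

theorem runs_loop {w M N : ℕ} (hM : 2 ≤ M) (hMN : M ≤ N) (e : NExp w) (l : List (NExp (w + 1)))
    (he : M ^ e.weight ≤ N) (hN : ∀ e ∈ l, M ^ e.weight ≤ N) (ρ : ℕ → ℕ) (hρ : ∀ i < w, ρ i ≤ M)
    (heM : e.eval ρ ≤ M) (σ : ℕ → ℕ) (hσ : ∀ i < w, σ i = ρ i) :
    ∃ σ', Prog.Runs N (loop e l) σ
      ((List.range (e.eval ρ)).flatMap fun o => l.map (eval (Function.update ρ w o))) σ' ∧
      ∀ i < w, σ' i = ρ i := by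
  have h0 : ∀ i < w, Function.update σ w 0 i = ρ i := fun i hi => by
    rw [Function.update_of_ne hi.ne, hσ i hi]
  obtain ⟨σ₁, r₁, h₁, k₁⟩ := runs_code hM e he (w + 1) (by omega) (Function.update σ w 0)
    fun i hi => by rw [h0 i hi]; exact hρ i hi
  rw [eval_congr h0] at h₁
  have e0 : Function.update σ₁ (w + 2) 1 w = 0 := by
    rw [Function.update_of_ne (by omega), k₁ w (by omega), Function.update_self]
  obtain ⟨σ₂, r₂, k₂⟩ := runs_while hM hMN l hN ρ hρ (e.eval ρ) (Function.update σ₁ (w + 2) 1)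
    (fun i hi => by rw [Function.update_of_ne (by omega), k₁ i (by omega), h0 i hi])
    (by rw [Function.update_of_ne (by omega), h₁]) (Function.update_self _ _ _)
    (by rw [e0]; omega)
  refine ⟨σ₂, ?_, k₂⟩
  simp only [e0, Nat.zero_add] at r₂
  exact .seq (.set σ w 0 (Nat.zero_le N)) (.seq r₁ (.seq (.set σ₁ (w + 2) 1 (by omega)) r₂))

end NExp

/-! ### Uniform families of Boolean formulas and their circuits -/

/-- Boolean formulas whose leaves read the input bit with a computed number, or test whether a
computed number is nonzero. -/
inductive BExp (v : ℕ) : Type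
  | input (e : NExp v) : BExp v
  | test (e : NExp v) : BExp v
  | not (b : BExp v) : BExp v
  | and (b₁ b₂ : BExp v) : BExp v

namespace BExp

variable {v : ℕ}

/-- The value of a formula on the input `x` when the registers have the contents `ρ`. -/
def eval (ρ : ℕ → ℕ) (x : List Bool) : BExp v → Bool
  | .input e => x.getD (e.eval ρ) false
  | .test e => decide (e.eval ρ ≠ 0)
  | .not b => !b.eval ρ x
  | .and b₁ b₂ => b₁.eval ρ x && b₂.eval ρ x

variable (ρ : ℕ → ℕ) (x : List Bool) (b b₁ b₂ : BExp v)

theorem eval_input (e : NExp v) : (input e).eval ρ x = x.getD (e.eval ρ) false := rfl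
theorem eval_not : b.not.eval ρ x = !b.eval ρ x := rfl
theorem eval_and : (b₁.and b₂).eval ρ x = (b₁.eval ρ x && b₂.eval ρ x) := rfl

/-- Disjunction, by De Morgan's law. -/
def or (b₁ b₂ : BExp v) : BExp v := .not (.and (.not b₁) (.not b₂))

@[simp] theorem eval_or : (or b₁ b₂).eval ρ x = (b₁.eval ρ x || b₂.eval ρ x) := by
  simp [or, eval]

/-- The formula with the given truth table in some formulas, by Shannon expansion. -/
def ofFun : List (BExp v) → (List Bool → Bool) → BExp v
  | [], f => .test (.const (if f [] then 1 else 0))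
  | b :: bs, f => or (.and b (ofFun bs fun l => f (true :: l)))
      (.and (.not b) (ofFun bs fun l => f (false :: l)))

theorem eval_ofFun (ρ : ℕ → ℕ) (x : List Bool) (bs : List (BExp v)) (f : List Bool → Bool) :
    (ofFun bs f).eval ρ x = f (bs.map (eval ρ x)) := by
  induction bs generalizing f with
  | nil => cases h : f [] <;> simp [ofFun, eval, h]
  | cons b bs ih => cases h : b.eval ρ x <;> simp [ofFun, eval, ih, h]

/-- The number of gates of a formula. -/
def size : BExp v → ℕ
  | .input _ => 1
  | .test _ => 1
  | .not b => b.size + 1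
  | .and b₁ b₂ => b₁.size + b₂.size + 1

theorem size_pos (b : BExp v) : 1 ≤ b.size := by cases b <;> simp [size]

/-- The gates of a formula, the first of them having the number `s`. -/
def gates (ρ : ℕ → ℕ) : ℕ → BExp v → List Gate
  | _, .input e => [.input (e.eval ρ)]
  | _, .test e => [.const (decide (e.eval ρ ≠ 0))]
  | s, .not b => b.gates ρ s ++ [.not (s + (b.size - 1))]
  | s, .and b₁ b₂ => b₁.gates ρ s ++ (b₂.gates ρ (s + b₁.size) ++
      [.and (s + (b₁.size - 1)) (s + b₁.size + (b₂.size - 1))])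

/-- Expressions for the encoding of `gates`. -/
def code : NExp v → BExp v → List (NExp v)
  | _, .input e => [.const 0, e, .const 0]
  | _, .test e => [.const 1, e / e, .const 0]
  | s, .not b => b.code s ++ [.const 2, s + .const (b.size - 1), .const 0]
  | s, .and b₁ b₂ => b₁.code s ++ (b₂.code (s + .const b₁.size) ++
      [.const 3, s + .const (b₁.size - 1), s + .const b₁.size + .const (b₂.size - 1)])

theorem map_eval_code (ρ : ℕ → ℕ) (b : BExp v) (s : NExp v) :
    (b.code s).map (NExp.eval ρ) = (b.gates ρ (s.eval ρ)).flatMap Gate.encode := by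
  induction b generalizing s with
  | input e => simp [code, gates, Gate.encode]
  | test e =>
    by_cases h : e.eval ρ = 0
    · simp [code, gates, Gate.encode, h]
    · simp [code, gates, Gate.encode, h, Nat.div_self (Nat.pos_of_ne_zero h)]
  | not b ih => simp [code, gates, Gate.encode, ih]
  | and b₁ b₂ ih₁ ih₂ => simp [code, gates, Gate.encode, ih₁, ih₂]

theorem length_gates (ρ : ℕ → ℕ) (b : BExp v) (s : ℕ) : (b.gates ρ s).length = b.size := by
  induction b generalizing s with
  | input e => rfl
  | test e => rfl
  | not b ih => simp [gates, size, ih]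
  | and b₁ b₂ ih₁ ih₂ => simp [gates, size, ih₁, ih₂]; omega

/-- The last gate of a formula computes its value. -/
theorem eval_gates (ρ : ℕ → ℕ) (x : List Bool) (b : BExp v) (vals : List Bool) :
    ∃ l, (b.gates ρ vals.length).foldl (fun vals g => vals ++ [g.eval x vals]) vals = vals ++ l ∧
      l.length = b.size ∧ l.getD (b.size - 1) false = b.eval ρ x := by
  have key : ∀ (vals l : List Bool) (s i : ℕ), vals.length = s → i < l.length → ∀ l' : List Bool,
      (vals ++ (l ++ l')).getD (s + i) false = l.getD i false := by
    intro vals l s i hs hi l'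
    rw [List.getD_append_right _ _ _ _ (by omega), hs, Nat.add_sub_cancel_left,
      List.getD_append _ _ _ _ hi]
  induction b generalizing vals with
  | input e => exact ⟨_, rfl, rfl, rfl⟩
  | test e => exact ⟨_, rfl, rfl, rfl⟩
  | not b ih =>
    have hb := b.size_pos
    obtain ⟨l, h, hl, hv⟩ := ih vals
    have k := key vals l _ (b.size - 1) rfl (by omega) []
    rw [List.append_nil, hv] at k
    refine ⟨l ++ [!b.eval ρ x], ?_, by simp [hl, size], ?_⟩
    · rw [gates, List.foldl_append, h, List.foldl_cons, List.foldl_nil, Gate.eval, k,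
        List.append_assoc]
    · rw [size, Nat.add_sub_cancel, List.getD_append_right _ _ _ _ hl.le, hl]; simp [eval]
  | and b₁ b₂ ih₁ ih₂ =>
    have hb₁ := b₁.size_pos
    have hb₂ := b₂.size_pos
    obtain ⟨l₁, h₁, hl₁, hv₁⟩ := ih₁ vals
    obtain ⟨l₂, h₂, hl₂, hv₂⟩ := ih₂ (vals ++ l₁)
    rw [List.length_append, hl₁] at h₂
    have k₁ := key vals l₁ _ (b₁.size - 1) rfl (by omega) l₂
    have k₂ := key (vals ++ l₁) l₂ _ (b₂.size - 1) rfl (by omega) []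
    rw [List.length_append, hl₁, List.append_nil, hv₂, List.append_assoc] at k₂
    rw [hv₁] at k₁
    refine ⟨l₁ ++ (l₂ ++ [b₁.eval ρ x && b₂.eval ρ x]), ?_,
      by simp [hl₁, hl₂, size, Nat.add_assoc], ?_⟩
    · rw [gates, List.foldl_append, h₁, List.foldl_append, h₂, List.foldl_cons, List.foldl_nil,
        Gate.eval]
      simp only [List.append_assoc]
      rw [k₁, k₂]
    · rw [size, Nat.add_sub_cancel, ← List.append_assoc,
        List.getD_append_right _ _ _ _ (by simp [hl₁, hl₂])]; simp [eval, hl₁, hl₂]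

theorem depth_gates (ρ : ℕ → ℕ) (b : BExp v) (ds : List ℕ) :
    ∃ l, (b.gates ρ ds.length).foldl (fun ds g => ds ++ [g.depth ds]) ds = ds ++ l ∧
      l.length = b.size ∧ ∀ d ∈ l, d ≤ b.size := by
  have key : ∀ (ds l : List ℕ) (s i M : ℕ), ds.length = s → i < l.length → (∀ d ∈ l, d ≤ M) →
      ∀ l' : List ℕ, (ds ++ (l ++ l')).getD (s + i) 0 ≤ M := by
    intro ds l s i M hs hi hM l'
    rw [List.getD_append_right _ _ _ _ (by omega), hs, Nat.add_sub_cancel_left,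
      List.getD_append _ _ _ _ hi, List.getD_eq_getElem _ _ hi]
    exact hM _ (List.getElem_mem hi)
  induction b generalizing ds with
  | input e => exact ⟨_, rfl, rfl, by simp [Gate.depth]⟩
  | test e => exact ⟨_, rfl, rfl, by simp [Gate.depth]⟩
  | not b ih =>
    have hb := b.size_pos
    obtain ⟨l, h, hl, hv⟩ := ih ds
    have k := key ds l _ (b.size - 1) _ rfl (by omega) hv []
    rw [List.append_nil] at k
    refine ⟨_, by rw [gates, List.foldl_append, h, List.foldl_cons, List.foldl_nil,
      List.append_assoc], by simp [hl, size], fun d hd => ?_⟩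
    rw [size]
    rcases List.mem_append.1 hd with hd | hd
    · have := hv d hd; omega
    · rw [List.mem_singleton.1 hd, Gate.depth]; omega
  | and b₁ b₂ ih₁ ih₂ =>
    have hb₁ := b₁.size_pos
    have hb₂ := b₂.size_pos
    obtain ⟨l₁, h₁, hl₁, hv₁⟩ := ih₁ ds
    obtain ⟨l₂, h₂, hl₂, hv₂⟩ := ih₂ (ds ++ l₁)
    rw [List.length_append, hl₁] at h₂
    have k₁ := key ds l₁ _ (b₁.size - 1) _ rfl (by omega) hv₁ l₂
    have k₂ := key (ds ++ l₁) l₂ _ (b₂.size - 1) _ rfl (by omega) hv₂ []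
    rw [List.length_append, hl₁, List.append_nil, List.append_assoc] at k₂
    refine ⟨_, by rw [gates, List.foldl_append, h₁, List.foldl_append, h₂, List.foldl_cons,
      List.foldl_nil, List.append_assoc, List.append_assoc],
      by simp [hl₁, hl₂, size, Nat.add_assoc], fun d hd => ?_⟩
    rw [size]
    rcases List.mem_append.1 hd with hd | hd
    · have := hv₁ d hd; omega
    rcases List.mem_append.1 hd with hd | hd
    · have := hv₂ d hd; omega
    · rw [List.mem_singleton.1 hd, Gate.depth, List.append_assoc]; omega

end BExp

section Family

variable {w : ℕ}

/-- The circuit with `inE` inputs whose outputs are the values of the formula `b` for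
`o = 0, 1, …`, below `outE`, where `o` is variable `w`. -/
def familyCircuit (inE outE : NExp w) (b : BExp (w + 1)) (ρ : ℕ → ℕ) : Circuit where
  inputs := inE.eval ρ
  gates := (List.range (outE.eval ρ)).flatMap fun o =>
    b.gates (Function.update ρ w o) (o * b.size)
  outputs := (List.range (outE.eval ρ)).map fun o => o * b.size + (b.size - 1)

theorem eval_familyCircuit (inE outE : NExp w) (b : BExp (w + 1)) (ρ : ℕ → ℕ) (x : List Bool) :
    (familyCircuit inE outE b ρ).eval x =
      (List.range (outE.eval ρ)).map fun o => b.eval (Function.update ρ w o) x := by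
  have h : ∀ n, ∃ l, ((List.range n).flatMap fun o =>
      b.gates (Function.update ρ w o) (o * b.size)).foldl (fun vals g => vals ++ [g.eval x vals]) []
        = l ∧ l.length = n * b.size ∧ ∀ o < n, l.getD (o * b.size + (b.size - 1)) false =
          b.eval (Function.update ρ w o) x := by
    have hb := b.size_pos
    intro n
    induction n with
    | zero => exact ⟨[], rfl, by simp, fun o ho => absurd ho (Nat.not_lt_zero o)⟩
    | succ n ih =>
      obtain ⟨l, h, hl, hv⟩ := ih
      obtain ⟨l', h', hl', hv'⟩ := BExp.eval_gates (Function.update ρ w n) x b l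
      rw [hl] at h'
      refine ⟨l ++ l', ?_, by rw [List.length_append, hl, hl', add_mul, one_mul], fun o ho => ?_⟩
      · rw [List.range_succ, List.flatMap_append, List.foldl_append, h]
        simpa using h'
      · rcases Nat.lt_succ_iff_lt_or_eq.1 ho with h | rfl
        · rw [List.getD_append _ _ _ _ ?_, hv o h]
          calc o * b.size + (b.size - 1) < (o + 1) * b.size := by rw [add_mul, one_mul]; omega
            _ ≤ l.length := by rw [hl]; exact Nat.mul_le_mul_right _ h
        · rw [List.getD_append_right _ _ _ _ (by omega), hl, Nat.add_sub_cancel_left, hv']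
  obtain ⟨l, h, _, hv⟩ := h (outE.eval ρ)
  simp only [Circuit.eval, familyCircuit, h, List.map_map]
  exact List.map_congr_left fun o ho => hv o (List.mem_range.1 ho)

theorem depth_familyCircuit (inE outE : NExp w) (b : BExp (w + 1)) (ρ : ℕ → ℕ) :
    (familyCircuit inE outE b ρ).depth ≤ b.size := by
  have h : ∀ n, ∃ l, ((List.range n).flatMap fun o =>
      b.gates (Function.update ρ w o) (o * b.size)).foldl (fun ds g => ds ++ [g.depth ds]) []
        = l ∧ l.length = n * b.size ∧ ∀ d ∈ l, d ≤ b.size := by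
    intro n
    induction n with
    | zero => exact ⟨[], rfl, by simp, by simp⟩
    | succ n ih =>
      obtain ⟨l, h, hl, hv⟩ := ih
      obtain ⟨l', h', hl', hv'⟩ := BExp.depth_gates (Function.update ρ w n) b l
      rw [hl] at h'
      refine ⟨l ++ l', ?_, by rw [List.length_append, hl, hl', add_mul, one_mul], fun d hd => ?_⟩
      · rw [List.range_succ, List.flatMap_append, List.foldl_append, h]
        simpa using h'
      · rcases List.mem_append.1 hd with h | h
        · exact hv d h
        · exact hv' d h
  obtain ⟨l, h, hl, hv⟩ := h (outE.eval ρ)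
  rw [Circuit.depth]
  simp only [familyCircuit, h]
  clear h hl
  induction l with
  | nil => simp
  | cons d l ih =>
    exact max_le (hv d (by simp)) (ih fun d hd => hv d (by simp [hd]))

theorem size_familyCircuit (inE outE : NExp w) (b : BExp (w + 1)) (ρ : ℕ → ℕ) :
    (familyCircuit inE outE b ρ).size = outE.eval ρ * b.size := by
  rw [Circuit.size, familyCircuit, length_flatMap_of_length _ _ b.size
    (fun o _ => b.length_gates _ _), List.length_range]

/-- Expressions for the encoding of the gates of `familyCircuit` that belong to one output. -/
def familyGates (b : BExp (w + 1)) : List (NExp (w + 1)) :=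
  b.code (.var (Fin.last w) * .const b.size)

/-- Expressions for the encoding of one output of `familyCircuit`. -/
def familyOutput (b : BExp (w + 1)) : List (NExp (w + 1)) :=
  [.const 5, .var (Fin.last w) * .const b.size + .const (b.size - 1), .const 0]

/-- Such a family of circuits is printed in logarithmic space: each number printed is the value of
one of finitely many arithmetic expressions, which is polynomially bounded. -/
theorem exists_prints_familyCircuit (inE outE : NExp w) (b : BExp (w + 1)) (K : ℕ) :
    ∃ (e₀ : ℕ) (P : Prog), ∀ e, e₀ ≤ e → ∀ (N : ℕ) (args : List ℕ), 2 ≤ N → args.length = w →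
      (∀ x ∈ args, x ≤ N ^ K) →
      P.Prints (N ^ e) args (familyCircuit inE outE b fun i => args.getD i 0).encode := by
  set W := inE.weight + outE.weight + ((familyGates b).map NExp.weight).sum +
    ((familyOutput b).map NExp.weight).sum with hW
  refine ⟨(K + 1) * (outE.weight + 1) * W, .seq (NExp.print [inE] w)
    (.seq (NExp.loop outE (familyGates b)) (NExp.loop outE (familyOutput b))),
    fun e he N args hN hargs hK => ?_⟩
  set ρ : ℕ → ℕ := fun i => args.getD i 0 with hρ
  have hNpos : 0 < N := by omega
  have h1 : 2 ≤ N ^ (K + 1) := hN.trans (Nat.le_self_pow (by omega) N)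
  have hρ1 : ∀ i < w, ρ i ≤ N ^ (K + 1) := by
    intro i hi
    have hi' : i < args.length := by omega
    rw [hρ]
    dsimp only
    rw [List.getD_eq_getElem _ _ hi']
    exact (hK _ (List.getElem_mem hi')).trans (Nat.pow_le_pow_right hNpos (Nat.le_succ K))
  set M := N ^ ((K + 1) * (outE.weight + 1)) with hM
  have hM1 : N ^ (K + 1) ≤ M := Nat.pow_le_pow_right hNpos (Nat.le_mul_of_pos_right _ (by omega))
  have hM2 : 2 ≤ M := h1.trans hM1
  have hout : outE.eval ρ ≤ M := by
    refine (NExp.eval_le h1 hρ1 outE).trans ?_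
    rw [← pow_mul]
    exact Nat.pow_le_pow_right hNpos (Nat.mul_le_mul_left _ (Nat.le_succ _))
  have hρM : ∀ i < w, ρ i ≤ M := fun i hi => (hρ1 i hi).trans hM1
  have hMW : ∀ j ≤ W, M ^ j ≤ N ^ e := by
    intro j hj
    rw [hM, ← pow_mul]
    exact Nat.pow_le_pow_right hNpos ((Nat.mul_le_mul_left _ hj).trans he)
  have hw := inE.weight_pos
  have hMe : M ≤ N ^ e := by simpa using hMW 1 (by omega)
  have hg : ∀ e' ∈ familyGates b, M ^ e'.weight ≤ N ^ e := fun e' he' => hMW _ (by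
    have := List.single_le_sum (fun _ _ => Nat.zero_le _) _
      (List.mem_map_of_mem (f := NExp.weight) he')
    omega)
  have ho : ∀ e' ∈ familyOutput b, M ^ e'.weight ≤ N ^ e := fun e' he' => hMW _ (by
    have := List.single_le_sum (fun _ _ => Nat.zero_le _) _
      (List.mem_map_of_mem (f := NExp.weight) he')
    omega)
  refine ⟨fun x hx => (hK x hx).trans ((Nat.pow_le_pow_right hNpos (Nat.le_succ K)).trans
    (hM1.trans hMe)), ?_⟩
  obtain ⟨σ₁, r₁, k₁⟩ := NExp.runs_print (N := N ^ e) hM2 [inE]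
    (fun e' he' => hMW _ (by rw [List.mem_singleton.1 he']; omega)) w le_rfl ρ hρM
  obtain ⟨σ₂, r₂, k₂⟩ := NExp.runs_loop hM2 hMe outE (familyGates b) (hMW _ (by omega)) hg ρ hρM
    hout σ₁ k₁
  obtain ⟨σ₃, r₃, k₃⟩ := NExp.runs_loop hM2 hMe outE (familyOutput b) (hMW _ (by omega)) ho ρ hρM
    hout σ₂ k₂
  refine ⟨σ₃, ?_⟩
  have r := Prog.Runs.seq r₁ (.seq r₂ r₃)
  convert r using 1
  rw [Circuit.encode, familyCircuit, List.map_singleton, List.singleton_append,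
    List.flatMap_assoc, List.flatMap_map]
  congr 2
  · refine List.flatMap_congr fun o _ => ?_
    rw [familyGates, BExp.map_eval_code]
    simp
  · refine List.flatMap_congr fun o _ => ?_
    simp [familyOutput]

end Family

/-! ### Layout of the representation as arithmetic expressions -/

theorem sum_flatMap_eq {α M : Type} [AddMonoid M] (l : List α) (g : α → List M) :
    (l.flatMap g).sum = (l.map fun x => (g x).sum).sum := by
  induction l with
  | nil => rfl
  | cons x l ih => rw [List.flatMap_cons, List.sum_append, ih, List.map_cons, List.sum_cons]

section Layout

variable {v : ℕ} (ρ : ℕ → ℕ)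

/-- An expression for `Ty.numTuples`. -/
def Ty.numTuplesE (n m : NExp v) : Ty → NExp v
  | .unit => .const 1
  | .base => n
  | .prod A B => A.numTuplesE n m * B.numTuplesE n m
  | .bag _ => m

@[simp] theorem eval_numTuplesE (n m : NExp v) (A : Ty) :
    (A.numTuplesE n m).eval ρ = A.numTuples (n.eval ρ) (m.eval ρ) := by
  induction A with
  | prod A B ihA ihB => simp [Ty.numTuplesE, Ty.numTuples, ihA, ihB]
  | _ => rfl

/-- Expressions for `Ty.ctxRuns`. -/
def Ty.ctxRunsE (n m : NExp v) : Ty → List (Bool × NExp v)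
  | .unit => []
  | .base => []
  | .prod A B => A.ctxRunsE n m ++ B.ctxRunsE n m
  | .bag C => (true, m) :: (false, m * C.numTuplesE n m) :: C.ctxRunsE n m

/-- Expressions for `Ty.runs`. -/
def Ty.runsE (n m : NExp v) (A : Ty) : List (Bool × NExp v) :=
  (false, A.numTuplesE n m) :: A.ctxRunsE n m

/-- The runs described by a list of expressions. -/
def evalRuns (l : List (Bool × NExp v)) : List (Bool × ℕ) := l.map fun s => (s.1, s.2.eval ρ)

theorem evalRuns_runsE (n m : NExp v) (A : Ty) :
    evalRuns ρ (A.runsE n m) = A.runs (n.eval ρ) (m.eval ρ) := by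
  have h : evalRuns ρ (A.ctxRunsE n m) = A.ctxRuns (n.eval ρ) (m.eval ρ) := by
    induction A with
    | prod A B ihA ihB =>
      simpa [Ty.ctxRunsE, Ty.ctxRuns, evalRuns] using congrArg₂ (· ++ ·) ihA ihB
    | bag C ih => simpa [Ty.ctxRunsE, Ty.ctxRuns, evalRuns] using ih
    | _ => rfl
  simpa [Ty.runsE, Ty.runs, evalRuns] using h

/-- Expressions for the layout of the cells of a shredded database. -/
def dbRunsE {r : ℕ} (S : Fin r → Ty) (n m : NExp v) : List (Bool × NExp v) :=
  (List.finRange r).flatMap fun i => (S i).runsE n m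

theorem evalRuns_dbRunsE {r : ℕ} (S : Fin r → Ty) (n m : NExp v) :
    evalRuns ρ (dbRunsE S n m) =
      (List.finRange r).flatMap fun i => (S i).runs (n.eval ρ) (m.eval ρ) := by
  rw [evalRuns, dbRunsE, List.map_flatMap]
  exact List.flatMap_congr fun i _ => evalRuns_runsE ρ n m (S i)

/-- An expression for `numCells`. -/
def numCellsE {r : ℕ} (S : Fin r → Ty) (n m : NExp v) : NExp v :=
  .sum ((dbRunsE S n m).map Prod.snd)

@[simp] theorem eval_numCellsE {r : ℕ} (S : Fin r → Ty) (n m : NExp v) :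
    (numCellsE S n m).eval ρ = numCells S (n.eval ρ) (m.eval ρ) := by
  have h : ((dbRunsE S n m).map Prod.snd).map (NExp.eval ρ) =
      (evalRuns ρ (dbRunsE S n m)).map Prod.snd := by
    simp [evalRuns, Function.comp_def]
  rw [numCellsE, NExp.eval_sum, h, evalRuns_dbRunsE, List.map_flatMap, numCells,
    sum_flatMap_eq, ← List.ofFn_eq_map, List.sum_ofFn]
  refine Finset.sum_congr rfl fun i _ => ?_
  rw [Ty.runs, List.map_cons, List.sum_cons, sum_ctxRuns]

/-- The number of bits of a view of type `B` over `n` primitive values and `L` labels. -/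
def numBits (k : ℕ) (B : Ty) (n L : ℕ) : ℕ :=
  ((B.runs n L).map fun s => (if s.1 then 1 else k) * s.2).sum

/-- An expression for `numBits`. -/
def numBitsE (k : ℕ) (B : Ty) (n L : NExp v) : NExp v :=
  .sum ((B.runsE n L).map fun s => .const (if s.1 then 1 else k) * s.2)

@[simp] theorem eval_numBitsE (k : ℕ) (B : Ty) (n L : NExp v) :
    (numBitsE k B n L).eval ρ = numBits k B (n.eval ρ) (L.eval ρ) := by
  rw [numBitsE, NExp.eval_sum, numBits, ← evalRuns_runsE, evalRuns, List.map_map, List.map_map]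
  rfl

/-- An expression for `numAssigns`. -/
def numAssignsE (n L : NExp v) : List Ty → NExp v
  | [] => .const 1
  | A :: Θ => A.numTuplesE n L * numAssignsE n L Θ

@[simp] theorem eval_numAssignsE (n L : NExp v) (Θ : List Ty) :
    (numAssignsE n L Θ).eval ρ = numAssigns (n.eval ρ) (L.eval ρ) Θ := by
  induction Θ with
  | nil => rfl
  | cons A Θ ih => simp [numAssignsE, numAssigns, ih]

/-- An expression for `numLabels`. -/
def numLabelsE (n : NExp v) : NExp v → List (List Ty) → NExp v
  | L, [] => L
  | L, Θ :: rest => numLabelsE n (L + numAssignsE n L Θ) rest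

@[simp] theorem eval_numLabelsE (n L : NExp v) (l : List (List Ty)) :
    (numLabelsE n L l).eval ρ = numLabels (n.eval ρ) (L.eval ρ) l := by
  induction l generalizing L with
  | nil => rfl
  | cons Θ l ih => rw [numLabelsE, ih]; simp [numLabels]

/-- The number `1` if the cell with number `q` is a support, and `0` otherwise. -/
def suppE : List (Bool × NExp v) → NExp v → NExp v
  | [], _ => .const 0
  | s :: l, q => (if s.1 then .lt q s.2 else .const 0) + .lt s.2 (q + .const 1) * suppE l (q - s.2)

@[simp] theorem eval_suppE (l : List (Bool × NExp v)) (q : NExp v) :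
    (suppE l q).eval ρ = if (expandRuns (evalRuns ρ l)).getD (q.eval ρ) false then 1 else 0 := by
  induction l generalizing q with
  | nil => simp [suppE, evalRuns, expandRuns]
  | cons s l ih =>
    have h : expandRuns (evalRuns ρ (s :: l)) =
        List.replicate (s.2.eval ρ) s.1 ++ expandRuns (evalRuns ρ l) := rfl
    rw [h, suppE, NExp.eval_add, NExp.eval_mul, ih, NExp.eval_lt]
    rcases lt_or_ge (q.eval ρ) (s.2.eval ρ) with hq | hq
    · rw [List.getD_append _ _ _ _ (by simpa using hq), List.getD_replicate _ hq]
      cases hs : s.1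
      · simp [hq]
      · simp [hq]
    · rw [List.getD_append_right _ _ _ _ (by simpa using hq), List.length_replicate]
      have h1 : (if s.1 = true then NExp.lt q s.2 else NExp.const 0).eval ρ = 0 := by
        cases hs : s.1
        · simp
        · simp [hq]
      simp [h1, Nat.lt_succ_of_le hq]

/-- The number of bits of the cell with number `q`. -/
def cellLenE {r : ℕ} (k : ℕ) (S : Fin r → Ty) (n m q : NExp v) : NExp v :=
  .cond (suppE (dbRunsE S n m) q) (.const 1) (.const k)

theorem eval_suppE_dbRunsE {r : ℕ} (S : Fin r → Ty) (n m q : NExp v) :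
    (suppE (dbRunsE S n m) q).eval ρ =
      if isSupp S (n.eval ρ) (m.eval ρ) (q.eval ρ) then 1 else 0 := by
  rw [eval_suppE, evalRuns_dbRunsE, isSupp]

@[simp] theorem eval_cellLenE {r : ℕ} (k : ℕ) (S : Fin r → Ty) (n m q : NExp v) :
    (cellLenE k S n m q).eval ρ =
      if isSupp S (n.eval ρ) (m.eval ρ) (q.eval ρ) then 1 else k :=
  NExp.eval_cond ρ _ _ (eval_suppE_dbRunsE ρ S n m q)

end Layout

/-! ### The formula of a maintained bit -/

section Formula

variable {v : ℕ}

/-- Formulas for the bits of `x + b * y` from the bits of `x` and `y`. -/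
def addIf (k : ℕ) (b : BExp v) (xs ys : List (BExp v)) : List (BExp v) :=
  (List.range k).map fun j => BExp.ofFun (b :: (xs ++ ys)) fun l =>
    (ofBits k (l.tail.take k) + if l.headD false then ofBits k (l.tail.drop k)
      else 0).val.testBit j

theorem eval_addIf {k : ℕ} {ρ : ℕ → ℕ} {s : List Bool} (b : BExp v) {xs ys : List (BExp v)}
    {x y : ZMod (2 ^ k)} (hx : xs.map (BExp.eval ρ s) = bits x)
    (hy : ys.map (BExp.eval ρ s) = bits y) :
    (addIf k b xs ys).map (BExp.eval ρ s) = bits (x + if b.eval ρ s then y else 0) := by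
  rw [addIf, List.map_map]
  refine List.map_congr_left fun j _ => ?_
  rw [Function.comp_apply, BExp.eval_ofFun, List.map_cons, List.map_append, hx, hy,
    List.tail_cons, List.take_left' (length_bits x), List.drop_left' (length_bits x), ofBits_bits,
    ofBits_bits]
  rfl

/-- Formulas for the bits of the entry `(t, Q)` of the array of derivatives, which starts at input
`T` and has rows of length `Z ^ N`; entries beyond the row vanish. -/
def leafBits (k N : ℕ) (T Z t Q : NExp v) : List (BExp v) :=
  (List.range k).map fun j =>
    -- the factor `g` keeps the address inside the array where the entry is not read
    let g : NExp v := .lt Q (Z.pow N)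
    .and (.test g) (.input (T + (t * Z.pow N + Q * g) * .const k + .const j))

/-- Formulas for the bits of the entry `(t, Q)` of the array of derivatives after a sequence of
conditional unit steps. -/
def entryBits (k N : ℕ) (T Z : NExp v) : List (BExp v × NExp v) → NExp v → NExp v → List (BExp v)
  | [], t, Q => leafBits k N T Z t Q
  | u :: us, t, Q => addIf k u.1 (entryBits k N T Z us t Q)
      (entryBits k N T Z us t (Q * Z + (u.2 + .const 1)))

/-- The total increment of a sequence of conditional unit steps. -/
def increment {R : Type} [CommRing R] (ρ : ℕ → ℕ) (s : List Bool) (us : List (BExp v × NExp v)) :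
    ℕ → R :=
  (us.map fun u => if u.1.eval ρ s then Pi.single (u.2.eval ρ) 1 else 0).sum

theorem eval_entryBits {k N : ℕ} {T Z : NExp v} {ρ : ℕ → ℕ} {s : List Bool}
    {f : ℕ → (ℕ → ZMod (2 ^ k)) → ZMod (2 ^ k)} {x : ℕ → ZMod (2 ^ k)} {t : NExp v}
    (hleaf : ∀ Q : NExp v, (leafBits k N T Z t Q).map (BExp.eval ρ s) =
      bits (deriv (Z.eval ρ) (Q.eval ρ) (f (t.eval ρ)) x))
    (us : List (BExp v × NExp v)) (hus : ∀ u ∈ us, u.2.eval ρ + 1 < Z.eval ρ) (Q : NExp v) :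
    (entryBits k N T Z us t Q).map (BExp.eval ρ s) =
      bits (deriv (Z.eval ρ) (Q.eval ρ) (f (t.eval ρ)) (x + increment ρ s us)) := by
  induction us generalizing Q with
  | nil => simpa [increment, entryBits] using hleaf Q
  | cons u us ih =>
    have hx : x + increment ρ s (u :: us) = (x + increment ρ s us) +
        if u.1.eval ρ s then Pi.single (u.2.eval ρ) 1 else 0 := by
      rw [increment, increment, List.map_cons, List.sum_cons, add_assoc, add_comm (List.sum _)]
    have ih := ih fun u hu => hus u (by simp [hu])
    rw [entryBits, eval_addIf u.1 (ih _) (ih _), hx, deriv_step (hus u (by simp))]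
    rfl

/-- The formula that reads the bit with number `j` of a list of formulas. -/
def selectBit (k : ℕ) (xs : List (BExp v)) (j : NExp v) : BExp v :=
  .ofFun (xs ++ (List.range k).map fun i => .not (.test ((j - .const i) + (.const i - j))))
    fun l => (List.range k).any fun i => (l.take k).getD i false && (l.drop k).getD i false

theorem eval_selectBit {k : ℕ} {ρ : ℕ → ℕ} {s : List Bool} {xs : List (BExp v)} {x : ZMod (2 ^ k)}
    (hx : xs.map (BExp.eval ρ s) = bits x) (j : NExp v) (hj : j.eval ρ < k) :
    (selectBit k xs j).eval ρ s = x.val.testBit (j.eval ρ) := by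
  have h : ((List.range k).map fun i => BExp.not (.test ((j - .const i) + (.const i - j)))).map
      (BExp.eval ρ s) = (List.range k).map fun i => decide (j.eval ρ = i) := by
    rw [List.map_map]
    refine List.map_congr_left fun i _ => ?_
    rw [Function.comp_apply, BExp.eval, BExp.eval, ← decide_not, decide_eq_decide]
    simp only [NExp.eval_add, NExp.eval_sub, NExp.eval_const]
    omega
  rw [selectBit, BExp.eval_ofFun, List.map_append, hx, h, List.take_left' (length_bits x),
    List.drop_left' (length_bits x), Bool.eq_iff_iff, List.any_eq_true]
  constructor
  · rintro ⟨i, hi, hb⟩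
    have hi := List.mem_range.1 hi
    rw [getD_bits x hi, Bool.and_eq_true, List.getD_eq_getElem _ _ (by simpa using hi)] at hb
    have e : j.eval ρ = i := by simpa using hb.2
    rw [e]; exact hb.1
  · intro hb
    refine ⟨_, List.mem_range.2 hj, ?_⟩
    rw [getD_bits x hj, hb, List.getD_eq_getElem _ _ (by simpa using hj)]
    simp

/-- Reading an array entry out of the input of the maintenance circuit. -/
theorem getD_array {k W : ℕ} (V U : List Bool) (A : ℕ → ZMod (2 ^ k)) (i j : ℕ) (hi : i < W)
    (hj : j < k) :
    ((V ++ (List.range W).flatMap fun i => bits (A i)) ++ U).getD (V.length + (i * k + j)) false =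
      (A i).val.testBit j := by
  have hl : ((List.range W).flatMap fun i => bits (A i)).length = W * k := by
    rw [length_flatMap_of_length _ _ k (fun _ _ => length_bits _), List.length_range]
  have hlt : i * k + j < W * k :=
    calc i * k + j < (i + 1) * k := by rw [add_mul, one_mul]; omega
      _ ≤ W * k := Nat.mul_le_mul_right _ hi
  rw [List.getD_append _ _ _ _ (by rw [List.length_append, hl]; omega),
    List.getD_append_right _ _ _ _ (Nat.le_add_right _ _), Nat.add_sub_cancel_left,
    getD_flatMap_of_length _ _ k _ (fun _ _ => length_bits _) i j (by simpa using hi) hj,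
    getD_bits _ hj, List.getElem_range]

/-- A number `Q` outside the row reads no input: the derivative that it encodes is zero. -/
theorem eval_leafBits {k N : ℕ} {T Z t : NExp v} {ρ : ℕ → ℕ} {s V U : List Bool}
    {f : ℕ → (ℕ → ZMod (2 ^ k)) → ZMod (2 ^ k)} {x : ℕ → ZMod (2 ^ k)} (hZ : 1 < Z.eval ρ)
    (hT : T.eval ρ = V.length) (ht : t.eval ρ < Z.eval ρ) (hf : ∀ t, DegLE N (f t))
    (hs : s = (V ++ (List.range (Z.eval ρ ^ (N + 1))).flatMap fun i => bits (deriv (Z.eval ρ)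
      (i % Z.eval ρ ^ N) (f (i / Z.eval ρ ^ N)) x)) ++ U) (Q : NExp v) :
    (leafBits k N T Z t Q).map (BExp.eval ρ s) =
      bits (deriv (Z.eval ρ) (Q.eval ρ) (f (t.eval ρ)) x) := by
  rw [leafBits, List.map_map]
  refine List.map_congr_left fun j hj => ?_
  have hj := List.mem_range.1 hj
  simp only [Function.comp_apply, BExp.eval, NExp.eval_add, NExp.eval_mul, NExp.eval_const,
    NExp.eval_lt, NExp.eval_pow]
  rcases lt_or_ge (Q.eval ρ) (Z.eval ρ ^ N) with hQ | hQ
  · have hlt : t.eval ρ * Z.eval ρ ^ N + Q.eval ρ < Z.eval ρ ^ (N + 1) :=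
      calc _ < (t.eval ρ + 1) * Z.eval ρ ^ N := by rw [add_mul, one_mul]; omega
        _ ≤ Z.eval ρ * Z.eval ρ ^ N := Nat.mul_le_mul_right _ ht
        _ = _ := (pow_succ' _ _).symm
    have h1 : (t.eval ρ * Z.eval ρ ^ N + Q.eval ρ) / Z.eval ρ ^ N = t.eval ρ := by
      rw [mul_comm, Nat.mul_add_div (by omega), Nat.div_eq_of_lt hQ, add_zero]
    have h2 : (t.eval ρ * Z.eval ρ ^ N + Q.eval ρ) % Z.eval ρ ^ N = Q.eval ρ := by
      rw [mul_comm, Nat.mul_add_mod, Nat.mod_eq_of_lt hQ]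
    rw [if_pos hQ, hT, mul_one, add_assoc, hs, getD_array V U _ _ j hlt hj, h1, h2]
    simp
  · rw [deriv_eq_zero hZ (hf _) hQ, if_neg (by omega)]
    simp

end Formula

/-! ### The maintained state -/

section State

variable {k : ℕ}

/-- The functions of the cells of the database that are maintained together with their
derivatives: the `M` cells themselves, followed by the functions `gs`. -/
def track (M : ℕ) (gs : List ((ℕ → ZMod (2 ^ k)) → ZMod (2 ^ k))) (t : ℕ) :
    (ℕ → ZMod (2 ^ k)) → ZMod (2 ^ k) :=
  if t < M then fun x => x t else gs.getD (t - M) 0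

theorem degLE_track {N M : ℕ} {gs : List ((ℕ → ZMod (2 ^ k)) → ZMod (2 ^ k))}
    (hgs : ∀ g ∈ gs, DegLE N g) (hN : 1 ≤ N) (t : ℕ) : DegLE N (track M gs t) := by
  rw [track]
  split_ifs
  · exact (DegLE.coord 0 t).mono hN
  · rcases lt_or_ge (t - M) gs.length with h | h
    · rw [List.getD_eq_getElem _ _ h]
      exact hgs _ (List.getElem_mem h)
    · rw [List.getD_eq_default _ _ h]
      exact DegLE.zero N

/-- The array of the derivatives of `track M gs` at `x`, with rows of length `Z ^ N`. -/
def derivArray (M Z N : ℕ) (gs : List ((ℕ → ZMod (2 ^ k)) → ZMod (2 ^ k)))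
    (x : ℕ → ZMod (2 ^ k)) (i : ℕ) : ZMod (2 ^ k) :=
  deriv Z (i % Z ^ N) (track M gs (i / Z ^ N)) x

/-- The bits of the view followed by those of the array of derivatives. -/
def stateList (M Z N : ℕ) (gs : List ((ℕ → ZMod (2 ^ k)) → ZMod (2 ^ k)))
    (x : ℕ → ZMod (2 ^ k)) : List Bool :=
  (gs.map fun g => topBit (g x)) ++
    (List.range (Z ^ (N + 1))).flatMap fun i => bits (derivArray M Z N gs x i)

theorem length_stateList (M Z N : ℕ) (gs : List ((ℕ → ZMod (2 ^ k)) → ZMod (2 ^ k)))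
    (x : ℕ → ZMod (2 ^ k)) :
    (stateList M Z N gs x).length = gs.length + Z ^ (N + 1) * k := by
  rw [stateList, List.length_append, List.length_map,
    length_flatMap_of_length _ _ k (fun _ _ => length_bits _), List.length_range]

end State

section Maintenance

variable {Base : Type} {k r c v : ℕ} {S : Fin r → Ty} {B : Ty}

/-- The position of the `j`-th updated cell among the update bits. -/
def updateOffsetE (k : ℕ) (S : Fin r → Ty) (n m : NExp v) (p : Fin c → NExp v) (j : Fin c) :
    NExp v :=
  .sum (((List.finRange c).take j).map fun i => cellLenE k S n m (p i))

/-- The formula for `stepBit`: a support bit is incremented if the update sets it and it is not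
set yet, and its present value is the entry `(p j, 0)` of the array of derivatives. -/
def stepBitE (k N : ℕ) (S : Fin r → Ty) (T Z n m : NExp v) (p : Fin c → NExp v) (j : Fin c)
    (i : ℕ) : BExp v :=
  let s := suppE (dbRunsE S n m) (p j)
  let off := T + Z.pow (N + 1) * .const k + updateOffsetE k S n m p j
  .or
    (.and (.test s) (if i = 0 then
      .and (.input off) (.not (.input (T + p j * Z.pow N * .const k))) else .test (.const 0)))
    (.and (.not (.test s)) (.input (off + .const i * (.const 1 - s))))

/-- An update as a sequence of conditional unit steps: the `i`-th bit of the increment of a cell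
controls `2 ^ i` steps. -/
def stepsE (k N : ℕ) (S : Fin r → Ty) (T Z n m : NExp v) (p : Fin c → NExp v) :
    List (BExp v × NExp v) :=
  (List.finRange c).flatMap fun j => (List.range k).flatMap fun i =>
    List.replicate (2 ^ i) (stepBitE k N S T Z n m p j i, p j)

/-- The formula for bit `o` of the new state: an entry of the array of derivatives is selected, and
one of its bits. Bit `o` of the view is the highest bit of the entry
`(M + o, 0)` of the array of derivatives, `M` being the number of cells of the database. -/
def stateBitE (k N : ℕ) (S : Fin r → Ty) (T Z n m : NExp v) (p : Fin c → NExp v) (o : NExp v) :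
    BExp v :=
  let isView := NExp.lt o T
  let i := (o - T) / .const k
  selectBit k
    (entryBits k N T Z (stepsE k N S T Z n m p)
      (.cond isView (numCellsE S n m + o) (i / Z.pow N)) (.cond isView (.const 0) (i % Z.pow N)))
    (.cond isView (.const (k - 1)) ((o - T) % .const k))

theorem length_updateBits (hk : 1 ≤ k) {n m : ℕ} (a : Fin n ↪ Base) (Δ : DB Base k S)
    {p : Fin c → ℕ} (hp : ∀ j, p j < numCells S n m) : (updateBits a m Δ p).length =
      ((List.finRange c).map fun j => if isSupp S n m (p j) then 1 else k).sum := by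
  rw [updateBits, List.length_flatMap]
  congr 1
  exact List.map_congr_left fun j _ => length_getD_blocks hk a m Δ _ (hp j)

theorem getD_updateBits (hk : 1 ≤ k) {n m : ℕ} (a : Fin n ↪ Base) (Δ : DB Base k S)
    {p : Fin c → ℕ} (hp : ∀ j, p j < numCells S n m) (j : Fin c) (q : ℕ)
    (hq : q < if isSupp S n m (p j) then 1 else k) :
    (updateBits a m Δ p).getD ((((List.finRange c).take j).map fun i =>
      if isSupp S n m (p i) then 1 else k).sum + q) false =
      ((Δ.blocks a m).getD (p j) []).getD q false := by
  have h := getD_flatMap_finRange (fun j => (Δ.blocks a m).getD (p j) []) false j q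
    (by rw [length_getD_blocks hk a m Δ _ (hp j)]; exact hq)
  rw [← h, updateBits]
  congr 3
  exact List.map_congr_left fun j _ => (length_getD_blocks hk a m Δ _ (hp j)).symm

variable {ρ : ℕ → ℕ} {T Z n m : NExp v} {p : Fin c → NExp v}
  {gs : List ((ℕ → ZMod (2 ^ k)) → ZMod (2 ^ k))} {N : ℕ}

theorem eval_stepBitE (hk : 1 ≤ k) (a : Fin (n.eval ρ) ↪ Base) (D Δ : DB Base k S)
    (hT : T.eval ρ = gs.length) (hZ : numCells S (n.eval ρ) (m.eval ρ) < Z.eval ρ)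
    (hp : ∀ j, (p j).eval ρ < numCells S (n.eval ρ) (m.eval ρ)) (j : Fin c) (i : ℕ) (hi : i < k) :
    (stepBitE k N S T Z n m p j i).eval ρ
      (stateList (numCells S (n.eval ρ) (m.eval ρ)) (Z.eval ρ) N gs (D.enc a (m.eval ρ)) ++
        updateBits a (m.eval ρ) Δ fun j => (p j).eval ρ) =
      stepBit a (m.eval ρ) D Δ ((p j).eval ρ) i := by
  set x := D.enc a (m.eval ρ) with hx
  set M := numCells S (n.eval ρ) (m.eval ρ) with hM
  have hZN : 0 < Z.eval ρ ^ N := Nat.pow_pos (by omega)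
  have hupd : ∀ q, (q < if isSupp S (n.eval ρ) (m.eval ρ) ((p j).eval ρ) then 1 else k) →
      (stateList M (Z.eval ρ) N gs x ++ updateBits a (m.eval ρ) Δ fun j => (p j).eval ρ).getD
        ((T + Z.pow (N + 1) * .const k + updateOffsetE k S n m p j).eval ρ + q) false =
        ((Δ.blocks a (m.eval ρ)).getD ((p j).eval ρ) []).getD q false := by
    intro q hq
    rw [← getD_updateBits hk a Δ hp j q hq]
    simp only [NExp.eval_add, NExp.eval_mul, NExp.eval_pow, NExp.eval_const, hT, updateOffsetE,
      NExp.eval_sum, List.map_map, Function.comp_def, eval_cellLenE]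
    rw [List.getD_append_right _ _ _ _ (by rw [length_stateList]; omega), length_stateList]
    congr 1
    omega
  have hcur : (stateList M (Z.eval ρ) N gs x ++ updateBits a (m.eval ρ) Δ
      fun j => (p j).eval ρ).getD ((T + p j * Z.pow N * .const k).eval ρ) false =
        (x ((p j).eval ρ)).val.testBit 0 := by
    have hlt : (p j).eval ρ * Z.eval ρ ^ N < Z.eval ρ ^ (N + 1) := by
      rw [pow_succ']
      exact Nat.mul_lt_mul_of_pos_right ((hp j).trans hZ) hZN
    have h := getD_array (gs.map fun g => topBit (g x))
      (updateBits a (m.eval ρ) Δ fun j => (p j).eval ρ) (derivArray M (Z.eval ρ) N gs x)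
      _ 0 hlt hk
    simp only [derivArray, Nat.mul_mod_left, Nat.mul_div_cancel _ hZN, deriv_zero, track, hp j,
      if_true, List.length_map, Nat.add_zero] at h
    simp only [NExp.eval_add, NExp.eval_mul, NExp.eval_pow, NExp.eval_const, hT]
    exact h
  have htest : ∀ s, (BExp.test (suppE (dbRunsE S n m) (p j))).eval ρ s =
      isSupp S (n.eval ρ) (m.eval ρ) ((p j).eval ρ) := by
    intro s
    rw [BExp.eval, eval_suppE_dbRunsE]
    cases isSupp S (n.eval ρ) (m.eval ρ) ((p j).eval ρ) <;> rfl
  rw [stepBitE, BExp.eval_or, BExp.eval_and, BExp.eval_and, BExp.eval_not, htest, BExp.eval_input,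
    stepBit]
  cases hs : isSupp S (n.eval ρ) (m.eval ρ) ((p j).eval ρ)
  · have h := hupd i (by simpa [hs] using hi)
    have e : (T + Z.pow (N + 1) * .const k + updateOffsetE k S n m p j + .const i *
        (.const 1 - suppE (dbRunsE S n m) (p j))).eval ρ =
        (T + Z.pow (N + 1) * .const k + updateOffsetE k S n m p j).eval ρ + i := by
      rw [NExp.eval_add, NExp.eval_mul, NExp.eval_sub, eval_suppE_dbRunsE, hs]
      simp
    rw [e, h]
    simp
  · have h := hupd 0 (by simp [hs])
    rw [Nat.add_zero] at h
    by_cases h0 : i = 0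
    · rw [if_pos h0, BExp.eval_and, BExp.eval_not, BExp.eval_input, BExp.eval_input, h, hcur]
      simp [h0, hx]
    · rw [if_neg h0]
      simp [h0, BExp.eval]

/-- The cells `p` are distinct, so each is moved by its own steps only. -/
theorem increment_stepsE (hk : 1 ≤ k) (a : Fin (n.eval ρ) ↪ Base) (D Δ : DB Base k S)
    (hT : T.eval ρ = gs.length) (hZ : numCells S (n.eval ρ) (m.eval ρ) < Z.eval ρ)
    (hp : ∀ j, (p j).eval ρ < numCells S (n.eval ρ) (m.eval ρ))
    (hinj : Function.Injective fun j => (p j).eval ρ)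
    (hΔ : SupportedAt a (m.eval ρ) Δ fun j => (p j).eval ρ) :
    D.enc a (m.eval ρ) + increment ρ
      (stateList (numCells S (n.eval ρ) (m.eval ρ)) (Z.eval ρ) N gs (D.enc a (m.eval ρ)) ++
        updateBits a (m.eval ρ) Δ fun j => (p j).eval ρ) (stepsE k N S T Z n m p) =
      (D.add Δ).enc a (m.eval ρ) := by
  have h : increment (R := ZMod (2 ^ k)) ρ
      (stateList (numCells S (n.eval ρ) (m.eval ρ)) (Z.eval ρ) N gs (D.enc a (m.eval ρ)) ++
        updateBits a (m.eval ρ) Δ fun j => (p j).eval ρ) (stepsE k N S T Z n m p) =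
      ∑ j, ∑ i ∈ Finset.range k, 2 ^ i • if stepBit a (m.eval ρ) D Δ ((p j).eval ρ) i then
        Pi.single ((p j).eval ρ) 1 else 0 := by
    rw [increment, stepsE, List.map_flatMap, sum_flatMap_eq, ← List.ofFn_eq_map, List.sum_ofFn]
    refine Finset.sum_congr rfl fun j _ => ?_
    rw [List.map_flatMap, sum_flatMap_eq]
    show _ = ((List.range k).map _).sum
    congr 1
    refine List.map_congr_left fun i hi => ?_
    rw [List.map_replicate, List.sum_replicate,
      eval_stepBitE hk a D Δ hT hZ hp j i (List.mem_range.1 hi)]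
  rw [h]
  funext q
  rw [DB.enc_add hk, Pi.add_apply]
  congr 1
  rw [Finset.sum_apply]
  simp only [Finset.sum_apply]
  by_cases hq : ∃ j, (p j).eval ρ = q
  · obtain ⟨j, rfl⟩ := hq
    rw [Finset.sum_eq_single j]
    · refine Finset.sum_congr rfl fun i _ => ?_
      split_ifs <;> simp
    · intro j' _ hj'
      have hne : (p j).eval ρ ≠ (p j').eval ρ := fun e => hj' (hinj e.symm)
      refine Finset.sum_eq_zero fun i _ => ?_
      split_ifs <;> simp [Pi.single_eq_of_ne hne]
    · simp
  · have hq' : ∀ j, (p j).eval ρ ≠ q := fun j e => hq ⟨j, e⟩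
    rw [Finset.sum_eq_zero, Finset.sum_eq_zero]
    · intro i _
      rw [stepBit_eq_false hΔ hq' i]; rfl
    · intro j _
      refine Finset.sum_eq_zero fun i _ => ?_
      split_ifs <;> simp [Pi.single_eq_of_ne (hq' j).symm]

theorem eval_stateBitE (hk : 1 ≤ k) {n₀ m₀ : ℕ} {p₀ : Fin c → ℕ} (hn : n.eval ρ = n₀)
    (hm : m.eval ρ = m₀) (hp₀ : ∀ j, (p j).eval ρ = p₀ j) (a : Fin n₀ ↪ Base) (D Δ : DB Base k S)
    (hT : T.eval ρ = gs.length) (hZ : numCells S n₀ m₀ + gs.length + 1 < Z.eval ρ)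
    (hN : 1 ≤ N) (hgs : ∀ g ∈ gs, DegLE N g) (hp : ∀ j, p₀ j < numCells S n₀ m₀)
    (hinj : Function.Injective p₀) (hΔ : SupportedAt a m₀ Δ p₀) (o : NExp v)
    (ho : o.eval ρ < gs.length + Z.eval ρ ^ (N + 1) * k) :
    (stateBitE k N S T Z n m p o).eval ρ
      (stateList (numCells S n₀ m₀) (Z.eval ρ) N gs (D.enc a m₀) ++ updateBits a m₀ Δ p₀) =
      (stateList (numCells S n₀ m₀) (Z.eval ρ) N gs ((D.add Δ).enc a m₀)).getD
        (o.eval ρ) false := by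
  obtain rfl : (fun j => (p j).eval ρ) = p₀ := funext hp₀
  subst hn hm
  have hinc := increment_stepsE (N := N) hk a D Δ hT (by omega : _ < Z.eval ρ) hp hinj hΔ
  set M := numCells S (n.eval ρ) (m.eval ρ) with hM
  set s := stateList M (Z.eval ρ) N gs (D.enc a (m.eval ρ)) ++
    updateBits a (m.eval ρ) Δ fun j => (p j).eval ρ with hs
  set x' := (D.add Δ).enc a (m.eval ρ) with hx'
  have hZN : 0 < Z.eval ρ ^ N := Nat.pow_pos (by omega)
  have hentry : ∀ t Q : NExp v, t.eval ρ < Z.eval ρ →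
      (entryBits k N T Z (stepsE k N S T Z n m p) t Q).map (BExp.eval ρ s) =
        bits (deriv (Z.eval ρ) (Q.eval ρ) (track M gs (t.eval ρ)) x') := by
    intro t Q ht
    have hleaf : ∀ Q : NExp v, (leafBits k N T Z t Q).map (BExp.eval ρ s) =
        bits (deriv (Z.eval ρ) (Q.eval ρ) (track M gs (t.eval ρ)) (D.enc a (m.eval ρ))) :=
      eval_leafBits (V := gs.map fun g => topBit (g (D.enc a (m.eval ρ))))
        (U := updateBits a (m.eval ρ) Δ fun j => (p j).eval ρ) (by omega)
        (by rw [hT, List.length_map]) ht (degLE_track hgs hN) rfl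
    rw [eval_entryBits hleaf, hinc]
    intro u hu
    simp only [stepsE, List.mem_flatMap] at hu
    obtain ⟨j, _, i, _, hu⟩ := hu
    rw [List.eq_of_mem_replicate hu]
    have : (p j).eval ρ < M := hp j
    show (p j).eval ρ + 1 < _
    omega
  have hview : (NExp.lt o T).eval ρ = if o.eval ρ < gs.length then 1 else 0 := by
    rw [NExp.eval_lt, hT]
  have et := NExp.eval_cond ρ (numCellsE S n m + o) ((o - T) / .const k / Z.pow N) hview
  have eQ := NExp.eval_cond ρ (.const 0) ((o - T) / .const k % Z.pow N) hview
  have ej := NExp.eval_cond ρ (.const (k - 1)) ((o - T) % .const k) hview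
  simp only [NExp.eval_add, NExp.eval_sub, NExp.eval_div, NExp.eval_mod, NExp.eval_const,
    NExp.eval_pow, eval_numCellsE, hT] at et eQ ej
  rcases lt_or_ge (o.eval ρ) gs.length with hlt | hge
  · rw [if_pos hlt] at et eQ ej
    rw [stateBitE, eval_selectBit (hentry _ _ (by rw [et]; omega)) _ (by rw [ej]; omega), et, eQ,
      ej, deriv_zero, track, if_neg (by omega), Nat.add_sub_cancel_left,
      List.getD_eq_getElem _ _ hlt, stateList, List.getD_append _ _ _ _ (by simpa using hlt),
      List.getD_eq_getElem _ _ (by simpa using hlt), List.getElem_map]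
    rfl
  · rw [if_neg (by omega)] at et eQ ej
    have hi : (o.eval ρ - gs.length) / k < Z.eval ρ ^ (N + 1) :=
      Nat.div_lt_of_lt_mul (by rw [mul_comm]; omega)
    have ht : (o.eval ρ - gs.length) / k / Z.eval ρ ^ N < Z.eval ρ :=
      Nat.div_lt_of_lt_mul (by rw [← pow_succ]; exact hi)
    have hj : (o.eval ρ - gs.length) % k < k := Nat.mod_lt _ (by omega)
    rw [stateBitE, eval_selectBit (hentry _ _ (by rw [et]; exact ht)) _ (by rw [ej]; exact hj), et,
      eQ, ej]
    have h := getD_array (gs.map fun g => topBit (g x')) [] (derivArray M (Z.eval ρ) N gs x')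
      _ _ hi hj
    rw [List.append_nil, List.length_map, Nat.div_add_mod', Nat.add_sub_cancel' hge] at h
    exact h.symm

end Maintenance

/-! ### Incremental maintenance -/

/-- Views of queries, together with the derivatives of their entries as auxiliary views, are
maintained by uniform circuits of constant depth. -/
theorem exists_maintenance {Base : Type} {r : ℕ} {S : Fin r → Ty} {B : Ty} (h : Query Base S B)
    {k : ℕ} (hk : 1 ≤ k) :
    ∃ aux : List (AuxView Base k S), ∀ c : ℕ, ∃ (d e : ℕ) (P : Prog),
      ∀ (n m : ℕ) (p : Fin c → ℕ), Function.Injective p → (∀ j, p j < numCells S n m) →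
        ∃ C : Circuit,
          C.depth ≤ d ∧ C.size ≤ (C.inputs + 2) ^ e ∧
          P.Prints ((n + m + 2) ^ e) (n :: m :: List.ofFn p) C.encode ∧
          ∀ (a : Fin n ↪ Base) (D Δ : DB Base k S),
            D.Over a m → Δ.Over a m → SupportedAt a m Δ p →
            C.Maps (stateBits h aux m a D ++ updateBits a m Δ p)
              (stateBits h aux m a (D.add Δ)) := by
  obtain ⟨N₀, hN₀⟩ := exists_polyBits_view hk h
  choose gs hdeg hgs using hN₀
  set N := max N₀ 1 with hN
  -- the base `Z` exceeds the number of tracked functions and the number of cells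
  set L : ℕ → ℕ → ℕ := fun n m => numLabels n m h.sigs with hL
  set T : ℕ → ℕ → ℕ := fun n m => numBits k B n (L n m) with hT
  let TE : {v : ℕ} → NExp v → NExp v → NExp v := fun n m =>
    numBitsE k B n (numLabelsE n m h.sigs)
  set K := (numCellsE S (.var 0) (.var 1) + TE (.var 0) (.var 1) + .const 2 : NExp 2).weight
    with hK
  set Z : ℕ → ℕ → ℕ := fun n m => (n + L n m + 2) ^ K with hZ
  let ZE : {v : ℕ} → NExp v → NExp v → NExp v := fun n m =>
    (n + numLabelsE n m h.sigs + .const 2).pow K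
  have hTE : ∀ {v : ℕ} (ρ : ℕ → ℕ) (n m : NExp v),
      (TE n m).eval ρ = T (n.eval ρ) (m.eval ρ) := fun ρ n m => by simp [TE, hT, hL]
  have hZE : ∀ {v : ℕ} (ρ : ℕ → ℕ) (n m : NExp v),
      (ZE n m).eval ρ = Z (n.eval ρ) (m.eval ρ) := fun ρ n m => by simp [ZE, hZ, hL]
  have hZlt : ∀ n m, numCells S n m + T n m + 1 < Z n m := by
    intro n m
    have hle := NExp.eval_le (v := 2) (ρ := fun i => if i = 0 then n else m) (M := n + L n m + 2)
      (by omega) (fun i _ => by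
        have := le_numLabels n m h.sigs
        split_ifs
        · omega
        · simp only [hL]; omega)
      (numCellsE S (.var 0) (.var 1) + TE (.var 0) (.var 1) + .const 2)
    simp only [NExp.eval_add, eval_numCellsE, hTE, NExp.eval_const, NExp.eval_var] at hle
    exact hle
  obtain ⟨aux, haux⟩ := exists_auxViews (k := k) h (powSchemas (K * (N + 1)))
    fun {n} m a D i => derivArray (numCells S n m) (Z n m) N (gs n m a) (D.enc a m) i
  have hlabels : ∀ (n m : ℕ) (a : Fin n ↪ Base), (h.labels m a).length = L n m := fun n m a => by
    rw [Query.labels, length_labelsFrom, length_inpLabels]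
  have hlen : ∀ (n m : ℕ) (a : Fin n ↪ Base), (gs n m a).length = T n m := by
    intro n m a
    have e := congrArg List.length (hgs n m a 0)
    rw [length_viewBits hk, List.length_map, hlabels] at e
    exact e.symm
  have hstate : ∀ (n m : ℕ) (a : Fin n ↪ Base) (D : DB Base k S), D.Over a m →
      stateBits h aux m a D =
        stateList (numCells S n m) (Z n m) N (gs n m a) (D.enc a m) := by
    intro n m a D hD
    have e := hgs n m a (D.enc a m)
    simp only [DB.dec_enc hk a m D hD] at e
    rw [stateBits, haux, e, sum_numTuples_powSchemas, hlabels, pow_mul]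
    rfl
  refine ⟨aux, fun c => ?_⟩
  -- the registers `0`, `1`, `j + 2` hold `n`, `m`, `p j`
  let nE : {w : ℕ} → NExp (c + 2 + w) := .var ⟨0, by omega⟩
  let mE : {w : ℕ} → NExp (c + 2 + w) := .var ⟨1, by omega⟩
  let pE : {w : ℕ} → Fin c → NExp (c + 2 + w) := fun j => .var ⟨j + 2, by omega⟩
  set outE : NExp (c + 2) := TE (nE (w := 0)) mE + (ZE (nE (w := 0)) mE).pow (N + 1) * .const k
    with hout
  set inE : NExp (c + 2) := outE + .sum ((List.finRange c).map fun j =>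
    cellLenE k S (nE (w := 0)) (mE (w := 0)) (pE (w := 0) j)) with hin
  set b : BExp (c + 2 + 1) := stateBitE k N S (TE nE mE) (ZE nE mE) nE mE pE
    (.var (Fin.last (c + 2))) with hb
  set K' := (numCellsE S (.var 0) (.var 1) : NExp 2).weight with hK'
  obtain ⟨e₀, P, hP⟩ := exists_prints_familyCircuit inE outE b (K' + 1)
  refine ⟨b.size, max e₀ (b.size + 1), P, fun n m p hinj hp => ?_⟩
  set ρ : ℕ → ℕ := fun i => (n :: m :: List.ofFn p).getD i 0 with hρ
  have hρp : ∀ j : Fin c, ρ (j + 2) = p j := by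
    intro j
    simp [hρ]
  have hN2 : 2 ≤ n + m + 2 := by omega
  have houtv : outE.eval ρ = T n m + Z n m ^ (N + 1) * k := by
    rw [hout, NExp.eval_add, NExp.eval_mul, NExp.eval_pow, hTE, hZE]
    rfl
  have hinv : inE.eval ρ = T n m + Z n m ^ (N + 1) * k +
      ((List.finRange c).map fun j => if isSupp S n m (p j) then 1 else k).sum := by
    rw [hin, NExp.eval_add, houtv, NExp.eval_sum, List.map_map]
    congr 2
    refine List.map_congr_left fun j _ => ?_
    rw [Function.comp_apply, eval_cellLenE]
    have e : (pE (w := 0) j).eval ρ = p j := hρp j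
    rw [e]
    rfl
  refine ⟨familyCircuit inE outE b ρ, depth_familyCircuit inE outE b ρ, ?_, ?_, ?_⟩
  · rw [size_familyCircuit]
    have h1 : outE.eval ρ ≤ inE.eval ρ + 2 := by rw [houtv, hinv]; omega
    calc outE.eval ρ * b.size ≤ (inE.eval ρ + 2) * (inE.eval ρ + 2) ^ b.size :=
          Nat.mul_le_mul h1 (Nat.lt_two_pow_self.le.trans (Nat.pow_le_pow_left (by omega) _))
      _ = (inE.eval ρ + 2) ^ (b.size + 1) := (pow_succ' _ _).symm
      _ ≤ _ := Nat.pow_le_pow_right (by omega) (le_max_right _ _)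
  · refine hP _ (le_max_left _ _) (n + m + 2) _ hN2 (by simp) ?_
    have h1 : n + m + 2 ≤ (n + m + 2) ^ (K' + 1) := Nat.le_self_pow (by omega) _
    intro y hy
    simp only [List.mem_cons, List.mem_ofFn] at hy
    rcases hy with rfl | rfl | ⟨j, rfl⟩
    · omega
    · omega
    · have hle := NExp.eval_le (v := 2) (ρ := fun i => if i = 0 then n else m) hN2
        (fun i _ => by split_ifs <;> omega) (numCellsE S (.var 0) (.var 1))
      rw [eval_numCellsE] at hle
      exact (hp j).le.trans (hle.trans (Nat.pow_le_pow_right (by omega) (Nat.le_succ K')))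
  · intro a D Δ hD hΔ hsupp
    rw [hstate n m a D hD, hstate n m a _ (hD.add hΔ)]
    refine ⟨?_, ?_⟩
    · rw [List.length_append, length_stateList, hlen, length_updateBits hk a Δ hp]
      exact hinv.symm
    · rw [eval_familyCircuit]
      refine List.ext_getElem ?_ fun o h1 h2 => ?_
      · rw [List.length_map, List.length_range, length_stateList, houtv, hlen]
      · rw [List.getElem_map, List.getElem_range, ← List.getD_eq_getElem _ false h2]
        rw [length_stateList] at h2
        set ρ' := Function.update ρ (c + 2) o with hρ'
        have e0 : ρ' 0 = n := by rw [hρ', Function.update_of_ne (by omega)]; rfl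
        have e1 : ρ' 1 = m := by rw [hρ', Function.update_of_ne (by omega)]; rfl
        have ep : ∀ j, (pE (w := 1) j).eval ρ' = p j := by
          intro j
          show ρ' (j + 2) = p j
          rw [hρ', Function.update_of_ne (by have := j.2; omega), hρp]
        have eo : (NExp.var (Fin.last (c + 2)) : NExp (c + 2 + 1)).eval ρ' = o := by
          show Function.update ρ (c + 2) o (Fin.last (c + 2) : ℕ) = o
          rw [Fin.val_last, Function.update_self]
        have eT : (TE (nE (w := 1)) mE).eval ρ' = T n m := by rw [hTE]; exact congrArg₂ T e0 e1
        have eZ : (ZE (nE (w := 1)) mE).eval ρ' = Z n m := by rw [hZE]; exact congrArg₂ Z e0 e1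
        have key := eval_stateBitE (ρ := ρ') (T := TE (nE (w := 1)) mE) (Z := ZE (nE (w := 1)) mE)
          (n := nE (w := 1)) (m := mE) (p := pE) (gs := gs n m a) (N := N) hk e0 e1 ep a D Δ
          (by rw [eT, hlen]) (by rw [eZ, hlen]; exact hZlt n m) (le_max_right _ _)
          (fun g hg => (hdeg n m a g hg).mono (le_max_left _ _)) hp hinj hsupp
          (.var (Fin.last (c + 2))) (by rw [eo, eZ]; exact h2)
        rw [eo, eZ] at key
        exact key

/-! ### Re-evaluation needs unbounded depth -/

/-- A gate of depth `d` depends on at most `2 ^ d` input bits. -/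
theorem exists_support_gate (gs : List Gate) (i : ℕ) :
    ∃ s : Finset ℕ,
      s.card ≤ 2 ^ (gs.foldl (fun ds g => ds ++ [g.depth ds]) []).getD i 0 ∧
      ∀ x y : List Bool, (∀ j ∈ s, x.getD j false = y.getD j false) →
        (gs.foldl (fun vals g => vals ++ [g.eval x vals]) []).getD i false =
          (gs.foldl (fun vals g => vals ++ [g.eval y vals]) []).getD i false := by
  classical
  have hlen : ∀ (gs : List Gate) {α : Type} (f : List α → Gate → α),
      (gs.foldl (fun l g => l ++ [f l g]) []).length = gs.length := by
    intro gs α f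
    induction gs using List.reverseRecOn with
    | nil => rfl
    | append_singleton gs g ih => simp [List.foldl_append, ih]
  induction gs using List.reverseRecOn generalizing i with
  | nil => exact ⟨∅, by simp, fun _ _ _ => rfl⟩
  | append_singleton gs g ih =>
    simp only [List.foldl_append, List.foldl_cons, List.foldl_nil]
    set ds := gs.foldl (fun ds g => ds ++ [g.depth ds]) [] with hds
    set vals : List Bool → List Bool := fun x =>
      gs.foldl (fun vals g => vals ++ [g.eval x vals]) [] with hvals
    have hd : ds.length = gs.length := hlen gs fun ds g => g.depth ds
    have hv : ∀ x, (vals x).length = gs.length := fun x => hlen gs fun vals g => g.eval x vals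
    show ∃ s : Finset ℕ, s.card ≤ 2 ^ (ds ++ [g.depth ds]).getD i 0 ∧
      ∀ x y : List Bool, (∀ j ∈ s, x.getD j false = y.getD j false) →
        (vals x ++ [g.eval x (vals x)]).getD i false = (vals y ++ [g.eval y (vals y)]).getD i false
    rcases lt_trichotomy i gs.length with hi | rfl | hi
    · obtain ⟨s, hs, h⟩ := ih i
      refine ⟨s, ?_, fun x y hxy => ?_⟩
      · rw [List.getD_append _ _ _ _ (by omega)]; exact hs
      · rw [List.getD_append _ _ _ _ (by rw [hv]; exact hi),
          List.getD_append _ _ _ _ (by rw [hv]; exact hi)]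
        exact h x y hxy
    · have e1 : (ds ++ [g.depth ds]).getD gs.length 0 = g.depth ds := by
        rw [List.getD_append_right _ _ _ _ (by omega), hd, Nat.sub_self]; rfl
      have e2 : ∀ x, (vals x ++ [g.eval x (vals x)]).getD gs.length false =
          g.eval x (vals x) := fun x => by
        rw [List.getD_append_right _ _ _ _ (by rw [hv]), hv, Nat.sub_self]; rfl
      simp only [e1, e2]
      have hbin : ∀ i j : ℕ, ∃ s : Finset ℕ,
          s.card ≤ 2 ^ (max (ds.getD i 0) (ds.getD j 0) + 1) ∧
          ∀ x y : List Bool, (∀ j ∈ s, x.getD j false = y.getD j false) →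
            (vals x).getD i false = (vals y).getD i false ∧
              (vals x).getD j false = (vals y).getD j false := by
        intro i j
        obtain ⟨s, hs, h⟩ := ih i
        obtain ⟨t, ht, h'⟩ := ih j
        refine ⟨s ∪ t, (Finset.card_union_le s t).trans ?_, fun x y hxy =>
          ⟨h x y fun l hl => hxy l (Finset.mem_union_left t hl),
            h' x y fun l hl => hxy l (Finset.mem_union_right s hl)⟩⟩
        rw [pow_succ, mul_two]
        exact Nat.add_le_add
          (hs.trans (Nat.pow_le_pow_right two_pos (le_max_left _ _)))
          (ht.trans (Nat.pow_le_pow_right two_pos (le_max_right _ _)))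
      cases g with
      | input j => exact ⟨{j}, by simp [Gate.depth], fun x y hxy => hxy j (by simp)⟩
      | const b => exact ⟨∅, by simp, fun _ _ _ => rfl⟩
      | not j =>
        obtain ⟨s, hs, h⟩ := ih j
        refine ⟨s, hs.trans (Nat.pow_le_pow_right two_pos (Nat.le_succ _)), fun x y hxy => ?_⟩
        exact congrArg (! ·) (h x y hxy)
      | and i j =>
        obtain ⟨s, hs, h⟩ := hbin i j
        exact ⟨s, hs, fun x y hxy => congrArg₂ (· && ·) (h x y hxy).1 (h x y hxy).2⟩
      | or i j =>
        obtain ⟨s, hs, h⟩ := hbin i j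
        exact ⟨s, hs, fun x y hxy => congrArg₂ (· || ·) (h x y hxy).1 (h x y hxy).2⟩
    · refine ⟨∅, by simp, fun x y _ => ?_⟩
      rw [List.getD_eq_default _ _ (by rw [List.length_append, hv]; simpa using hi),
        List.getD_eq_default _ _ (by rw [List.length_append, hv]; simpa using hi)]

theorem Circuit.exists_support (C : Circuit) (o : ℕ) (ho : o < C.outputs.length) :
    ∃ s : Finset ℕ, s.card ≤ 2 ^ C.depth ∧
      ∀ x y : List Bool, (∀ j ∈ s, x.getD j false = y.getD j false) →
        (C.eval x).getD o false = (C.eval y).getD o false := by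
  obtain ⟨s, hs, h⟩ := exists_support_gate C.gates C.outputs[o]
  refine ⟨s, hs.trans (Nat.pow_le_pow_right two_pos ?_), fun x y hxy => ?_⟩
  · rw [Circuit.depth]
    generalize C.gates.foldl (fun ds g => ds ++ [g.depth ds]) [] = ds
    generalize C.outputs[o] = i
    induction ds generalizing i with
    | nil => simp
    | cons d ds ih =>
      cases i with
      | zero => exact le_max_left _ _
      | succ i => exact (ih i).trans (le_max_right _ _)
  · have e : ∀ x, (C.eval x).getD o false =
        (C.gates.foldl (fun vals g => vals ++ [g.eval x vals]) []).getD C.outputs[o] false := by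
      intro x
      rw [Circuit.eval, List.getD_eq_getElem _ _ (by simpa using ho), List.getElem_map]
    rw [e, e]
    exact h x y hxy

/-- The schema with one flat unary relation. -/
def unarySchema : Fin 1 → Ty := fun _ => .base

/-- The query `for x in R union sng(⟨⟩)`, which counts the elements of `R`. -/
def countQuery (Base : Type) : Query Base unarySchema .unit := .forIn (.rel 0) .sngUnit

theorem viewBits_countQuery {Base : Type} {k n : ℕ} (m : ℕ) (a : Fin n ↪ Base)
    (D : DB Base k unarySchema) :
    viewBits (countQuery Base) m a D = bits ((D 0).flat.sum fun _ μ => μ) := by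
  have h : ((countQuery Base).view D).flat FVal.unit = (D 0).flat.sum fun _ μ => μ := by
    show ((D 0).flat.sum fun v μ => μ • Finsupp.single FVal.unit (1 : ZMod (2 ^ k))) FVal.unit = _
    rw [Finsupp.sum_apply]
    refine Finsupp.sum_congr fun v _ => ?_
    simp
  simp [viewBits, ShBag.blocks, Ctx.blocks, tuples, h]

/-- The lowest bit of the count depends on the multiplicity of every primitive value. -/
theorem countQuery_not_constant_depth {Base : Type} [Infinite Base] {k : ℕ} (hk : 1 ≤ k) :
    ¬ ∃ d : ℕ, ∀ (n m : ℕ) (a : Fin n ↪ Base), ∃ C : Circuit, C.depth ≤ d ∧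
      ∀ D : DB Base k unarySchema, D.Over a m →
        C.Maps (D.blocks a m).flatten (viewBits (countQuery Base) m a D) := by
  rintro ⟨d, hd⟩
  obtain ⟨a⟩ : Nonempty (Fin (2 ^ d + 1) ↪ Base) :=
    ⟨Fin.valEmbedding.trans (Infinite.natEmbedding Base)⟩
  obtain ⟨C, hC, hmaps⟩ := hd (2 ^ d + 1) 0 a
  let D : Bag Base k → DB Base k unarySchema := fun b _ => ⟨b, ()⟩
  have hover : ∀ b : Bag Base k, (∀ t, b t ≠ 0 → t ∈ tuples a (inpLabels Base 0) .base) →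
      (D b).Over a 0 := fun b hb i => ⟨hb, trivial⟩
  have hblocks : ∀ b : Bag Base k, ((D b).blocks a 0).flatten =
      (List.finRange (2 ^ d + 1)).flatMap fun j => bits (b (.base (a j))) := by
    intro b
    have h1 : List.finRange 1 = [0] := rfl
    rw [DB.blocks, h1, List.flatMap_cons, List.flatMap_nil, List.append_nil]
    show (((tuples a _ .base).map fun t => bits (b t)) ++ []).flatten = _
    rw [List.append_nil, tuples, List.map_map, ← List.flatMap_def]
    rfl
  have h0 := hmaps (D 0) (hover 0 fun t ht => absurd rfl ht)
  rw [viewBits_countQuery] at h0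
  have hlen : C.outputs.length = k := by
    have := congrArg List.length h0.2
    rwa [Circuit.eval, List.length_map, length_bits] at this
  obtain ⟨s, hs, hdep⟩ := C.exists_support 0 (by omega)
  -- the positions of the lowest bits of the multiplicities are too many to lie in `s`
  obtain ⟨j, hj⟩ : ∃ j : Fin (2 ^ d + 1), (j : ℕ) * k ∉ s := by
    by_contra hall
    push Not at hall
    have hinj : Function.Injective fun j : Fin (2 ^ d + 1) => (j : ℕ) * k := fun i j h =>
      Fin.ext (Nat.eq_of_mul_eq_mul_right hk h)
    have := Finset.card_le_card_of_injOn (s := Finset.univ) (t := s) _ (fun j _ => hall j)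
      hinj.injOn
    rw [Finset.card_univ, Fintype.card_fin] at this
    have := hs.trans (Nat.pow_le_pow_right two_pos hC)
    omega
  have h1 := hmaps (D (Finsupp.single (.base (a j)) 1)) (hover _ fun t ht => by
    rw [Finsupp.single_apply_ne_zero] at ht
    rw [ht.1]
    exact List.mem_map.2 ⟨j, List.mem_finRange j, rfl⟩)
  rw [viewBits_countQuery] at h1
  have hagree : ∀ i ∈ s, ((D 0).blocks a 0).flatten.getD i false =
      ((D (Finsupp.single (.base (a j)) 1)).blocks a 0).flatten.getD i false := by
    intro i hi
    rw [hblocks, hblocks]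
    rcases lt_or_ge i ((2 ^ d + 1) * k) with hlt | hge
    · have hq : i / k < (List.finRange (2 ^ d + 1)).length := by
        rw [List.length_finRange]
        exact Nat.div_lt_of_lt_mul (by rw [mul_comm]; exact hlt)
      have hr : i % k < k := Nat.mod_lt _ hk
      rw [← Nat.div_add_mod' i k,
        getD_flatMap_of_length _ _ k _ (fun _ _ => length_bits _) _ _ hq hr,
        getD_flatMap_of_length _ _ k _ (fun _ _ => length_bits _) _ _ hq hr, getD_bits _ hr,
        getD_bits _ hr, List.getElem_finRange]
      by_cases hij : j = Fin.cast (by simp) (⟨i / k, hq⟩ : Fin _)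
      · have hjv : (j : ℕ) = i / k := by rw [hij]; rfl
        have hpos : i % k ≠ 0 := by
          intro h
          refine hj ?_
          rw [hjv, ← Nat.add_zero (i / k * k), ← h, Nat.div_add_mod']
          exact hi
        have : Fact (1 < 2 ^ k) := ⟨Nat.one_lt_two_pow (by omega)⟩
        obtain ⟨l, hl⟩ := Nat.exists_eq_succ_of_ne_zero hpos
        rw [← hij, Finsupp.single_eq_same, ZMod.val_one, hl]
        simp [Nat.testBit_succ]
      · rw [Finsupp.single_eq_of_ne]
        · rfl
        · intro e
          exact hij (a.injective (FVal.base.inj e.symm))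
    · rw [List.getD_eq_default, List.getD_eq_default] <;>
      · rw [length_flatMap_of_length _ _ k (fun _ _ => length_bits _), List.length_finRange]
        exact hge
  have h := hdep _ _ hagree
  rw [h0.2, h1.2, getD_bits _ hk, getD_bits _ hk] at h
  have e0 : ((D (0 : Bag Base k)) 0).flat.sum (fun _ μ => μ) = 0 := Finsupp.sum_zero_index
  have e1 : ((D (Finsupp.single (.base (a j)) 1)) 0).flat.sum (fun _ μ => μ) = 1 :=
    Finsupp.sum_single_index rfl
  rw [e0, e1, testBit_zero_one hk] at h
  simp at h

end NRC

/-- Views of `NRC⁺` queries in shredded form, with multiplicities modulo `2 ^ k` in natural bit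
representation, are maintainable in LOGSPACE-uniform `NC₀` under updates of `c` cells, for every
constant `c`; re-evaluation is not in `NC₀`, even over flat relations. -/
theorem mainTheorem6 {Base : Type} :
    (∀ (r : ℕ) (S : Fin r → NRC.Ty) (B : NRC.Ty) (h : NRC.Query Base S B) (k : ℕ), 1 ≤ k →
      ∃ aux : List (NRC.AuxView Base k S), ∀ c : ℕ, ∃ (d e : ℕ) (P : NRC.Prog),
        ∀ (n m : ℕ) (p : Fin c → ℕ), Function.Injective p → (∀ j, p j < NRC.numCells S n m) →
          ∃ C : NRC.Circuit,
            C.depth ≤ d ∧ C.size ≤ (C.inputs + 2) ^ e ∧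
            P.Prints ((n + m + 2) ^ e) (n :: m :: List.ofFn p) C.encode ∧
            ∀ (a : Fin n ↪ Base) (D Δ : NRC.DB Base k S),
              D.Over a m → Δ.Over a m → NRC.SupportedAt a m Δ p →
              C.Maps (NRC.stateBits h aux m a D ++ NRC.updateBits a m Δ p)
                (NRC.stateBits h aux m a (D.add Δ))) ∧
    (Infinite Base →
      ∃ (r : ℕ) (S : Fin r → NRC.Ty) (B : NRC.Ty) (h : NRC.Query Base S B),
        (∀ i, (S i).IsTBase) ∧
        ∀ k : ℕ, 1 ≤ k → ¬ ∃ d : ℕ, ∀ (n m : ℕ) (a : Fin n ↪ Base),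
          ∃ C : NRC.Circuit, C.depth ≤ d ∧
            ∀ D : NRC.DB Base k S, D.Over a m →
              C.Maps (D.blocks a m).flatten (NRC.viewBits h m a D)) :=
  ⟨fun _ _ _ h _ hk => NRC.exists_maintenance h hk, fun _ =>
    ⟨1, NRC.unarySchema, .unit, NRC.countQuery Base, fun _ => trivial, fun _ hk =>
      NRC.countQuery_not_constant_depth hk⟩⟩
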